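/- Let $k$ be a field, $k^{\rm s}$ a separable closure of $k$, $\Gamma={\rm Gal}(k^{\rm s}/k)$, and let $B$ be a quaternion algebra over $k$ with canonical involution $\iota$. Let $n\in\{2,3\}$, let ${\rm H}_n(B)$ be the $k$-vector space of $n\times n$ Hermitian matrices over $B$ (that is, $x_{ji}=x_{ij}^\iota$ for $i\ne j$, and diagonal entries in $k$), and let $G={\rm GL}_n(B)\times{\rm GL}_2$ act on $V={\rm H}_n(B)\otimes k^2$, the space of pairs $x=(x_1,x_2)$, by $$(g_1,\begin{pmatrix}a&b\\c&d\end{pmatrix})\cdot(x_1,x_2)=(g_1(ax_1+bx_2)\,{}^tg_1^{\iota},\;g_1(cx_1+dx_2)\,{}^tg_1^{\iota}).$$ For $x\in V$ put $F_x(v)={\rm Pfaff}_n(x_1v_1+x_2v_2)$, a binary form of degree $n$, where ${\rm Pfaff}_n$ is the square root of the reduced norm of ${\rm M}_n(B)$ on ${\rm H}_n(B)$ with ${\rm Pfaff}_n(1)=1$. Let $P(x)$ be the discriminant of $F_x$, $V^{\rm ss}=\{x\in V\mid P(x)\neq0\}$, and for $x\in V^{\rm ss}(k)$ let $Z_x={\rm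 Proj}\,k[v_1,v_2]/(F_x)$. Let $\mathcal P_n$ be the set of isomorphism classes of $k$-forms of ${\rm Proj}\,k[v_1,v_2]/(v_1v_2)$ if $n=2$, and of ${\rm Proj}\,k[v_1,v_2]/(v_1v_2(v_1-v_2))$ if $n=3$; here a $k$-form of a $k$-variety $X$ is a $k$-variety $Y$ with $Y\times_kk^{\rm s}\cong X\times_kk^{\rm s}$ over $k^{\rm s}$. For $w\in V^{\rm ss}(k)$ let $G_w\subset G$ be the stabilizer of $w$. The group $G(k^{\rm s})$ acts transitively on $V^{\rm ss}(k^{\rm s})$. Let $(G/G_w)(k)$ be the set of $\Gamma$-invariant elements of $G(k^{\rm s})/G_w(k^{\rm s})$, and consider the following maps. 1. $a_w\colon G(k)\backslash V^{\rm ss}(k)\to G(k)\backslash(G/G_w)(k)$ is induced by the inverse of $gG_w\mapsto gw$. 2. $b_w\colon G(k)\backslash(G/G_w)(k)\to{\rm H}^1(k,G_w)$ takes the class of $gG_w(k^{\rm s})$ to the class of the cocycle $\sigma\mapsto g^{-1}g^\sigma$. 3. $c_w\colon{\rm H}^1(k,G_w)\to{\rm H}^1(k,{\rm Aut}(Z_w))$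 is induced by the homomorphism $G_w\to{\rm Aut}(Z_w)$, $(g_1,g_2)\mapsto(v\mapsto vg_2)$, where ${\rm Aut}(Z_w)$ acts on $Z_w$ from the right. 4. $d_w\colon{\rm H}^1(k,{\rm Aut}(Z_w))\to\mathcal P_n$ takes a class $\xi$ to the isomorphism class of the $k$-form $Y$ of $Z_w$ for which, for some isomorphism $\psi\colon Y\times_kk^{\rm s}\to Z_w\times_kk^{\rm s}$ over $k^{\rm s}$, the cocycle $\sigma\mapsto\sigma_{Z_w}\circ\psi\circ\sigma_Y^{-1}\circ\psi^{-1}$ represents $\xi$; here $\sigma_X$ is the automorphism of $X\times_kk^{\rm s}$ defined by the action of $\sigma$ on $k^{\rm s}$, which lies over the automorphism $(\sigma^{-1})^*$ of ${\rm Spec}\,k^{\rm s}$. Put $\Phi_w=d_w\circ c_w\circ b_w\circ a_w\colon G(k)\backslash V^{\rm ss}(k)\to\mathcal P_n$. Then for all $w,x\in V^{\rm ss}(k)$ the class of $Z_x$ lies in $\mathcal P_n$ and $$\Phi_w(G(k)\cdot x)=Z_x.$$ In particular, $\Phi_w$ does not depend on the choice of $w\in V^{\rm ss}(k)$. -/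

import Mathlib

universe u

namespace PrehomOrbits

/-! ### Non-abelian Galois cohomology -/

section Cohomology

variable (Γ : Type*) [Group Γ] [TopologicalSpace Γ]

/-- A continuous 1-cocycle of the topological group `Γ` with values in the discrete group `A`,
on which `Γ` acts on the left. -/
structure OneCocycle (A : Type*) [Group A] [MulDistribMulAction Γ A] where
  toFun : Γ → A
  isLocallyConstant : IsLocallyConstant toFun
  map_mul : ∀ σ τ : Γ, toFun (σ * τ) = toFun σ * σ • toFun τ

variable {Γ}
variable {A : Type*} [Group A] [MulDistribMulAction Γ A]
variable {A' : Type*} [Group A'] [MulDistribMulAction Γ A']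

/-- Two 1-cocycles are equivalent if `h₂ σ = g⁻¹ * h₁ σ * σ(g)` for some `g`. -/
def OneCocycle.setoid : Setoid (OneCocycle Γ A) where
  r h₁ h₂ := ∃ g : A, ∀ σ : Γ, h₂.toFun σ = g⁻¹ * h₁.toFun σ * σ • g
  iseqv :=
    { refl := fun h => ⟨1, fun σ => by simp⟩
      symm := by
        rintro h₁ h₂ ⟨g, hg⟩
        refine ⟨g⁻¹, fun σ => ?_⟩
        simp [hg, mul_assoc]
      trans := by
        rintro h₁ h₂ h₃ ⟨g, hg⟩ ⟨g', hg'⟩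
        refine ⟨g * g', fun σ => ?_⟩
        simp [hg, hg', mul_assoc] }

variable (Γ A) in
/-- The first cohomology set. -/
def H1 : Type _ := Quotient (OneCocycle.setoid (Γ := Γ) (A := A))

/-- The class of a 1-cocycle. -/
def OneCocycle.cls (h : OneCocycle Γ A) : H1 Γ A := Quotient.mk OneCocycle.setoid h

/-- The image of a 1-cocycle under an equivariant homomorphism. -/
def OneCocycle.map (f : A →* A') (hf : ∀ (σ : Γ) (x : A), f (σ • x) = σ • f x)
    (h : OneCocycle Γ A) : OneCocycle Γ A' where
  toFun σ := f (h.toFun σ)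
  isLocallyConstant := h.isLocallyConstant.comp f
  map_mul σ τ := by rw [h.map_mul, _root_.map_mul, hf]

/-- The map on cohomology sets induced by an equivariant homomorphism. -/
def H1.map (f : A →* A') (hf : ∀ (σ : Γ) (x : A), f (σ • x) = σ • f x) : H1 Γ A → H1 Γ A' :=
  Quotient.map (sa := OneCocycle.setoid) (sb := OneCocycle.setoid) (OneCocycle.map f hf) (by
    rintro h₁ h₂ ⟨g, hg⟩
    exact ⟨f g, fun σ => by simp [OneCocycle.map, hg, hf]⟩)

end Cohomology

/-! ### Quaternion algebras and Hermitian matrices -/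

/-- Structure constants of a quaternion algebra over the field `k` of arbitrary characteristic:
the algebra has the basis `1, i, j, ij` with `i² = a + b i`, `j² = c` and `ji = (b - i) j`, where
`x² - b x - a` is a separable polynomial and `c ≠ 0`. -/
structure QuaternionData (k : Type u) [Field k] where
  a : k
  b : k
  c : k
  separable : b ^ 2 + 4 * a ≠ 0
  c_ne_zero : c ≠ 0

section Quaternion

variable {k : Type u} [Field k] (Q : QuaternionData k)
variable (R : Type*) [CommRing R] [Algebra k R]
variable (S : Type*) [CommRing S] [Algebra k S]
variable (T : Type*) [CommRing T] [Algebra k T]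

/-- The base change `B ⊗ R` of the quaternion algebra. -/
abbrev Quat : Type _ :=
  QuaternionAlgebra R (algebraMap k R Q.a) (algebraMap k R Q.b) (algebraMap k R Q.c)

variable {R S T}

/-- Functoriality of `R ↦ B ⊗ R`. -/
def Quat.map (f : R →ₐ[k] S) : Quat Q R →+* Quat Q S where
  toFun q := ⟨f q.re, f q.imI, f q.imJ, f q.imK⟩
  map_zero' := by ext <;> simp
  map_one' := by ext <;> simp
  map_add' x y := by ext <;> simp
  map_mul' x y := by ext <;> simp

@[simp] lemma Quat.map_re (f : R →ₐ[k] S) (q : Quat Q R) :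
    (Quat.map Q f q).re = f q.re := rfl

@[simp] lemma Quat.map_imI (f : R →ₐ[k] S) (q : Quat Q R) :
    (Quat.map Q f q).imI = f q.imI := rfl

@[simp] lemma Quat.map_imJ (f : R →ₐ[k] S) (q : Quat Q R) :
    (Quat.map Q f q).imJ = f q.imJ := rfl

@[simp] lemma Quat.map_imK (f : R →ₐ[k] S) (q : Quat Q R) :
    (Quat.map Q f q).imK = f q.imK := rfl

lemma Quat.map_star (f : R →ₐ[k] S) (q : Quat Q R) :
    Quat.map Q f (star q) = star (Quat.map Q f q) := by
  ext <;> simp [Quat.map]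

lemma Quat.map_smul (f : R →ₐ[k] S) (r : R) (q : Quat Q R) :
    Quat.map Q f (r • q) = f r • Quat.map Q f q := by
  ext <;> simp [Quat.map]

variable {Q}

/-- The reduced trace `q + q*` of the quaternion algebra. -/
def Quat.trd (q : Quat Q R) : R := (q + star q).re

/-- The reduced norm `q q*` of the quaternion algebra. -/
def Quat.nrd (q : Quat Q R) : R := (q * star q).re

/-- `q` lies in the centre `R` of `B ⊗ R`. -/
def Quat.IsScalar (q : Quat Q R) : Prop := q.imI = 0 ∧ q.imJ = 0 ∧ q.imK = 0

variable (Q) (n : ℕ)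

variable (R) in
/-- The space `H_n(B ⊗ R)` of Hermitian matrices: `x i j = (x j i)*` for `i ≠ j`, and the diagonal
entries are scalars. (Away from characteristic 2 a quaternion is fixed by the involution if and
only if it is a scalar.) -/
def Herm : Submodule R (Matrix (Fin n) (Fin n) (Quat Q R)) where
  carrier := {x | x.conjTranspose = x ∧ ∀ i, (x i i).IsScalar}
  zero_mem' := ⟨by simp, fun i => by simp [Quat.IsScalar]⟩
  add_mem' := by
    rintro x y ⟨hx, hx'⟩ ⟨hy, hy'⟩
    refine ⟨by rw [Matrix.conjTranspose_add, hx, hy], fun i => ?_⟩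
    obtain ⟨h1, h2, h3⟩ := hx' i
    obtain ⟨h4, h5, h6⟩ := hy' i
    exact ⟨by simp [h1, h4], by simp [h2, h5], by simp [h3, h6]⟩
  smul_mem' := by
    rintro r x ⟨hx, hx'⟩
    refine ⟨?_, fun i => ?_⟩
    · refine Matrix.ext fun i j => ?_
      have h : star (x j i) = x i j := by rw [← Matrix.conjTranspose_apply, hx]
      rw [Matrix.conjTranspose_apply, Matrix.smul_apply, Matrix.smul_apply, ← h]
      ext <;> simp [mul_add]
    · obtain ⟨h1, h2, h3⟩ := hx' i
      exact ⟨by simp [h1], by simp [h2], by simp [h3]⟩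

variable {n} in
lemma herm_conj_aux (F : Fin n → Fin n → Quat Q R) (h : ∀ i j, F j i = star (F i j))
    (hd : ∀ i, (F i i).IsScalar) : (∑ i, ∑ j, F i j).IsScalar := by
  classical
  rw [← Finset.sum_product']
  have key : ∀ (p : Quat Q R →+ R), (∀ q, p (star q) = - p q) → (∀ i, p (F i i) = 0) →
      p (∑ x ∈ Finset.univ ×ˢ Finset.univ, F x.1 x.2) = 0 := by
    intro p hp hp0
    rw [map_sum]
    refine Finset.sum_involution (fun x _ => (x.2, x.1)) ?_ ?_ ?_ ?_
    · rintro ⟨i, j⟩ -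
      simp [h i j, hp]
    · rintro ⟨i, j⟩ - hne heq
      simp only [Prod.mk.injEq] at heq
      obtain ⟨rfl, -⟩ := heq
      exact hne (hp0 _)
    · simp
    · simp
  exact ⟨key ⟨⟨fun q => q.imI, rfl⟩, fun _ _ => rfl⟩ (fun q => by simp) (fun i => (hd i).1),
    key ⟨⟨fun q => q.imJ, rfl⟩, fun _ _ => rfl⟩ (fun q => by simp) (fun i => (hd i).2.1),
    key ⟨⟨fun q => q.imK, rfl⟩, fun _ _ => rfl⟩ (fun q => by simp) (fun i => (hd i).2.2)⟩

lemma Quat.IsScalar.conj {d : Quat Q R} (hd : d.IsScalar) (q : Quat Q R) :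
    (q * d * star q).IsScalar := by
  obtain ⟨h1, h2, h3⟩ := hd
  refine ⟨?_, ?_, ?_⟩ <;> simp [h1, h2, h3] <;> ring

lemma herm_conj (g x : Matrix (Fin n) (Fin n) (Quat Q R)) (hx : x ∈ Herm Q R n) :
    g * x * g.conjTranspose ∈ Herm Q R n := by
  obtain ⟨hx, hx'⟩ := hx
  refine ⟨by simp [Matrix.conjTranspose_mul, hx, mul_assoc], fun i => ?_⟩
  have : (g * x * g.conjTranspose) i i = ∑ l, ∑ j, g i j * x j l * star (g i l) := by
    simp [Matrix.mul_apply, Finset.sum_mul]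
  rw [this]
  refine herm_conj_aux Q _ (fun l j => ?_) (fun j => Quat.IsScalar.conj Q (hx' j) _)
  have h : star (x j l) = x l j := by rw [← Matrix.conjTranspose_apply, hx]
  simp [h, mul_assoc]


/-- Functoriality of `R ↦ H_n(B ⊗ R)`. -/
def Herm.map (f : R →ₐ[k] S) (x : Herm Q R n) : Herm Q S n :=
  ⟨x.1.map (Quat.map Q f), by
    obtain ⟨x, hx, hx'⟩ := x
    refine ⟨?_, fun i => ?_⟩
    · refine Matrix.ext fun i j => ?_
      have h : star (x j i) = x i j := by rw [← Matrix.conjTranspose_apply, hx]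
      rw [Matrix.conjTranspose_apply, Matrix.map_apply, Matrix.map_apply, ← Quat.map_star, h]
    · obtain ⟨h1, h2, h3⟩ := hx' i
      exact ⟨by simp [Quat.map, h1], by simp [Quat.map, h2], by simp [Quat.map, h3]⟩⟩

/-- The form `Pfaff_n` for `n = 2, 3`: the square root of the reduced norm of `M_n(B ⊗ R)` on
`H_n(B ⊗ R)` with value `1` at the identity. (It is not used for other `n`.) -/
def pfaff {n : ℕ} (x : Matrix (Fin n) (Fin n) (Quat Q R)) : R :=
  match n, x with
  | 2, x => (x 0 0).re * (x 1 1).re - (x 0 1).nrd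
  | 3, x => (x 0 0).re * (x 1 1).re * (x 2 2).re + (x 0 1 * x 1 2 * x 2 0).trd
      - (x 0 0).re * (x 1 2).nrd - (x 1 1).re * (x 2 0).nrd - (x 2 2).re * (x 0 1).nrd
  | _, _ => 0

lemma pfaff_one (hn : n = 2 ∨ n = 3) : pfaff Q (1 : Matrix (Fin n) (Fin n) (Quat Q R)) = 1 := by
  rcases hn with rfl | rfl <;> simp [pfaff, Quat.nrd, Quat.trd]

lemma Quat.nrd_map (f : R →ₐ[k] S) (q : Quat Q R) : (Quat.map Q f q).nrd = f q.nrd := by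
  unfold Quat.nrd
  rw [← Quat.map_star, ← map_mul]
  rfl

lemma Quat.trd_map (f : R →ₐ[k] S) (q : Quat Q R) : (Quat.map Q f q).trd = f q.trd := by
  unfold Quat.trd
  rw [← Quat.map_star, ← map_add]
  rfl

lemma pfaff_map (f : R →ₐ[k] S) (x : Matrix (Fin n) (Fin n) (Quat Q R)) :
    pfaff Q (x.map (Quat.map Q f)) = f (pfaff Q x) := by
  match n, x with
  | 2, x =>
    simp only [pfaff, Matrix.map_apply, Quat.nrd_map, map_sub, map_mul f]
    rfl
  | 3, x =>
    simp only [pfaff, Matrix.map_apply, ← map_mul (Quat.map Q f), Quat.nrd_map, Quat.trd_map,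
      map_add, map_sub, map_mul f]
    rfl
  | 0, x => simp [pfaff]
  | 1, x => simp [pfaff]
  | (m + 4), x => simp [pfaff]

/-- A splitting of `B ⊗ R` by `2 × 2` matrices, given a root `t` of `x² = b x + a` in `R`. -/
def Quat.split (t : R) (ht : t ^ 2 = algebraMap k R Q.b * t + algebraMap k R Q.a) :
    Quat Q R →+* Matrix (Fin 2) (Fin 2) R where
  toFun q := !![q.re + q.imI * t, algebraMap k R Q.c * (q.imJ + q.imK * t);
    q.imJ + q.imK * (algebraMap k R Q.b - t), q.re + q.imI * (algebraMap k R Q.b - t)]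
  map_zero' := by ext i j; fin_cases i <;> fin_cases j <;> simp
  map_one' := by ext i j; fin_cases i <;> fin_cases j <;> simp
  map_add' x y := by ext i j; fin_cases i <;> fin_cases j <;> simp <;> ring
  map_mul' x y := by
    have ha : algebraMap k R Q.a = t ^ 2 - algebraMap k R Q.b * t := by rw [ht]; ring
    ext i j
    fin_cases i <;> fin_cases j <;> simp [Matrix.mul_apply, Fin.sum_univ_two, ha] <;> ring

/-- The induced embedding of `M_n(B ⊗ R)` into the matrices of size `2n`; its determinant is the
reduced norm. -/
def Quat.splitMat (t : R) (ht : t ^ 2 = algebraMap k R Q.b * t + algebraMap k R Q.a) :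
    Matrix (Fin n) (Fin n) (Quat Q R) →+* Matrix (Fin n × Fin 2) (Fin n × Fin 2) R :=
  (Matrix.compRingEquiv (Fin n) (Fin 2) R).toRingHom.comp (Quat.split Q t ht).mapMatrix

lemma Quat.split_star (t : R) (ht : t ^ 2 = algebraMap k R Q.b * t + algebraMap k R Q.a)
    (q : Quat Q R) :
    Quat.split Q t ht (star q) = !![Quat.split Q t ht q 1 1, -Quat.split Q t ht q 0 1;
      -Quat.split Q t ht q 1 0, Quat.split Q t ht q 0 0] := by
  ext i j
  fin_cases i <;> fin_cases j <;> simp [Quat.split] <;> ring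

lemma Quat.split_scalar (t : R) (ht : t ^ 2 = algebraMap k R Q.b * t + algebraMap k R Q.a)
    (q : Quat Q R) (hq : q.IsScalar) : Quat.split Q t ht q = !![q.re, 0; 0, q.re] := by
  obtain ⟨h1, h2, h3⟩ := hq
  simp [Quat.split, h1, h2, h3]

lemma Quat.nrd_eq (t : R) (ht : t ^ 2 = algebraMap k R Q.b * t + algebraMap k R Q.a)
    (q : Quat Q R) : q.nrd = (Quat.split Q t ht q).det := by
  have ha : algebraMap k R Q.a = t ^ 2 - algebraMap k R Q.b * t := by rw [ht]; ring
  simp [Quat.nrd, Quat.split, Matrix.det_fin_two, ha]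
  ring

lemma Quat.trd_eq (t : R) (ht : t ^ 2 = algebraMap k R Q.b * t + algebraMap k R Q.a)
    (q : Quat Q R) : q.trd = (Quat.split Q t ht q).trace := by
  simp [Quat.trd, Quat.split, Matrix.trace_fin_two]
  ring

lemma det_aux2 {R : Type*} [CommRing R] (a b p q r s : R) :
    (!![a, 0, p, q; 0, a, r, s; s, -q, b, 0; -r, p, 0, b] : Matrix (Fin 4) (Fin 4) R).det =
      (a * b - (p * s - q * r)) ^ 2 := by
  simp [Matrix.det_succ_row_zero, Fin.sum_univ_succ, Fin.succAbove]
  ring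

set_option maxHeartbeats 4000000 in
lemma det_aux3 {R : Type*} [CommRing R] (a b d p q r s p' q' r' s' p'' q'' r'' s'' : R) :
    (!![a, 0, p, q, s', -q'; 0, a, r, s, -r', p'; s, -q, b, 0, p'', q''; -r, p, 0, b, r'', s'';
      p', q', s'', -q'', d, 0; r', s', -r'', p'', 0, d] : Matrix (Fin 6) (Fin 6) R).det =
      (a * b * d + (p * p'' * p' + p * q'' * r' + q * r'' * p' + q * s'' * r' + r * p'' * q' +
        r * q'' * s' + s * r'' * q' + s * s'' * s') - a * (p'' * s'' - q'' * r'') -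
        b * (p' * s' - q' * r') - d * (p * s - q * r)) ^ 2 := by
  simp [Matrix.det_succ_row_zero, Fin.sum_univ_succ, Fin.succAbove]
  ring

lemma Quat.splitMat_apply (t : R) (ht : t ^ 2 = algebraMap k R Q.b * t + algebraMap k R Q.a)
    (x : Matrix (Fin n) (Fin n) (Quat Q R)) (i j : Fin n) (p q : Fin 2) :
    Quat.splitMat Q n t ht x (i, p) (j, q) = Quat.split Q t ht (x i j) p q := rfl

/-- The square of `Pfaff_n` is the reduced norm. -/
lemma pfaff_sq (hn : n = 2 ∨ n = 3) (t : R)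
    (ht : t ^ 2 = algebraMap k R Q.b * t + algebraMap k R Q.a)
    (x : Matrix (Fin n) (Fin n) (Quat Q R)) (hx : x ∈ Herm Q R n) :
    (Quat.splitMat Q n t ht x).det = pfaff Q x ^ 2 := by
  obtain ⟨hx, hx'⟩ := hx
  have h (i j) : x j i = star (x i j) := by rw [← Matrix.conjTranspose_apply, hx]
  rcases hn with rfl | rfl
  · rw [← Matrix.det_reindex_self (finProdFinEquiv : Fin 2 × Fin 2 ≃ Fin 4)]
    have e0 : finProdFinEquiv.symm (0 : Fin (2 * 2)) = ((0 : Fin 2), (0 : Fin 2)) := rfl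
    have e1 : finProdFinEquiv.symm (1 : Fin (2 * 2)) = ((0 : Fin 2), (1 : Fin 2)) := rfl
    have e2 : finProdFinEquiv.symm (2 : Fin (2 * 2)) = ((1 : Fin 2), (0 : Fin 2)) := rfl
    have e3 : finProdFinEquiv.symm (3 : Fin (2 * 2)) = ((1 : Fin 2), (1 : Fin 2)) := rfl
    have key : Matrix.reindex finProdFinEquiv finProdFinEquiv (Quat.splitMat Q 2 t ht x) =
        !![(x 0 0).re, 0, Quat.split Q t ht (x 0 1) 0 0, Quat.split Q t ht (x 0 1) 0 1;
          0, (x 0 0).re, Quat.split Q t ht (x 0 1) 1 0, Quat.split Q t ht (x 0 1) 1 1;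
          Quat.split Q t ht (x 0 1) 1 1, -Quat.split Q t ht (x 0 1) 0 1, (x 1 1).re, 0;
          -Quat.split Q t ht (x 0 1) 1 0, Quat.split Q t ht (x 0 1) 0 0, 0, (x 1 1).re] := by
      ext u v
      fin_cases u <;> fin_cases v <;>
        simp [e0, e1, e2, e3, Quat.splitMat_apply, h 0 1, Quat.split_star, Quat.split_scalar, hx']
    rw [key, det_aux2]
    simp [pfaff, Quat.nrd_eq Q t ht, Matrix.det_fin_two]
  · rw [← Matrix.det_reindex_self (finProdFinEquiv : Fin 3 × Fin 2 ≃ Fin 6)]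
    have e0 : finProdFinEquiv.symm (0 : Fin (3 * 2)) = ((0 : Fin 3), (0 : Fin 2)) := rfl
    have e1 : finProdFinEquiv.symm (1 : Fin (3 * 2)) = ((0 : Fin 3), (1 : Fin 2)) := rfl
    have e2 : finProdFinEquiv.symm (2 : Fin (3 * 2)) = ((1 : Fin 3), (0 : Fin 2)) := rfl
    have e3 : finProdFinEquiv.symm (3 : Fin (3 * 2)) = ((1 : Fin 3), (1 : Fin 2)) := rfl
    have e4 : finProdFinEquiv.symm (4 : Fin (3 * 2)) = ((2 : Fin 3), (0 : Fin 2)) := rfl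
    have e5 : finProdFinEquiv.symm (5 : Fin (3 * 2)) = ((2 : Fin 3), (1 : Fin 2)) := rfl
    have key : Matrix.reindex finProdFinEquiv finProdFinEquiv (Quat.splitMat Q 3 t ht x) =
        (let M := Quat.split Q t ht (x 0 1)
        let M' := Quat.split Q t ht (x 2 0)
        let M'' := Quat.split Q t ht (x 1 2)
        !![(x 0 0).re, 0, M 0 0, M 0 1, M' 1 1, -M' 0 1;
          0, (x 0 0).re, M 1 0, M 1 1, -M' 1 0, M' 0 0;
          M 1 1, -M 0 1, (x 1 1).re, 0, M'' 0 0, M'' 0 1;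
          -M 1 0, M 0 0, 0, (x 1 1).re, M'' 1 0, M'' 1 1;
          M' 0 0, M' 0 1, M'' 1 1, -M'' 0 1, (x 2 2).re, 0;
          M' 1 0, M' 1 1, -M'' 1 0, M'' 0 0, 0, (x 2 2).re]) := by
      ext u v
      fin_cases u <;> fin_cases v <;>
        simp [e0, e1, e2, e3, e4, e5, Quat.splitMat_apply, h 0 1, h 2 0, h 1 2, Quat.split_star,
          Quat.split_scalar, hx']
    rw [key, det_aux3]
    simp [pfaff, Quat.nrd_eq Q t ht, Quat.trd_eq Q t ht, Matrix.det_fin_two, Matrix.trace_fin_two,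
      Matrix.mul_apply, Fin.sum_univ_two]
    ring


/-! ### The group `G = GL_n(B) × GL_2`, its representation `V = H_n(B) ⊗ k²`, and `F_x` -/

variable (R) in
/-- The `R`-points of the group `G = GL_n(B) × GL_2`. -/
def Grp : Type _ := (Matrix (Fin n) (Fin n) (Quat Q R))ˣ × GL (Fin 2) R

instance : Group (Grp Q R n) :=
  inferInstanceAs (Group ((Matrix (Fin n) (Fin n) (Quat Q R))ˣ × GL (Fin 2) R))

/-- Functoriality of `R ↦ G(R)`. -/
def Grp.map (f : R →ₐ[k] S) : Grp Q R n →* Grp Q S n :=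
  MonoidHom.prodMap (Units.map ((Quat.map Q f).mapMatrix : _ →+* _).toMonoidHom)
    (Units.map ((f : R →+* S).mapMatrix : Matrix (Fin 2) (Fin 2) R →+* _).toMonoidHom)

variable (R) in
/-- The `R`-points of `V = H_n(B) ⊗ k²`: pairs `(x₁, x₂)` of Hermitian matrices. -/
def Vec : Type _ := Fin 2 → Herm Q R n

/-- Functoriality of `R ↦ V(R)`. -/
def Vec.map (f : R →ₐ[k] S) (x : Vec Q R n) : Vec Q S n := fun i => Herm.map Q n f (x i)

/-- The representation of `G` on `V`:
`(g₁, g₂) · (x₁, x₂) = (g₁ (a x₁ + b x₂) g₁*, g₁ (c x₁ + d x₂) g₁*)` for `g₂ = (a, b; c, d)`. -/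
instance : MulAction (Grp Q R n) (Vec Q R n) where
  smul g x := fun i => ⟨g.1.1 * (∑ j, g.2.1 i j • x j : Herm Q R n).1 * g.1.1.conjTranspose,
    herm_conj Q n _ _ (∑ j, g.2.1 i j • x j : Herm Q R n).2⟩
  one_smul x := by
    funext i
    refine Subtype.ext ?_
    change (1 : Matrix (Fin n) (Fin n) (Quat Q R)) *
      (∑ j, (1 : Matrix (Fin 2) (Fin 2) R) i j • x j : Herm Q R n).1 *
      (1 : Matrix (Fin n) (Fin n) (Quat Q R)).conjTranspose = (x i).1
    fin_cases i <;> simp [Matrix.one_apply]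
  mul_smul g h x := by
    funext i
    refine Subtype.ext ?_
    change (g.1.1 * h.1.1) * (∑ j, (g.2.1 * h.2.1) i j • x j : Herm Q R n).1 *
      (g.1.1 * h.1.1).conjTranspose = g.1.1 * (∑ j, g.2.1 i j • (⟨h.1.1 *
        (∑ l, h.2.1 j l • x l : Herm Q R n).1 * h.1.1.conjTranspose, _⟩ : Herm Q R n) :
          Herm Q R n).1 * g.1.1.conjTranspose
    have e : (∑ j, (g.2.1 * h.2.1) i j • x j : Herm Q R n) =
        ∑ j, g.2.1 i j • ∑ l, h.2.1 j l • x l := by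
      simp only [Matrix.mul_apply, Finset.sum_smul, Finset.smul_sum, mul_smul]
      exact Finset.sum_comm
    rw [e]
    simp only [Submodule.coe_sum, Submodule.coe_smul, Matrix.conjTranspose_mul, Finset.mul_sum,
      Finset.sum_mul, mul_assoc, Matrix.mul_smul, Matrix.smul_mul]

lemma Grp.smul_apply (g : Grp Q R n) (x : Vec Q R n) (i : Fin 2) :
    ((g • x) i).1 = g.1.1 * (∑ j, g.2.1 i j • (x j).1) * g.1.1.conjTranspose := by
  change g.1.1 * (∑ j, g.2.1 i j • x j : Herm Q R n).1 * g.1.1.conjTranspose = _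
  simp only [Submodule.coe_sum, Submodule.coe_smul]

lemma Herm.map_coe (f : R →ₐ[k] S) (x : Herm Q R n) :
    (Herm.map Q n f x).1 = x.1.map (Quat.map Q f) := rfl

lemma Grp.map_smul (f : R →ₐ[k] S) (g : Grp Q R n) (x : Vec Q R n) :
    Vec.map Q n f (g • x) = Grp.map Q n f g • Vec.map Q n f x := by
  funext i
  refine Subtype.ext ?_
  rw [Grp.smul_apply]
  change ((g • x) i).1.map (Quat.map Q f) = (Quat.map Q f).mapMatrix g.1.1 *
    (∑ j, f (g.2.1 i j) • (x j).1.map (Quat.map Q f)) *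
      ((Quat.map Q f).mapMatrix g.1.1).conjTranspose
  rw [Grp.smul_apply]
  have e1 : ((Quat.map Q f).mapMatrix g.1.1).conjTranspose =
      (Quat.map Q f).mapMatrix g.1.1.conjTranspose := by
    refine Matrix.ext fun i j => ?_
    simp [Matrix.conjTranspose_apply, Quat.map_star]
  have e2 (r : R) (y : Matrix (Fin n) (Fin n) (Quat Q R)) :
      f r • y.map (Quat.map Q f) = (Quat.map Q f).mapMatrix (r • y) := by
    refine Matrix.ext fun i j => ?_
    simp [Quat.map_smul]
  simp only [e1, e2, ← map_sum, ← map_mul]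
  rfl

open MvPolynomial

/-- The Hermitian matrix of linear forms `x(v) = x₁ v₁ + x₂ v₂`. -/
noncomputable def Vec.lin (x : Vec Q R n) : Herm Q (MvPolynomial (Fin 2) R) n :=
  ∑ i, (X i : MvPolynomial (Fin 2) R) •
    Herm.map Q n (IsScalarTower.toAlgHom k R (MvPolynomial (Fin 2) R)) (x i)

lemma Vec.lin_apply (x : Vec Q R n) (i j : Fin n) : (x.lin Q n).1 i j =
    (X 0 : MvPolynomial (Fin 2) R) • Quat.map Q (IsScalarTower.toAlgHom k R _) ((x 0).1 i j) +
    (X 1 : MvPolynomial (Fin 2) R) • Quat.map Q (IsScalarTower.toAlgHom k R _) ((x 1).1 i j) := by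
  rw [Vec.lin, Fin.sum_univ_two]
  rfl

/-- The binary form `F_x(v) = Pfaff_n(x(v))`. -/
noncomputable def Vec.form (x : Vec Q R n) : MvPolynomial (Fin 2) R := pfaff Q (x.lin Q n).1

lemma Vec.form_map (f : R →ₐ[k] S) (x : Vec Q R n) :
    (Vec.map Q n f x).form = MvPolynomial.map (f : R →+* S) x.form := by
  refine Eq.trans ?_ (pfaff_map Q n (MvPolynomial.mapAlgHom (σ := Fin 2) f) (x.lin Q n).1)
  unfold Vec.form
  congr 1
  refine Matrix.ext fun i j => ?_
  rw [Matrix.map_apply, Vec.lin_apply, Vec.lin_apply]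
  refine QuaternionAlgebra.ext ?_ ?_ ?_ ?_ <;>
    simp [Vec.map, Herm.map_coe]

/-- All four coordinates of the quaternion are homogeneous of degree `d`. -/
def Quat.IsHomog (q : Quat Q (MvPolynomial (Fin 2) R)) (d : ℕ) : Prop :=
  q.re.IsHomogeneous d ∧ q.imI.IsHomogeneous d ∧ q.imJ.IsHomogeneous d ∧ q.imK.IsHomogeneous d

lemma homog_aux {p : MvPolynomial (Fin 2) R} {d : ℕ} (h : p.IsHomogeneous d) (r : k) :
    (algebraMap k (MvPolynomial (Fin 2) R) r * p).IsHomogeneous d := h.C_mul _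

lemma Quat.IsHomog.star {q : Quat Q (MvPolynomial (Fin 2) R)} {d : ℕ} (h : q.IsHomog Q d) :
    (star q).IsHomog Q d := by
  obtain ⟨h1, h2, h3, h4⟩ := h
  refine ⟨?_, ?_, ?_, ?_⟩ <;> simp only [QuaternionAlgebra.re_star, QuaternionAlgebra.imI_star,
    QuaternionAlgebra.imJ_star, QuaternionAlgebra.imK_star]
  · exact h1.add (homog_aux h2 _)
  · exact h2.neg
  · exact h3.neg
  · exact h4.neg

lemma Quat.IsHomog.mul {q r : Quat Q (MvPolynomial (Fin 2) R)} {d e : ℕ} (h : q.IsHomog Q d)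
    (h' : r.IsHomog Q e) : (q * r).IsHomog Q (d + e) := by
  obtain ⟨h1, h2, h3, h4⟩ := h
  obtain ⟨h1', h2', h3', h4'⟩ := h'
  refine ⟨?_, ?_, ?_, ?_⟩ <;> simp only [QuaternionAlgebra.re_mul, QuaternionAlgebra.imI_mul,
    QuaternionAlgebra.imJ_mul, QuaternionAlgebra.imK_mul, mul_assoc] <;>
  repeat' first
    | with_reducible apply MvPolynomial.IsHomogeneous.add
    | with_reducible apply MvPolynomial.IsHomogeneous.sub
    | with_reducible apply homog_aux
    | (with_reducible apply MvPolynomial.IsHomogeneous.mul <;> assumption)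

lemma Quat.IsHomog.add {q r : Quat Q (MvPolynomial (Fin 2) R)} {d : ℕ} (h : q.IsHomog Q d)
    (h' : r.IsHomog Q d) : (q + r).IsHomog Q d :=
  ⟨h.1.add h'.1, h.2.1.add h'.2.1, h.2.2.1.add h'.2.2.1, h.2.2.2.add h'.2.2.2⟩

lemma Vec.lin_isHomog (x : Vec Q R n) (i j : Fin n) : ((x.lin Q n).1 i j).IsHomog Q 1 := by
  have e (p : MvPolynomial (Fin 2) R) (r : R) (h : p.IsHomogeneous 1) :
      (p * C r).IsHomogeneous 1 := by
    rw [mul_comm]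
    exact h.C_mul _
  rw [Vec.lin_apply]
  refine Quat.IsHomog.add Q ?_ ?_ <;>
    refine ⟨?_, ?_, ?_, ?_⟩ <;>
    exact e _ _ (isHomogeneous_X R _)

lemma Vec.form_isHomogeneous (x : Vec Q R n) : x.form.IsHomogeneous n := by
  have h := Vec.lin_isHomog Q n x
  unfold Vec.form
  generalize (x.lin Q n).1 = y at h
  match n, y with
  | 2, y =>
    exact ((h 0 0).1.mul (h 1 1).1).sub ((h 0 1).mul Q ((h 0 1).star Q)).1
  | 3, y =>
    have t := ((h 0 1).mul Q (h 1 2)).mul Q (h 2 0)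
    have N (i j) := ((h i j).mul Q ((h i j).star Q)).1
    exact ((((((h 0 0).1.mul (h 1 1).1).mul (h 2 2).1).add (t.add Q (t.star Q)).1).sub
      ((h 0 0).1.mul (N 1 2))).sub ((h 1 1).1.mul (N 2 0))).sub ((h 2 2).1.mul (N 0 1))
  | 0, y => exact isHomogeneous_zero _ _ _
  | 1, y => exact isHomogeneous_zero _ _ _
  | (m + 4), y => exact isHomogeneous_zero _ _ _

/-- The discriminant of a binary quadratic (`n = 2`) or cubic (`n = 3`) form. (It is not used for
other `n`.) -/
noncomputable def binaryDisc (F : MvPolynomial (Fin 2) R) : R :=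
  let c (i j : ℕ) : R := F.coeff (Finsupp.single 0 i + Finsupp.single 1 j)
  match n with
  | 2 => c 1 1 ^ 2 - 4 * c 2 0 * c 0 2
  | 3 => c 2 1 ^ 2 * c 1 2 ^ 2 - 4 * c 3 0 * c 1 2 ^ 3 - 4 * c 2 1 ^ 3 * c 0 3
      - 27 * c 3 0 ^ 2 * c 0 3 ^ 2 + 18 * c 3 0 * c 2 1 * c 1 2 * c 0 3
  | _ => 0

/-- The relative invariant `P(x)`: the discriminant of `F_x`. -/
noncomputable def Vec.disc (x : Vec Q R n) : R := binaryDisc n x.form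

/-- The semistable locus `V^ss = {x | P(x) ≠ 0}` (on points with values in a field). -/
def ssLocus (R : Type*) [CommRing R] [Algebra k R] : Set (Vec Q R n) := {x | x.disc ≠ 0}

/-- The linear substitution `f(v) ↦ f(v g)` in binary forms, `v` being a row vector. -/
noncomputable def subst (g : Matrix (Fin 2) (Fin 2) R) :
    MvPolynomial (Fin 2) R →ₐ[R] MvPolynomial (Fin 2) R :=
  aeval fun j => ∑ i, X i * C (g i j)

lemma subst_mul (g h : Matrix (Fin 2) (Fin 2) R) :
    subst (g * h) = (subst g).comp (subst h) := by
  refine MvPolynomial.algHom_ext fun j => ?_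
  simp [subst, Matrix.mul_apply, Fin.sum_univ_two, algHom_C, MvPolynomial.algebraMap_eq]
  ring

lemma subst_one : subst (1 : Matrix (Fin 2) (Fin 2) R) = AlgHom.id R _ := by
  refine MvPolynomial.algHom_ext fun j => ?_
  fin_cases j <;> simp [subst, Matrix.one_apply]

lemma subst_isHomogeneous (g : Matrix (Fin 2) (Fin 2) R) {F : MvPolynomial (Fin 2) R} {d : ℕ}
    (hF : F.IsHomogeneous d) : (subst g F).IsHomogeneous d := by
  have h := hF.aeval (n := 1) (fun j => ∑ i, X i * C (g i j)) (fun j => by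
    refine IsHomogeneous.sum _ _ _ fun i _ => ?_
    rw [mul_comm]
    exact (isHomogeneous_X R i).C_mul _)
  simpa [subst] using h

lemma map_subst (f : R →+* S) (g : Matrix (Fin 2) (Fin 2) R) (F : MvPolynomial (Fin 2) R) :
    MvPolynomial.map f (subst g F) = subst (g.map f) (MvPolynomial.map f F) := by
  have : (MvPolynomial.map f).comp (subst g : MvPolynomial (Fin 2) R →+* MvPolynomial (Fin 2) R) =
      (subst (g.map f) : MvPolynomial (Fin 2) S →+* MvPolynomial (Fin 2) S).comp (MvPolynomial.map f) := by
    refine MvPolynomial.ringHom_ext (fun r => ?_) fun j => ?_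
    · simp [algHom_C, MvPolynomial.algebraMap_eq]
    · simp [subst]
  exact congrArg (fun h => h F) this

lemma lin_smul (g : Grp Q R n) (x : Vec Q R n) :
    ((g • x).lin Q n).1 =
      (Quat.map Q (IsScalarTower.toAlgHom k R (MvPolynomial (Fin 2) R))).mapMatrix g.1.1 *
      (x.lin Q n).1.map (Quat.map Q ((subst g.2.1).restrictScalars k)) *
      ((Quat.map Q (IsScalarTower.toAlgHom k R (MvPolynomial (Fin 2) R))).mapMatrix
        g.1.1).conjTranspose := by
  set c : R →ₐ[k] MvPolynomial (Fin 2) R := IsScalarTower.toAlgHom k R (MvPolynomial (Fin 2) R)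
  set G := (Quat.map Q c).mapMatrix g.1.1 with hG
  have e1 : G.conjTranspose = (Quat.map Q c).mapMatrix g.1.1.conjTranspose := by
    refine Matrix.ext fun i j => ?_
    simp [hG, Matrix.conjTranspose_apply, Quat.map_star]
  have e2 : ((g • x).lin Q n).1 = ∑ i, (X i : MvPolynomial (Fin 2) R) •
      (Quat.map Q c).mapMatrix ((g • x) i).1 := by
    refine Matrix.ext fun i j => ?_
    rw [Vec.lin_apply]
    simp [Fin.sum_univ_two, c]
  have e3 : (x.lin Q n).1.map (Quat.map Q ((subst g.2.1).restrictScalars k)) =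
      ∑ i, (X i : MvPolynomial (Fin 2) R) •
        (Quat.map Q c).mapMatrix (∑ j, g.2.1 i j • (x j).1) := by
    refine Matrix.ext fun i j => ?_
    rw [Matrix.map_apply, Vec.lin_apply]
    refine QuaternionAlgebra.ext ?_ ?_ ?_ ?_ <;>
      simp [Fin.sum_univ_two, c, subst, algHom_C, MvPolynomial.algebraMap_eq] <;> ring
  rw [e2, e3, e1, Finset.mul_sum, Finset.sum_mul]
  refine Finset.sum_congr rfl fun i _ => ?_
  rw [Grp.smul_apply, Matrix.mul_smul, Matrix.smul_mul, map_mul, map_mul]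

/-- `F_{gx}(v)` divides `F_x(v g₂)`. -/
lemma form_smul_dvd (hn : n = 2 ∨ n = 3) {L : Type*} [Field L] [Algebra k L] (t : L)
    (ht : t ^ 2 = algebraMap k L Q.b * t + algebraMap k L Q.a) (g : Grp Q L n) (x : Vec Q L n) :
    (g • x).form ∣ subst g.2.1 x.form := by
  have ht' : (C t : MvPolynomial (Fin 2) L) ^ 2 =
      algebraMap k _ Q.b * C t + algebraMap k _ Q.a := by
    change _ = C (algebraMap k L Q.b) * C t + C (algebraMap k L Q.a)
    rw [← map_pow, ht, map_add, map_mul]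
  rw [← IsIntegrallyClosed.pow_dvd_pow_iff (n := 2) two_ne_zero]
  have h1 := pfaff_sq Q n hn (C t) ht' _ ((g • x).lin Q n).2
  have h2 := pfaff_sq Q n hn (C t) ht' _ (Herm.map Q n ((subst g.2.1).restrictScalars k)
    (x.lin Q n)).2
  rw [Herm.map_coe, pfaff_map] at h2
  have h3 : (subst g.2.1).restrictScalars k (pfaff Q (x.lin Q n).1) = subst g.2.1 x.form := rfl
  rw [h3] at h2
  rw [Vec.form, ← h1, ← h2, lin_smul, map_mul, map_mul, Matrix.det_mul, Matrix.det_mul]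
  set G := (Quat.map Q (IsScalarTower.toAlgHom k L (MvPolynomial (Fin 2) L))).mapMatrix g.1.1
  have hG : IsUnit G := g.1.isUnit.map _
  have hG' : IsUnit G.conjTranspose := hG.star
  have u1 : IsUnit (Quat.splitMat Q n _ ht' G).det :=
    (Matrix.isUnit_iff_isUnit_det _).1 (hG.map _)
  have u2 : IsUnit (Quat.splitMat Q n _ ht' G.conjTranspose).det :=
    (Matrix.isUnit_iff_isUnit_det _).1 (hG'.map _)
  rw [u2.mul_right_dvd, u1.mul_left_dvd]

end Quaternion

/-! ### The schemes `Proj R[v₁, v₂] / (F)` -/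

section ProjScheme

open MvPolynomial AlgebraicGeometry CategoryTheory CategoryTheory.Limits DirectSum TensorProduct

variable {R S T : Type u} [CommRing R] [CommRing S] [CommRing T] {n m : ℕ}

/-- Binary forms of degree `n`. -/
abbrev BinaryForm (R : Type u) [CommRing R] (n : ℕ) : Type u :=
  homogeneousSubmodule (Fin 2) R n

/-- The homogeneous coordinate ring `R[v₁, v₂] / (F)`. -/
abbrev CoordRing (F : BinaryForm R n) : Type u :=
  MvPolynomial (Fin 2) R ⧸ Ideal.span {(F : MvPolynomial (Fin 2) R)}

/-- The grading of `R[v₁, v₂] / (F)` by degree. -/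
noncomputable def coordGrading (F : BinaryForm R n) (d : ℕ) : Submodule R (CoordRing F) :=
  (homogeneousSubmodule (Fin 2) R d).map (Ideal.Quotient.mkₐ R (Ideal.span {F.1})).toLinearMap

attribute [local instance] MvPolynomial.gradedAlgebra

lemma span_isHomogeneous (F : BinaryForm R n) :
    (Ideal.span {F.1}).IsHomogeneous (homogeneousSubmodule (Fin 2) R) :=
  Ideal.homogeneous_span _ _ (by
    rintro x rfl
    exact ⟨n, F.2⟩)

lemma mem_coordGrading (F : BinaryForm R n) {d : ℕ} {p : MvPolynomial (Fin 2) R}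
    (hp : p ∈ homogeneousSubmodule (Fin 2) R d) :
    (Ideal.Quotient.mk (Ideal.span {F.1}) p) ∈ coordGrading F d := ⟨p, hp, rfl⟩

instance (F : BinaryForm R n) : SetLike.GradedMonoid (coordGrading F) where
  one_mem := ⟨1, isHomogeneous_one _ _, rfl⟩
  mul_mem := by
    rintro i j _ _ ⟨p, hp, rfl⟩ ⟨q, hq, rfl⟩
    exact ⟨p * q, IsHomogeneous.mul hp hq, rfl⟩

/-- The map taking a polynomial to the classes of its homogeneous components. -/
noncomputable def coordDecomposeAux (F : BinaryForm R n) :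
    MvPolynomial (Fin 2) R →+ ⨁ d, coordGrading F d :=
  (DirectSum.toAddMonoid fun d => (DirectSum.of (fun d => coordGrading F d) d).comp
    ((((Ideal.Quotient.mkₐ R (Ideal.span {F.1})).toLinearMap.restrict
      (p := homogeneousSubmodule (Fin 2) R d) (q := coordGrading F d)
      (fun p hp => ⟨p, hp, rfl⟩)).toAddMonoidHom))).comp
    (DirectSum.decomposeAddEquiv (homogeneousSubmodule (Fin 2) R)).toAddMonoidHom

lemma coordDecomposeAux_of_mem (F : BinaryForm R n) {d : ℕ} {p : MvPolynomial (Fin 2) R}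
    (hp : p ∈ homogeneousSubmodule (Fin 2) R d) :
    coordDecomposeAux F p = DirectSum.of (fun d => coordGrading F d) d ⟨_, mem_coordGrading F hp⟩ := by
  simp only [coordDecomposeAux, AddMonoidHom.comp_apply, AddEquiv.toAddMonoidHom_eq_coe,
    AddMonoidHom.coe_coe, decomposeAddEquiv_apply]
  rw [DirectSum.decompose_of_mem _ hp, DirectSum.toAddMonoid_of]
  rfl

lemma coordDecomposeAux_ker (F : BinaryForm R n) (p : MvPolynomial (Fin 2) R)
    (hp : p ∈ Ideal.span {F.1}) : coordDecomposeAux F p = 0 := by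
  classical
  rw [← DirectSum.sum_support_decompose (homogeneousSubmodule (Fin 2) R) p, map_sum]
  refine Finset.sum_eq_zero fun d _ => ?_
  rw [coordDecomposeAux_of_mem F (SetLike.coe_mem _)]
  have : (⟨_, mem_coordGrading F (SetLike.coe_mem
      (decompose (homogeneousSubmodule (Fin 2) R) p d))⟩ : coordGrading F d) = 0 :=
    Subtype.ext (Ideal.Quotient.eq_zero_iff_mem.2 (span_isHomogeneous F d hp))
  rw [this, map_zero]

/-- The decomposition of `R[v₁, v₂] / (F)` into homogeneous components. -/
noncomputable def coordDecompose (F : BinaryForm R n) :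
    CoordRing F →+ ⨁ d, coordGrading F d :=
  QuotientAddGroup.lift (Ideal.span {F.1}).toAddSubgroup (coordDecomposeAux F)
    (fun p hp => coordDecomposeAux_ker F p hp)

lemma coordDecompose_mk (F : BinaryForm R n) (p : MvPolynomial (Fin 2) R) :
    coordDecompose F (Ideal.Quotient.mk _ p) = coordDecomposeAux F p := rfl

noncomputable instance (F : BinaryForm R n) : GradedAlgebra (coordGrading F) where
  toDecomposition := DirectSum.Decomposition.ofAddHom _ (coordDecompose F)
    (by
      classical
      refine AddMonoidHom.ext fun x => ?_
      obtain ⟨p, rfl⟩ := Ideal.Quotient.mk_surjective x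
      rw [AddMonoidHom.comp_apply, coordDecompose_mk]
      conv_lhs => rw [← DirectSum.sum_support_decompose (homogeneousSubmodule (Fin 2) R) p]
      conv_rhs => rw [← DirectSum.sum_support_decompose (homogeneousSubmodule (Fin 2) R) p]
      rw [map_sum, map_sum, map_sum, AddMonoidHom.id_apply]
      refine Finset.sum_congr rfl fun d _ => ?_
      rw [coordDecomposeAux_of_mem F (SetLike.coe_mem _), DirectSum.coeAddMonoidHom_of])
    (by
      refine DirectSum.addHom_ext fun d y => ?_
      obtain ⟨_, p, hp, rfl⟩ := y
      rw [AddMonoidHom.comp_apply, DirectSum.coeAddMonoidHom_of]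
      exact coordDecomposeAux_of_mem F hp)

/-- `Proj R[v₁, v₂] / (F)`. -/
noncomputable abbrev projForm (F : BinaryForm R n) : Scheme.{u} := Proj (coordGrading F)

/-- The structure morphism `Proj R[v₁, v₂] / (F) ⟶ Spec R`. -/
noncomputable def projForm.toSpec (F : BinaryForm R n) : projForm F ⟶ Spec (.of R) :=
  Proj.toSpecZero (coordGrading F) ≫
    Spec.map (CommRingCat.ofHom (algebraMap R (coordGrading F 0)))

/-- A graded ring homomorphism `R[v₁, v₂] ⟶ S[v₁, v₂]` mapping `(F)` into `(F')`, such that the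
images of the coordinates generate the irrelevant ideal. -/
structure FormHom (F : BinaryForm R n) (F' : BinaryForm S m) where
  toRingHom : MvPolynomial (Fin 2) R →+* MvPolynomial (Fin 2) S
  homog : ∀ {d : ℕ} {p : MvPolynomial (Fin 2) R}, p.IsHomogeneous d →
    (toRingHom p).IsHomogeneous d
  mem : toRingHom F.1 ∈ Ideal.span {F'.1}
  gen : ∀ i, X i ∈ Ideal.span (Set.range fun j => toRingHom (X j))

/-- The identity. -/
noncomputable def FormHom.id (F : BinaryForm R n) : FormHom F F where
  toRingHom := RingHom.id _
  homog h := h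
  mem := Ideal.mem_span_singleton_self _
  gen i := Ideal.subset_span ⟨i, rfl⟩

lemma FormHom.map_span_le {F : BinaryForm R n} {F' : BinaryForm S m} (f : FormHom F F') :
    Ideal.span {F.1} ≤ (Ideal.span {F'.1}).comap f.toRingHom := by
  rw [Ideal.span_le]
  rintro x rfl
  exact f.mem

/-- Composition. -/
noncomputable def FormHom.comp {l : ℕ} {F : BinaryForm R n} {F' : BinaryForm S m}
    {F'' : BinaryForm T l} (g : FormHom F' F'') (f : FormHom F F') : FormHom F F'' where
  toRingHom := g.toRingHom.comp f.toRingHom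
  homog h := g.homog (f.homog h)
  mem := g.map_span_le f.mem
  gen i := by
    have h : Ideal.span (Set.range fun j => g.toRingHom (X j)) ≤
        Ideal.span (Set.range fun j => g.toRingHom (f.toRingHom (X j))) := by
      rw [Ideal.span_le]
      rintro _ ⟨j, rfl⟩
      have := Ideal.mem_map_of_mem g.toRingHom (f.gen j)
      rw [Ideal.map_span, ← Set.range_comp] at this
      exact this
    exact h (g.gen i)

@[ext] lemma FormHom.ext {F : BinaryForm R n} {F' : BinaryForm S m} {f g : FormHom F F'}
    (h : f.toRingHom = g.toRingHom) : f = g := by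
  cases f; cases g; congr

/-- The induced homomorphism of graded rings `R[v₁, v₂] / (F) ⟶ S[v₁, v₂] / (F')`. -/
noncomputable def FormHom.graded {F : BinaryForm R n} {F' : BinaryForm S m} (f : FormHom F F') :
    coordGrading F →+*ᵍ coordGrading F' where
  toRingHom := Ideal.quotientMap _ f.toRingHom f.map_span_le
  map_mem := by
    rintro d _ ⟨p, hp, rfl⟩
    exact ⟨f.toRingHom p, f.homog hp, rfl⟩

lemma FormHom.graded_mk {F : BinaryForm R n} {F' : BinaryForm S m} (f : FormHom F F')
    (p : MvPolynomial (Fin 2) R) : f.graded (Ideal.Quotient.mk _ p) =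
      Ideal.Quotient.mk _ (f.toRingHom p) := rfl

lemma FormHom.graded_comp {l : ℕ} {F : BinaryForm R n} {F' : BinaryForm S m}
    {F'' : BinaryForm T l} (g : FormHom F' F'') (f : FormHom F F') :
    (g.comp f).graded = g.graded.comp f.graded := by
  refine DFunLike.ext _ _ fun x => ?_
  obtain ⟨p, rfl⟩ := Ideal.Quotient.mk_surjective x
  rfl

lemma FormHom.graded_id (F : BinaryForm R n) :
    (FormHom.id F).graded = GradedRingHom.id (coordGrading F) := by
  refine DFunLike.ext _ _ fun x => ?_
  obtain ⟨p, rfl⟩ := Ideal.Quotient.mk_surjective x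
  rfl

lemma FormHom.irrelevant {F : BinaryForm R n} {F' : BinaryForm S m} (f : FormHom F F') :
    HomogeneousIdeal.irrelevant (coordGrading F') ≤
      (HomogeneousIdeal.irrelevant (coordGrading F)).map f.graded := by
  refine (HomogeneousIdeal.irrelevant_le _).2 ?_
  rintro d hd _ ⟨p, hp, rfl⟩
  have hp' : p ∈ Ideal.span (X '' (Set.univ : Set (Fin 2))) := by
    rw [mem_ideal_span_X_image]
    intro e he
    by_contra! hcon
    have h0 : e = 0 := Finsupp.ext fun i => hcon i trivial
    have := (MvPolynomial.mem_homogeneousSubmodule _ _).1 hp (mem_support_iff.1 he)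
    simp [h0] at this
    omega
  have h1 : Ideal.span (X '' (Set.univ : Set (Fin 2))) ≤
      Ideal.comap (Ideal.Quotient.mk (Ideal.span {F'.1}))
        ((HomogeneousIdeal.irrelevant (coordGrading F)).map f.graded).toIdeal := by
    have h2 : Ideal.span (Set.range fun j => f.toRingHom (X j)) ≤
        Ideal.comap (Ideal.Quotient.mk (Ideal.span {F'.1}))
          ((HomogeneousIdeal.irrelevant (coordGrading F)).map f.graded).toIdeal := by
      rw [Ideal.span_le]
      rintro _ ⟨j, rfl⟩
      refine Ideal.mem_map_of_mem (f := f.graded)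
        (x := Ideal.Quotient.mk (Ideal.span {F.1}) (X j)) ?_
      exact HomogeneousIdeal.mem_irrelevant_of_mem _ one_pos
        (mem_coordGrading F (isHomogeneous_X R j))
    rw [Ideal.span_le]
    rintro _ ⟨i, -, rfl⟩
    exact h2 (f.gen i)
  exact h1 hp'

/-- The induced morphism of schemes. -/
noncomputable def FormHom.proj {F : BinaryForm R n} {F' : BinaryForm S m} (f : FormHom F F') :
    projForm F' ⟶ projForm F := Proj.map f.graded f.irrelevant

lemma FormHom.proj_comp {l : ℕ} {F : BinaryForm R n} {F' : BinaryForm S m}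
    {F'' : BinaryForm T l} (g : FormHom F' F'') (f : FormHom F F') :
    (g.comp f).proj = g.proj ≫ f.proj := by
  rw [FormHom.proj, FormHom.proj, FormHom.proj, ← Proj.map_comp]
  congr 1
  exact FormHom.graded_comp g f

lemma FormHom.proj_id (F : BinaryForm R n) : (FormHom.id F).proj = 𝟙 (projForm F) := by
  refine Eq.trans ?_ Proj.map_id
  rw [FormHom.proj]
  congr 1
  exact FormHom.graded_id F

lemma FormHom.proj_toSpec {F : BinaryForm R n} {F' : BinaryForm S m} (f : FormHom F F')
    (φ : R →+* S) (h : ∀ r, f.toRingHom (C r) = C (φ r)) :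
    f.proj ≫ projForm.toSpec F = projForm.toSpec F' ≫ Spec.map (CommRingCat.ofHom φ) := by
  have key (i : ℕ) (hi : 0 < i) (s : CoordRing F) (hs : s ∈ coordGrading F i) :
      Proj.awayι (coordGrading F') (f.graded s) (f.graded.2 hs) hi ≫
        f.proj ≫ projForm.toSpec F =
      Proj.awayι (coordGrading F') (f.graded s) (f.graded.2 hs) hi ≫
        projForm.toSpec F' ≫ Spec.map (CommRingCat.ofHom φ) := by
    simp only [FormHom.proj, projForm.toSpec, Category.assoc]
    rw [Proj.awayι_comp_map_assoc _ _ hi _ hs, Proj.awayι_toSpecZero_assoc,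
      Proj.awayι_toSpecZero_assoc]
    simp only [← Spec.map_comp, ← CommRingCat.ofHom_comp]
    congr 2
    refine RingHom.ext fun r => HomogeneousLocalization.val_injective _ ?_
    have e : f.graded (algebraMap R (CoordRing F) r) = algebraMap S (CoordRing F') (φ r) :=
      congrArg (Ideal.Quotient.mk (Ideal.span {F'.1})) (h r)
    have e1 : HomogeneousLocalization.fromZeroRingHom (coordGrading F) (Submonoid.powers s)
        (algebraMap R (coordGrading F 0) r) =
        HomogeneousLocalization.mk ⟨0, algebraMap R (coordGrading F 0) r, 1, one_mem _⟩ := rfl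
    have e2 : HomogeneousLocalization.fromZeroRingHom (coordGrading F')
        (Submonoid.powers (f.graded s)) (algebraMap S (coordGrading F' 0) (φ r)) =
        HomogeneousLocalization.mk ⟨0, algebraMap S (coordGrading F' 0) (φ r), 1, one_mem _⟩ := rfl
    simp only [RingHom.comp_apply, e1, e2, HomogeneousLocalization.Away.map,
      HomogeneousLocalization.map_mk, HomogeneousLocalization.val_mk]
    refine congrArg₂ Localization.mk e (Subtype.ext ?_)
    exact map_one f.graded
  exact (Proj.mapAffineOpenCover f.graded f.irrelevant).openCover.hom_ext _ _ fun s =>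
    key s.1 s.1.2 s.2.1 s.2.2

/-! ### Base change of `Proj k[v₁, v₂] / (F)` -/

/-- The base change of a binary form along a ring homomorphism. -/
noncomputable def BinaryForm.map (f : R →+* S) (F : BinaryForm R n) : BinaryForm S n :=
  ⟨MvPolynomial.map f F.1, IsHomogeneous.map F.2 f⟩

/-- The homomorphism `R[v₁, v₂] / (F) ⟶ S[v₁, v₂] / (F)` of coordinate rings. -/
noncomputable def BinaryForm.mapHom (f : R →+* S) (F : BinaryForm R n) : FormHom F (F.map f) where
  toRingHom := MvPolynomial.map f
  homog h := h.map f
  mem := Ideal.mem_span_singleton_self _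
  gen i := Ideal.subset_span ⟨i, by simp⟩

section Pushout

open HomogeneousLocalization

lemma isPushout_mvPolynomial (f : R →+* S) :
    IsPushout (CommRingCat.ofHom f) (CommRingCat.ofHom (C : R →+* MvPolynomial (Fin 2) R))
      (CommRingCat.ofHom (C : S →+* MvPolynomial (Fin 2) S))
      (CommRingCat.ofHom (MvPolynomial.map f)) := by
  let := f.toAlgebra
  let := algebraMvPolynomial (R := R) (S := S) (σ := Fin 2)
  exact CommRingCat.isPushout_of_isPushout R S (MvPolynomial (Fin 2) R) (MvPolynomial (Fin 2) S)

lemma isPushout_coordRing (f : R →+* S) (F : BinaryForm R n) :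
    IsPushout (CommRingCat.ofHom (MvPolynomial.map (σ := Fin 2) f))
      (CommRingCat.ofHom (Ideal.Quotient.mk (Ideal.span {F.1})))
      (CommRingCat.ofHom (Ideal.Quotient.mk (Ideal.span {(F.map f).1})))
      (CommRingCat.ofHom ((F.mapHom f).graded : CoordRing F →+* CoordRing (F.map f))) := by
  refine ⟨⟨rfl⟩, ⟨PushoutCocone.IsColimit.mk _
    (fun s => CommRingCat.ofHom (Ideal.Quotient.lift _ s.inl.hom ?_)) ?_ ?_ ?_⟩⟩
  · have h : Ideal.span {(F.map f).1} ≤ RingHom.ker s.inl.hom := by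
      rw [Ideal.span_le]
      rintro _ rfl
      have e := congrArg (fun g => g.hom F.1) s.condition
      have e' : Ideal.Quotient.mk (Ideal.span {F.1}) F.1 = 0 :=
        Ideal.Quotient.eq_zero_iff_mem.2 (Ideal.mem_span_singleton_self _)
      simp only [CommRingCat.hom_comp, RingHom.comp_apply, CommRingCat.hom_ofHom, e', map_zero] at e
      exact e
    exact fun a ha => h ha
  · intro s
    refine CommRingCat.hom_ext (RingHom.ext fun p => ?_)
    rfl
  · intro s
    refine CommRingCat.hom_ext (RingHom.ext fun x => ?_)
    obtain ⟨p, rfl⟩ := Ideal.Quotient.mk_surjective x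
    exact congrArg (fun g => g.hom p) s.condition
  · intro s g h1 _
    refine CommRingCat.hom_ext (RingHom.ext fun x => ?_)
    obtain ⟨p, rfl⟩ := Ideal.Quotient.mk_surjective x
    exact congrArg (fun g => g.hom p) h1

/-- `S ⊗ A_s = A'_s` for `A = R[v₁, v₂] / (F)` and `A' = S[v₁, v₂] / (F)`. -/
lemma isPushout_localization (f : R →+* S) (F : BinaryForm R n) (s : CoordRing F)
    (h : Submonoid.powers s ≤ (Submonoid.powers ((F.mapHom f).graded s)).comap
      ((F.mapHom f).graded : CoordRing F →+* CoordRing (F.map f))) :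
    IsPushout (CommRingCat.ofHom f)
      (CommRingCat.ofHom (algebraMap R (Localization (Submonoid.powers s))))
      (CommRingCat.ofHom (algebraMap S (Localization (Submonoid.powers ((F.mapHom f).graded s)))))
      (CommRingCat.ofHom (IsLocalization.map (Localization (Submonoid.powers
        ((F.mapHom f).graded s))) ((F.mapHom f).graded : CoordRing F →+* CoordRing (F.map f)) h)) := by
  have P1 := (isPushout_mvPolynomial f).paste_vert (isPushout_coordRing f F)
  have : IsLocalization ((Submonoid.powers s).map
      ((F.mapHom f).graded : CoordRing F →+* CoordRing (F.map f)))
      (Localization (Submonoid.powers ((F.mapHom f).graded s))) := by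
    have e : (Submonoid.powers s).map
      ((F.mapHom f).graded : CoordRing F →+* CoordRing (F.map f)) =
        Submonoid.powers ((F.mapHom f).graded s) := Submonoid.map_powers _ _
    rw [e]
    infer_instance
  have P2 := CommRingCat.isPushout_of_isLocalization
    ((F.mapHom f).graded : CoordRing F →+* CoordRing (F.map f))
    (IsLocalization.map (Localization (Submonoid.powers
        ((F.mapHom f).graded s))) ((F.mapHom f).graded : CoordRing F →+* CoordRing (F.map f)) h)
    (IsLocalization.map_comp h) (Submonoid.powers s) (Rₘ := Localization (Submonoid.powers s))
  exact P1.paste_vert P2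

/-- The structure map `R ⟶ (A_s)₀` for `A = R[v₁, v₂] / (F)`. -/
noncomputable def awayStr (F : BinaryForm R n) (s : CoordRing F) :
    R →+* Away (coordGrading F) s :=
  (fromZeroRingHom (coordGrading F) (Submonoid.powers s)).comp (algebraMap R (coordGrading F 0))

lemma val_awayStr (F : BinaryForm R n) (s : CoordRing F) (r : R) :
    (awayStr F s r).val = algebraMap R (Localization (Submonoid.powers s)) r := rfl

lemma val_awayMap' (f : R →+* S) (F : BinaryForm R n) (s : CoordRing F)
    (h : Submonoid.powers s ≤ (Submonoid.powers ((F.mapHom f).graded s)).comap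
      ((F.mapHom f).graded : CoordRing F →+* CoordRing (F.map f)))
    (x : Away (coordGrading F) s) :
    (Away.map (F.mapHom f).graded s x).val =
      IsLocalization.map (Localization (Submonoid.powers
        ((F.mapHom f).graded s))) ((F.mapHom f).graded : CoordRing F →+* CoordRing (F.map f)) h
        x.val := by
  obtain ⟨c, rfl⟩ := HomogeneousLocalization.mk_surjective x
  rw [Away.map, HomogeneousLocalization.map_mk, HomogeneousLocalization.val_mk,
    HomogeneousLocalization.val_mk, Localization.mk_eq_mk', Localization.mk_eq_mk',
    IsLocalization.map_mk']
  rfl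

lemma isPushout_of_injective {k K A A' L L' : Type u} [Field k] [Field K] [CommRing A]
    [CommRing A'] [CommRing L] [CommRing L'] (f : k →+* K) (a : k →+* A) (a' : K →+* A')
    (g : A →+* A') (l : A →+* L) (l' : A' →+* L') (h : L →+* L')
    (P : IsPushout (CommRingCat.ofHom f) (CommRingCat.ofHom (l.comp a))
      (CommRingCat.ofHom (l'.comp a')) (CommRingCat.ofHom h))
    (e : h.comp l = l'.comp g) (hl : Function.Injective l) (hl' : Function.Injective l')
    (gen : ∀ x : A', x ∈ AddSubgroup.closure (Set.range fun p : K × A => a' p.1 * g p.2)) :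
    IsPushout (CommRingCat.ofHom f) (CommRingCat.ofHom a)
      (CommRingCat.ofHom a') (CommRingCat.ofHom g) := by
  let := f.toAlgebra
  let := a.toAlgebra
  let := a'.toAlgebra
  let := g.toAlgebra
  let := (a'.comp f).toAlgebra
  let := (l.comp a).toAlgebra
  let := (l'.comp a').toAlgebra
  let := h.toAlgebra
  let := ((l'.comp a').comp f).toAlgebra
  have t1 : IsScalarTower k K A' := .of_algebraMap_eq' rfl
  have t3 : IsScalarTower k K L' := .of_algebraMap_eq' rfl
  have t4 : IsScalarTower k L L' := .of_algebraMap_eq' (congrArg CommRingCat.Hom.hom P.w)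
  have t2 : IsScalarTower k A A' := by
    refine .of_algebraMap_eq' (RingHom.ext fun r => hl' ?_)
    exact (congrArg (fun g => g.hom r) P.w).trans (congrArg (fun φ => φ (a r)) e)
  have B : Algebra.IsPushout k K L L' := CommRingCat.isPushout_iff_isPushout.1 P
  refine CommRingCat.isPushout_iff_isPushout.2 ⟨?_⟩
  let la : A →ₐ[k] L := { l with commutes' := fun r => rfl }
  let Φ : K ⊗[k] A →ₐ[K] A' := Algebra.TensorProduct.lift (Algebra.ofId K A')
      (IsScalarTower.toAlgHom k A A') (fun _ _ => .all _ _)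
  have hΦ (c : K) (y : A) : Φ (c ⊗ₜ y) = a' c * g y := Algebra.TensorProduct.lift_tmul ..
  have key : ∀ z : K ⊗[k] A, l' (Φ z) = B.out.equiv (la.toLinearMap.lTensor K z) := by
    intro z
    induction z with
    | zero => simp
    | add x y hx hy => simp only [map_add, hx, hy]
    | tmul c x =>
      have e1 : l' (g x) = h (l x) := (congrArg (fun φ => φ x) e).symm
      have e2 : B.out.equiv (c ⊗ₜ[k] l x) = c • h (l x) := B.out.equiv_tmul c (l x)
      have e3 : c • h (l x) = l' (a' c) * h (l x) := rfl
      rw [hΦ, map_mul, e1, ← e3, ← e2]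
      rfl
  have hinj : Function.Injective (la.toLinearMap.lTensor K) :=
    Module.Flat.lTensor_preserves_injective_linearMap _ hl
  refine IsBaseChange.of_equiv (LinearEquiv.ofBijective Φ.toLinearMap
    ⟨fun z z' hz => ?_, fun x => ?_⟩) fun x => ?_
  · refine hinj (B.out.equiv.injective ?_)
    rw [← key, ← key]
    exact congrArg l' hz
  · refine AddSubgroup.closure_induction (p := fun x _ => ∃ z, Φ z = x)
      ?_ ⟨0, map_zero _⟩ ?_ ?_ (gen x)
    · rintro _ ⟨⟨c, y⟩, rfl⟩
      exact ⟨c ⊗ₜ y, hΦ c y⟩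
    · rintro x y _ _ ⟨z, rfl⟩ ⟨z', rfl⟩
      exact ⟨z + z', map_add _ _ _⟩
    · rintro x _ ⟨z, rfl⟩
      exact ⟨-z, map_neg _ _⟩
  · exact (hΦ 1 x).trans (by rw [map_one, one_mul]; rfl)

/-- `S ⊗ (A_s)₀ = (A'_s)₀` for `A = k[v₁, v₂] / (F)` and `A' = K[v₁, v₂] / (F)`. -/
lemma isPushout_away {k K : Type u} [Field k] [Field K] (f : k →+* K) (F : BinaryForm k n)
    {d : ℕ} (s : CoordRing F) (hs : s ∈ coordGrading F d) :
    IsPushout (CommRingCat.ofHom f) (CommRingCat.ofHom (awayStr F s))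
      (CommRingCat.ofHom (awayStr (F.map f) ((F.mapHom f).graded s)))
      (CommRingCat.ofHom (Away.map (F.mapHom f).graded s)) := by
  have h : Submonoid.powers s ≤ (Submonoid.powers ((F.mapHom f).graded s)).comap
      ((F.mapHom f).graded : CoordRing F →+* CoordRing (F.map f)) := by
    rintro _ ⟨n, rfl⟩
    exact ⟨n, by simp⟩
  refine isPushout_of_injective f _ _ _ (algebraMap _ (Localization (Submonoid.powers s)))
    (algebraMap _ (Localization (Submonoid.powers ((F.mapHom f).graded s)))) _
    (isPushout_localization f F s h) (RingHom.ext fun x => (val_awayMap' f F s h x).symm)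
    (HomogeneousLocalization.val_injective _) (HomogeneousLocalization.val_injective _) fun x => ?_
  obtain ⟨m, _, ⟨p, hp, rfl⟩, rfl⟩ := Away.mk_surjective _ ((F.mapHom f).graded.2 hs) x
  set T := AddSubgroup.closure (Set.range fun p : K × Away (coordGrading F) s =>
    awayStr (F.map f) ((F.mapHom f).graded s) p.1 * Away.map (F.mapHom f).graded s p.2)
  let μ : homogeneousSubmodule (Fin 2) K (m • d) →+ 
      Away (coordGrading (F.map f)) ((F.mapHom f).graded s) :=
    { toFun := fun q => Away.mk _ ((F.mapHom f).graded.2 hs) m _ (mem_coordGrading _ q.2)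
      map_zero' := HomogeneousLocalization.val_injective _ (by
        simp [Away.val_mk, Localization.mk_zero])
      map_add' := fun q q' => HomogeneousLocalization.val_injective _ (by
        simp [Away.val_mk, Localization.add_mk_self]) }
  have hμ (q : MvPolynomial (Fin 2) K) (hq : q ∈ homogeneousSubmodule (Fin 2) K (m • d)) :
      μ ⟨q, hq⟩ ∈ T := by
    have hq' (e : q.support) : Finsupp.degree e.1 = m • d := by
      rw [Finsupp.degree_eq_weight_one]
      exact hq (mem_support_iff.1 e.2)
    have : (⟨q, hq⟩ : homogeneousSubmodule (Fin 2) K (m • d)) =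
        ∑ e ∈ q.support.attach, ⟨monomial e.1 (q.coeff e.1),
          isHomogeneous_monomial _ (hq' e)⟩ := by
      refine Subtype.ext ?_
      rw [Submodule.coe_sum]
      exact q.as_sum.trans (Finset.sum_attach q.support fun e => monomial e (q.coeff e)).symm
    rw [this, map_sum]
    refine sum_mem fun e _ => AddSubgroup.subset_closure ⟨(q.coeff e.1, Away.mk _ hs m _
      (mem_coordGrading F (p := monomial e.1 1)
        (isHomogeneous_monomial _ (hq' e)))), ?_⟩
    refine HomogeneousLocalization.val_injective _ ?_
    have e1 : (Away.map (F.mapHom f).graded s (Away.mk _ hs m _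
        (mem_coordGrading F (p := monomial e.1 1) (isHomogeneous_monomial _ (hq' e))))).val =
        Localization.mk (Ideal.Quotient.mk _ (monomial e.1 1))
          (⟨(F.mapHom f).graded s ^ m, m, rfl⟩ : Submonoid.powers ((F.mapHom f).graded s)) := by
      rw [Away.map_mk, Away.val_mk]
      simp [FormHom.graded_mk, BinaryForm.mapHom]
    have e2 : (awayStr (F.map f) ((F.mapHom f).graded s) (q.coeff e.1)).val =
        Localization.mk (Ideal.Quotient.mk _ (C (q.coeff e.1))) 1 :=
      (Localization.mk_algebraMap (q.coeff e.1)).symm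
    have hs' : (F.mapHom f).graded s ∈ coordGrading (F.map f) d := (F.mapHom f).graded.2 hs
    change _ = (Away.mk _ hs' m _ _).val
    rw [Away.val_mk]
    dsimp only
    rw [HomogeneousLocalization.val_mul, e1, e2, Localization.mk_mul, ← map_mul, C_mul_monomial,
      mul_one, one_mul]
  exact hμ p hp

lemma isPullback_away {k K : Type u} [Field k] [Field K] (f : k →+* K) (F : BinaryForm k n)
    {d : ℕ} (hd : 0 < d) (s : CoordRing F) (hs : s ∈ coordGrading F d)
    (hs' : (F.mapHom f).graded s ∈ coordGrading (F.map f) d) :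
    IsPullback (Proj.awayι (coordGrading (F.map f)) ((F.mapHom f).graded s) hs' hd)
      (Spec.map (CommRingCat.ofHom (Away.map (F.mapHom f).graded s)))
      (F.mapHom f).proj (Proj.awayι (coordGrading F) s hs hd) := by
  refine (IsOpenImmersion.isPullback _ _ _ _ (Proj.awayι_comp_map _ _ hd _ hs) ?_).flip
  rw [Proj.opensRange_awayι, Proj.opensRange_awayι]
  rfl

lemma awayι_toSpec (F : BinaryForm R n) {d : ℕ} (hd : 0 < d) (s : CoordRing F)
    (hs : s ∈ coordGrading F d) :
    Proj.awayι (coordGrading F) s hs hd ≫ projForm.toSpec F =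
      Spec.map (CommRingCat.ofHom (awayStr F s)) := by
  rw [projForm.toSpec, Proj.awayι_toSpecZero_assoc, ← Spec.map_comp, ← CommRingCat.ofHom_comp]
  rfl

/-- `Proj K[v₁, v₂] / (F)` is the base change of `Proj k[v₁, v₂] / (F)`. -/
lemma isPullback_projForm {k K : Type u} [Field k] [Field K] (f : k →+* K) (F : BinaryForm k n) :
    IsPullback (F.mapHom f).proj (projForm.toSpec (F.map f)) (projForm.toSpec F)
      (Spec.map (CommRingCat.ofHom f)) := by
  refine Scheme.isPullback_of_openCover _ _ _ _ (Proj.affineOpenCover (coordGrading F)).openCover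
    fun i => ?_
  obtain ⟨d, s, hs⟩ := i
  have hs' : (F.mapHom f).graded s ∈ coordGrading (F.map f) d := (F.mapHom f).graded.2 hs
  have P1 := isPullback_away f F d.2 s hs hs'
  have P2 := isPullback_SpecMap_of_isPushout _ _ _ _ (isPushout_away f F s hs)
  let e := P1.isoIsPullback _ _ (IsPullback.of_hasPullback (F.mapHom f).proj
    (Proj.awayι (coordGrading F) s hs d.2))
  refine P2.flip.of_iso e (Iso.refl _) (Iso.refl _) (Iso.refl _) ?_ ?_ ?_ ?_
  · exact (Category.comp_id _).trans (P1.isoIsPullback_hom_snd _ _ _).symm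
  · have e1 : e.hom ≫ pullback.fst _ _ = _ := P1.isoIsPullback_hom_fst _ _ _
    refine (Category.comp_id _).trans (Eq.trans ?_ (Category.assoc _ _ _))
    refine Eq.trans ?_ (congrArg (· ≫ projForm.toSpec (F.map f)) e1.symm)
    exact (awayι_toSpec _ _ _ _).symm
  · exact (Category.comp_id _).trans ((awayι_toSpec F d.2 s hs).symm.trans
      (Category.id_comp _).symm)
  · exact (Category.comp_id _).trans (Category.id_comp _).symm

end Pushout
end ProjScheme

/-! ### Galois action on base changes, and `k`-forms -/

section Forms

open AlgebraicGeometry CategoryTheory CategoryTheory.Limits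

variable {k : Type u} [Field k] (K : Type u) [Field K] [Algebra k K]

/-- The morphism `Spec K ⟶ Spec k`. -/
noncomputable abbrev specMap (k : Type u) [Field k] (K : Type u) [Field K] [Algebra k K] :
    Spec (.of K) ⟶ Spec (.of k) :=
  Spec.map (CommRingCat.ofHom (algebraMap k K))

/-- The base change `X ×_k K` of a `k`-scheme, as a `K`-scheme. -/
noncomputable abbrev geom (X : Over (Spec (.of k))) : Over (Spec (.of K)) :=
  Over.mk (pullback.snd X.hom (specMap k K))

variable {K}

/-- The automorphism `(σ⁻¹)*` of `Spec K`. -/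
noncomputable def galSpec (σ : K ≃ₐ[k] K) : Spec (.of K) ⟶ Spec (.of K) :=
  Spec.map (CommRingCat.ofHom ((σ⁻¹ : K ≃ₐ[k] K) : K →+* K))

lemma galSpec_specMap (σ : K ≃ₐ[k] K) : galSpec σ ≫ specMap k K = specMap k K := by
  rw [galSpec, specMap, ← Spec.map_comp, ← CommRingCat.ofHom_comp]
  congr 2
  exact RingHom.ext fun x => (σ⁻¹).commutes x

lemma galSpec_one : galSpec (1 : K ≃ₐ[k] K) = 𝟙 _ := by
  rw [galSpec, ← Spec.map_id]
  rfl

lemma galSpec_mul (σ τ : K ≃ₐ[k] K) : galSpec (σ * τ) = galSpec τ ≫ galSpec σ := by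
  rw [galSpec, galSpec, galSpec, ← Spec.map_comp, ← CommRingCat.ofHom_comp, mul_inv_rev]
  rfl

variable (X Y Z : Over (Spec (.of k)))

/-- The automorphism `σ_X` of the scheme `X ×_k K`, lying over the automorphism `(σ⁻¹)*` of
`Spec K`. -/
noncomputable def galAct (σ : K ≃ₐ[k] K) : (geom K X).left ⟶ (geom K X).left :=
  pullback.lift (pullback.fst _ _) (pullback.snd _ _ ≫ galSpec σ)
    (by rw [Category.assoc, galSpec_specMap, pullback.condition])

lemma galAct_snd (σ : K ≃ₐ[k] K) :
    galAct X σ ≫ pullback.snd X.hom (specMap k K) = pullback.snd _ _ ≫ galSpec σ :=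
  pullback.lift_snd _ _ _

lemma galAct_fst (σ : K ≃ₐ[k] K) :
    galAct X σ ≫ pullback.fst X.hom (specMap k K) = pullback.fst _ _ :=
  pullback.lift_fst _ _ _

lemma galAct_one : galAct X (1 : K ≃ₐ[k] K) = 𝟙 _ := by
  refine pullback.hom_ext ?_ ?_
  · simp [galAct_fst]
  · simp [galAct_snd, galSpec_one]

lemma galAct_mul (σ τ : K ≃ₐ[k] K) : galAct X (σ * τ) = galAct X τ ≫ galAct X σ := by
  refine pullback.hom_ext ?_ ?_
  · rw [galAct_fst, Category.assoc, galAct_fst, galAct_fst]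
  · rw [galAct_snd, Category.assoc, galAct_snd, ← Category.assoc, galAct_snd, Category.assoc,
      galSpec_mul]

lemma galAct_inv_comp (σ : K ≃ₐ[k] K) : galAct X σ⁻¹ ≫ galAct X σ = 𝟙 _ := by
  rw [← galAct_mul, mul_inv_cancel, galAct_one]

lemma galAct_comp_inv (σ : K ≃ₐ[k] K) : galAct X σ ≫ galAct X σ⁻¹ = 𝟙 _ := by
  rw [← galAct_mul, inv_mul_cancel, galAct_one]

variable {X Y Z}

/-- The conjugate `σ_Y ∘ α ∘ σ_X⁻¹` of a morphism `α : X ×_k K ⟶ Y ×_k K` over `K`. -/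
noncomputable def galHom (σ : K ≃ₐ[k] K) (α : geom K X ⟶ geom K Y) : geom K X ⟶ geom K Y :=
  Over.homMk (galAct X σ⁻¹ ≫ α.left ≫ galAct Y σ) (by
    have h : α.left ≫ pullback.snd Y.hom (specMap k K) = pullback.snd X.hom (specMap k K) :=
      Over.w α
    change (galAct X σ⁻¹ ≫ α.left ≫ galAct Y σ) ≫ pullback.snd _ _ = pullback.snd _ _
    rw [Category.assoc, Category.assoc, galAct_snd, ← Category.assoc α.left, h, ← Category.assoc,
      galAct_snd, Category.assoc, ← galSpec_mul, mul_inv_cancel, galSpec_one, Category.comp_id])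

lemma galHom_left (σ : K ≃ₐ[k] K) (α : geom K X ⟶ geom K Y) :
    (galHom σ α).left = galAct X σ⁻¹ ≫ α.left ≫ galAct Y σ := rfl

lemma galHom_id (σ : K ≃ₐ[k] K) : galHom σ (𝟙 (geom K X)) = 𝟙 _ := by
  refine Over.OverMorphism.ext ?_
  rw [galHom_left, Over.id_left, Category.id_comp, galAct_inv_comp]

lemma galHom_comp (σ : K ≃ₐ[k] K) (α : geom K X ⟶ geom K Y) (β : geom K Y ⟶ geom K Z) :
    galHom σ (α ≫ β) = galHom σ α ≫ galHom σ β := by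
  refine Over.OverMorphism.ext ?_
  rw [Over.comp_left, galHom_left, galHom_left, galHom_left, Over.comp_left]
  simp only [Category.assoc]
  rw [← Category.assoc (galAct Y σ), galAct_comp_inv, Category.id_comp]

lemma galHom_one (α : geom K X ⟶ geom K Y) : galHom 1 α = α := by
  refine Over.OverMorphism.ext ?_
  rw [galHom_left, inv_one, galAct_one, galAct_one, Category.id_comp, Category.comp_id]

lemma galHom_mul (σ τ : K ≃ₐ[k] K) (α : geom K X ⟶ geom K Y) :
    galHom (σ * τ) α = galHom σ (galHom τ α) := by
  refine Over.OverMorphism.ext ?_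
  simp only [galHom_left, mul_inv_rev, galAct_mul, Category.assoc]

/-- The conjugate of an isomorphism. -/
noncomputable def galIso (σ : K ≃ₐ[k] K) (α : geom K X ≅ geom K Y) : geom K X ≅ geom K Y where
  hom := galHom σ α.hom
  inv := galHom σ α.inv
  hom_inv_id := by rw [← galHom_comp, α.hom_inv_id, galHom_id]
  inv_hom_id := by rw [← galHom_comp, α.inv_hom_id, galHom_id]

variable (K X)

/-- The group `Aut(X)(K)` of `K`-automorphisms of `X ×_k K`. It acts on `X ×_k K` from the right:
`α * β` is `α` followed by `β`. -/
noncomputable def GeomAut : Type u := geom K X ≅ geom K X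

noncomputable instance : Group (GeomAut K X) where
  mul α β := Iso.trans α β
  one := Iso.refl _
  inv α := Iso.symm α
  mul_assoc α β γ := Iso.trans_assoc α β γ
  one_mul α := Iso.refl_trans α
  mul_one α := Iso.trans_refl α
  inv_mul_cancel α := Iso.symm_self_id α

/-- The Galois action `α ↦ σ_X ∘ α ∘ σ_X⁻¹` on `Aut(X)(K)`. -/
noncomputable instance : MulDistribMulAction (K ≃ₐ[k] K) (GeomAut K X) where
  smul σ α := galIso σ α
  one_smul _ := Iso.ext (galHom_one _)
  mul_smul σ τ _ := Iso.ext (galHom_mul σ τ _)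
  smul_mul σ _ _ := Iso.ext (galHom_comp σ _ _)
  smul_one σ := Iso.ext (galHom_id σ)

variable {K X}

/-- The cocycle `h_Y(σ) = σ_X ∘ ψ ∘ σ_Y⁻¹ ∘ ψ⁻¹` attached to an isomorphism
`ψ : Y ×_k K ≅ X ×_k K`. -/
noncomputable def formCocycle (ψ : geom K Y ≅ geom K X) (σ : K ≃ₐ[k] K) : GeomAut K X :=
  Iso.trans ψ.symm (galIso σ ψ)

lemma formCocycle_left (ψ : geom K Y ≅ geom K X) (σ : K ≃ₐ[k] K) :
    (Iso.hom (formCocycle ψ σ)).left = ψ.inv.left ≫ galAct Y σ⁻¹ ≫ ψ.hom.left ≫ galAct X σ := rfl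

variable (k) in
/-- A `k`-scheme is a `k`-variety if it is separated and of finite type over `k`. -/
structure IsVar (X : Over (Spec (.of k))) : Prop where
  separated : IsSeparated X.hom
  locallyOfFiniteType : LocallyOfFiniteType X.hom
  quasiCompact : QuasiCompact X.hom

variable (K) in
/-- The `k`-variety `Y` is a `k`-form of `X`. -/
def IsForm (X Y : Over (Spec (.of k))) : Prop := IsVar k Y ∧ Nonempty (geom K Y ≅ geom K X)

variable (k) in
/-- The isomorphism classes of `k`-schemes. -/
def IsoClass : Type (u + 1) := Quotient (isIsomorphicSetoid (Over (Spec (CommRingCat.of k))))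

/-- The isomorphism class of a `k`-scheme. -/
noncomputable def isoClass (X : Over (Spec (.of k))) : IsoClass k := Quotient.mk (isIsomorphicSetoid _) X

/-- The `k`-form `Y` of `X` corresponds to the cohomology class `ξ`: the cocycle
`σ ↦ σ_X ∘ ψ ∘ σ_Y⁻¹ ∘ ψ⁻¹` is in the class `ξ` for some isomorphism `ψ : Y ×_k K ≅ X ×_k K`. -/
def IsFormOfClass (X : Over (Spec (.of k))) (ξ : H1 (K ≃ₐ[k] K) (GeomAut K X))
    (Y : Over (Spec (.of k))) : Prop :=
  IsVar k Y ∧ ∃ (ψ : geom K Y ≅ geom K X) (h : OneCocycle (K ≃ₐ[k] K) (GeomAut K X)),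
    (∀ σ, h.toFun σ = formCocycle ψ σ) ∧ h.cls = ξ

open Classical in
/-- The map `d : H¹(k, Aut(X)) ⟶ {k-forms of X} / isomorphism`: the isomorphism class of the
`k`-form of `X` corresponding to a cohomology class. -/
noncomputable def formOfClass (X : Over (Spec (.of k))) (ξ : H1 (K ≃ₐ[k] K) (GeomAut K X)) :
    IsoClass k :=
  if h : ∃ Y, IsFormOfClass X ξ Y then isoClass h.choose else isoClass X

end Forms

/-! ### Galois action on the points of `G` and of the stabilizers -/

section GaloisGroup

variable {k : Type u} [Field k] (Q : QuaternionData k) (n : ℕ) (K : Type u) [Field K] [Algebra k K]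

lemma Quat.map_id' (q : Quat Q K) : Quat.map Q (AlgHom.id k K) q = q := by
  ext <;> simp

lemma Quat.map_comp' {K' K'' : Type*} [CommRing K'] [Algebra k K'] [CommRing K''] [Algebra k K'']
    (f : K' →ₐ[k] K'') (g : K →ₐ[k] K') (q : Quat Q K) :
    Quat.map Q (f.comp g) q = Quat.map Q f (Quat.map Q g q) := by
  ext <;> simp

variable {Q n K} in
lemma Grp.ext {R : Type*} [CommRing R] [Algebra k R] {g h : Grp Q R n}
    (h1 : ∀ i j, g.1.1 i j = h.1.1 i j) (h2 : ∀ i j, g.2.1 i j = h.2.1 i j) : g = h :=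
  Prod.ext (Units.ext (Matrix.ext h1)) (Units.ext (Matrix.ext h2))

/-- The Galois action on `G(K)`. -/
instance : MulDistribMulAction (K ≃ₐ[k] K) (Grp Q K n) where
  smul σ g := Grp.map Q n (σ : K →ₐ[k] K) g
  one_smul _ := Grp.ext (fun _ _ => Quat.map_id' Q K _) (fun _ _ => rfl)
  mul_smul σ τ _ := Grp.ext (fun _ _ => Quat.map_comp' Q K (σ : K →ₐ[k] K) (τ : K →ₐ[k] K) _)
    (fun _ _ => rfl)
  smul_mul σ _ _ := map_mul (Grp.map Q n (σ : K →ₐ[k] K)) _ _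
  smul_one σ := map_one (Grp.map Q n (σ : K →ₐ[k] K))

lemma Grp.gal_smul (σ : K ≃ₐ[k] K) (g : Grp Q K n) :
    σ • g = Grp.map Q n (σ : K →ₐ[k] K) g := rfl

lemma Grp.gal_map (σ : K ≃ₐ[k] K) (g : Grp Q k n) :
    σ • Grp.map Q n (Algebra.ofId k K) g = Grp.map Q n (Algebra.ofId k K) g := by
  refine Grp.ext (fun i j => ?_) (fun i j => ?_)
  · refine Eq.trans (Quat.map_comp' Q k (σ : K →ₐ[k] K) (Algebra.ofId k K) _).symm ?_
    exact congrArg (fun f => Quat.map Q f (g.1.1 i j)) (Subsingleton.elim _ _)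
  · exact σ.commutes _

variable {Q n} in
/-- The image in `V(K)` of a `k`-rational point of `V`. -/
def Vec.base (x : Vec Q k n) : Vec Q K n := Vec.map Q n (Algebra.ofId k K) x

lemma Vec.base_gal (σ : K ≃ₐ[k] K) (x : Vec Q k n) :
    Vec.map Q n (σ : K →ₐ[k] K) (x.base K) = x.base K := by
  funext i
  refine Subtype.ext (Matrix.ext fun a b => ?_)
  refine Eq.trans (Quat.map_comp' Q k (σ : K →ₐ[k] K) (Algebra.ofId k K) _).symm ?_
  exact congrArg (fun f => Quat.map Q f ((x i).1 a b)) (Subsingleton.elim _ _)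

lemma Vec.base_smul (g : Grp Q k n) (x : Vec Q k n) :
    (g • x).base K = Grp.map Q n (Algebra.ofId k K) g • x.base K :=
  Grp.map_smul Q n _ g x

variable {Q n}

/-- The group `G_w(K)` of `K`-points of the stabilizer of `w ∈ V(k)`. -/
def Stab (w : Vec Q k n) : Subgroup (Grp Q K n) := MulAction.stabilizer (Grp Q K n) (w.base K)

variable {K} in
lemma Stab.gal_mem {w : Vec Q k n} (σ : K ≃ₐ[k] K) {g : Grp Q K n} (hg : g ∈ Stab K w) :
    σ • g ∈ Stab K w := by
  have h : g • w.base K = w.base K := hg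
  change Grp.map Q n (σ : K →ₐ[k] K) g • w.base K = w.base K
  conv_lhs => rw [← Vec.base_gal Q n K σ w, ← Grp.map_smul, h]
  exact Vec.base_gal Q n K σ w

/-- The Galois action on `G_w(K)`. -/
instance (w : Vec Q k n) : MulDistribMulAction (K ≃ₐ[k] K) (Stab K w) where
  smul σ g := ⟨σ • g.1, Stab.gal_mem σ g.2⟩
  one_smul g := Subtype.ext (one_smul _ g.1)
  mul_smul σ τ g := Subtype.ext (mul_smul σ τ g.1)
  smul_mul σ g h := Subtype.ext (smul_mul' σ g.1 h.1)
  smul_one σ := Subtype.ext (smul_one σ)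

lemma Stab.gal_coe (w : Vec Q k n) (σ : K ≃ₐ[k] K) (g : Stab K w) :
    (σ • g : Stab K w).1 = σ • g.1 := rfl

variable {K}

lemma isLocallyConstant_gal [IsSepClosure k K] (g : Grp Q K n) :
    IsLocallyConstant fun σ : K ≃ₐ[k] K => σ • g := by
  have h1 (x : K) : ∀ σ : K ≃ₐ[k] K, ∀ᶠ τ in nhds σ, τ x = σ x := by
    intro σ
    have hsep : Algebra.IsSeparable k K := IsSepClosure.separable
    have h := stabilizer_isOpen_of_isIntegral (K := k) x
    have h' : IsOpen ((fun τ => σ⁻¹ * τ) ⁻¹' (MulAction.stabilizer (K ≃ₐ[k] K) x :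
      Set (K ≃ₐ[k] K))) := h.preimage (continuous_const_mul _)
    filter_upwards [h'.mem_nhds (by simp)] with τ hτ
    have hτ' : (σ⁻¹ * τ) x = x := hτ
    calc τ x = σ ((σ⁻¹ * τ) x) := by simp [AlgEquiv.mul_apply, ← AlgEquiv.aut_inv]
      _ = σ x := by rw [hτ']
  rw [IsLocallyConstant.iff_eventually_eq]
  intro σ
  have e1 : ∀ᶠ τ in nhds σ, ∀ i j, τ (g.1.1 i j).re = σ (g.1.1 i j).re ∧
      τ (g.1.1 i j).imI = σ (g.1.1 i j).imI ∧ τ (g.1.1 i j).imJ = σ (g.1.1 i j).imJ ∧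
      τ (g.1.1 i j).imK = σ (g.1.1 i j).imK := by
    simp only [Filter.eventually_all, Filter.eventually_and]
    exact fun i j => ⟨h1 _ σ, h1 _ σ, h1 _ σ, h1 _ σ⟩
  have e2 : ∀ᶠ τ in nhds σ, ∀ i j, τ (g.2.1 i j) = σ (g.2.1 i j) := by
    simp only [Filter.eventually_all]
    exact fun i j => h1 _ σ
  filter_upwards [e1, e2] with τ h2 h3
  refine Grp.ext (fun i j => ?_) (fun i j => h3 i j)
  obtain ⟨h4, h5, h6, h7⟩ := h2 i j
  exact QuaternionAlgebra.ext h4 h5 h6 h7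

variable (K)

/-! ### The maps `a_w` and `b_w` -/

variable (Q n k) in
/-- The orbit relation of `G(k)` on `V^ss(k)`. -/
def ssOrbitSetoid : Setoid (ssLocus Q n k) where
  r x y := ∃ γ : Grp Q k n, γ • x.1 = y.1
  iseqv :=
    { refl := fun x => ⟨1, one_smul _ _⟩
      symm := by
        rintro x y ⟨γ, h⟩
        exact ⟨γ⁻¹, by rw [← h, inv_smul_smul]⟩
      trans := by
        rintro x y z ⟨γ, h⟩ ⟨γ', h'⟩
        exact ⟨γ' * γ, by rw [mul_smul, h, h']⟩ }

variable (Q n) in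
/-- The set `G(k) \ V^ss(k)` of rational orbits. -/
def SSOrbits : Type u := Quotient (ssOrbitSetoid k Q n)

/-- The orbit `G(k) x`. -/
def ssOrbit (x : ssLocus Q n k) : SSOrbits Q n := Quotient.mk (ssOrbitSetoid k Q n) x

/-- The set `(G / G_w)(k)`: the Galois-invariant elements of `G(K) / G_w(K)`. -/
def RatCosets (w : Vec Q k n) : Type u :=
  {c : Grp Q K n ⧸ Stab K w //
    ∀ (σ : K ≃ₐ[k] K) (g : Grp Q K n), (g : Grp Q K n ⧸ Stab K w) = c →
      ((σ • g : Grp Q K n) : Grp Q K n ⧸ Stab K w) = c}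

/-- The orbit relation of `G(k)` on `(G / G_w)(k)`. -/
def ratCosetSetoid (w : Vec Q k n) : Setoid (RatCosets K w) where
  r c c' := ∃ γ : Grp Q k n, Grp.map Q n (Algebra.ofId k K) γ • c.1 = c'.1
  iseqv :=
    { refl := fun x => ⟨1, by rw [map_one, one_smul]⟩
      symm := by
        rintro x y ⟨γ, h⟩
        exact ⟨γ⁻¹, by rw [← h, map_inv, inv_smul_smul]⟩
      trans := by
        rintro x y z ⟨γ, h⟩ ⟨γ', h'⟩
        exact ⟨γ' * γ, by rw [map_mul, mul_smul, h, h']⟩ }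

/-- The set `G(k) \ (G / G_w)(k)`. -/
def CosetOrbits (w : Vec Q k n) : Type u := Quotient (ratCosetSetoid K w)

lemma coset_eq {w : Vec Q k n} {g h : Grp Q K n} :
    (g : Grp Q K n ⧸ Stab K w) = h ↔ g • w.base K = h • w.base K := by
  rw [QuotientGroup.eq, Stab, MulAction.mem_stabilizer_iff, mul_smul, inv_smul_eq_iff, eq_comm]

lemma gal_smul_base (w : Vec Q k n) (σ : K ≃ₐ[k] K) (g : Grp Q K n) :
    (σ • g) • w.base K = Vec.map Q n (σ : K →ₐ[k] K) (g • w.base K) := by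
  rw [Grp.map_smul, Vec.base_gal]
  rfl

open Classical in
/-- The coset `g G_w(K)` of the `g ∈ G(K)` with `g w = x`. -/
noncomputable def aCoset (w x : Vec Q k n) : Grp Q K n ⧸ Stab K w :=
  if h : ∃ g : Grp Q K n, g • w.base K = x.base K then (h.choose : Grp Q K n)
  else (1 : Grp Q K n)

lemma aCoset_eq {w x : Vec Q k n} {g : Grp Q K n} (hg : g • w.base K = x.base K) :
    aCoset K w x = (g : Grp Q K n ⧸ Stab K w) := by
  have h : ∃ g : Grp Q K n, g • w.base K = x.base K := ⟨g, hg⟩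
  rw [aCoset, dif_pos h]
  exact (coset_eq K).2 (h.choose_spec.trans hg.symm)

/-- The map `a_w : V^ss(k) ⟶ (G / G_w)(k)` inverse to `g ↦ g w`. -/
noncomputable def aPoint (w x : Vec Q k n) : RatCosets K w :=
  ⟨aCoset K w x, fun σ g hg => by
    by_cases h : ∃ g : Grp Q K n, g • w.base K = x.base K
    · obtain ⟨g', hg'⟩ := h
      rw [aCoset_eq K hg', coset_eq] at hg ⊢
      rw [gal_smul_base, hg, hg', Vec.base_gal]
    · rw [aCoset, dif_neg h, coset_eq, one_smul] at hg ⊢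
      rw [gal_smul_base, hg, Vec.base_gal]⟩

/-- The map `a_w : G(k) \ V^ss(k) ⟶ G(k) \ (G / G_w)(k)`. -/
noncomputable def aMap (w : ssLocus Q n k) : SSOrbits Q n → CosetOrbits K w.1 :=
  Quotient.map (sa := ssOrbitSetoid k Q n) (sb := ratCosetSetoid K w.1)
    (fun x => aPoint K w.1 x.1) (by
      rintro ⟨x, hx⟩ ⟨y, hy⟩ ⟨γ, h⟩
      dsimp only at h
      subst h
      by_cases h : ∃ g : Grp Q K n, g • w.1.base K = x.base K
      · obtain ⟨g, hg⟩ := h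
        have hg' : (Grp.map Q n (Algebra.ofId k K) γ * g) • w.1.base K = (γ • x).base K := by
          rw [mul_smul, hg, Vec.base_smul]
        refine ⟨γ, ?_⟩
        change Grp.map Q n (Algebra.ofId k K) γ • aCoset K w.1 x = aCoset K w.1 (γ • x)
        rw [aCoset_eq K hg, aCoset_eq K hg']
        rfl
      · have h' : ¬ ∃ g : Grp Q K n, g • w.1.base K = (γ • x).base K := by
          rintro ⟨g, hg⟩
          refine h ⟨Grp.map Q n (Algebra.ofId k K) γ⁻¹ * g, ?_⟩
          rw [mul_smul, hg, ← Vec.base_smul, inv_smul_smul]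
        refine ⟨1, ?_⟩
        change Grp.map Q n (Algebra.ofId k K) 1 • aCoset K w.1 x = aCoset K w.1 (γ • x)
        rw [map_one, one_smul, aCoset, aCoset, dif_neg h, dif_neg h'])

variable {K}

/-- The cocycle `σ ↦ g⁻¹ σ(g)` attached to a representative `g` of an element of
`(G / G_w)(k)`. -/
def cobCocycle [IsSepClosure k K] (w : Vec Q k n) (g : Grp Q K n)
    (hg : ∀ σ : K ≃ₐ[k] K, g⁻¹ * σ • g ∈ Stab K w) : OneCocycle (K ≃ₐ[k] K) (Stab K w) where
  toFun σ := ⟨g⁻¹ * σ • g, hg σ⟩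
  isLocallyConstant := by
    rw [IsLocallyConstant.iff_eventually_eq]
    intro σ
    filter_upwards [(IsLocallyConstant.iff_eventually_eq _).1 (isLocallyConstant_gal g) σ]
      with τ hτ
    exact Subtype.ext (congrArg (g⁻¹ * ·) hτ)
  map_mul σ τ := by
    refine Subtype.ext ?_
    change g⁻¹ * (σ * τ) • g = g⁻¹ * σ • g * σ • (g⁻¹ * τ • g)
    rw [smul_mul', smul_inv', mul_smul, mul_assoc g⁻¹, mul_inv_cancel_left]

lemma RatCosets.mem {w : Vec Q k n} (c : RatCosets K w) (g : Grp Q K n)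
    (hg : (g : Grp Q K n ⧸ Stab K w) = c.1) (σ : K ≃ₐ[k] K) : g⁻¹ * σ • g ∈ Stab K w :=
  QuotientGroup.eq.1 (hg.trans (c.2 σ g hg).symm)

variable (K)

/-- The map `b_w : G(k) \ (G / G_w)(k) ⟶ H¹(k, G_w)` taking the class of `g G_w(K)` to the class
of the cocycle `σ ↦ g⁻¹ σ(g)`. -/
noncomputable def bMap [IsSepClosure k K] (w : Vec Q k n) :
    CosetOrbits K w → H1 (K ≃ₐ[k] K) (Stab K w) :=
  Quotient.lift (s := ratCosetSetoid K w)
    (fun c => (cobCocycle w c.1.out (c.mem _ (Quotient.out_eq' _))).cls) (by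
      rintro c c' ⟨γ, h⟩
      have e : ((Grp.map Q n (Algebra.ofId k K) γ * c.1.out : Grp Q K n) :
          Grp Q K n ⧸ Stab K w) = (c'.1.out : Grp Q K n) := by
        refine Eq.trans ?_ (h.trans (Quotient.out_eq' c'.1).symm)
        conv_rhs => rw [← Quotient.out_eq' c.1]
        rfl
      refine Quotient.sound (s := OneCocycle.setoid) ⟨⟨_, QuotientGroup.eq.1 e⟩, fun σ => ?_⟩
      refine Subtype.ext ?_
      change (c'.1.out)⁻¹ * σ • c'.1.out = ((Grp.map Q n (Algebra.ofId k K) γ * c.1.out)⁻¹ *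
        c'.1.out)⁻¹ * ((c.1.out)⁻¹ * σ • c.1.out) *
          σ • ((Grp.map Q n (Algebra.ofId k K) γ * c.1.out)⁻¹ * c'.1.out)
      simp only [smul_mul', smul_inv', Grp.gal_map]
      group)

end GaloisGroup

/-! ### The scheme `Z_x`, the maps `c_w`, `d_w` and `Φ_w` -/

section Main

open MvPolynomial AlgebraicGeometry CategoryTheory CategoryTheory.Limits

variable {k : Type u} [Field k] {K : Type u} [Field K] [Algebra k K] {n : ℕ}

/-- The `k`-scheme `Proj k[v₁, v₂] / (F)`. -/
noncomputable abbrev formVar (F : BinaryForm k n) : Over (Spec (.of k)) :=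
  Over.mk (projForm.toSpec F)

/-- Applying `τ` to the coefficients, as an endomorphism of `K[v₁, v₂] / (F)` for a form `F`
with coefficients in `k`. -/
noncomputable def coeffHom (F : BinaryForm k n) (τ : K ≃ₐ[k] K) :
    FormHom (F.map (algebraMap k K)) (F.map (algebraMap k K)) where
  toRingHom := MvPolynomial.map (τ : K →+* K)
  homog h := h.map _
  mem := by
    have e : MvPolynomial.map (τ : K →+* K) (F.map (algebraMap k K)).1 =
        (F.map (algebraMap k K)).1 := by
      change MvPolynomial.map _ (MvPolynomial.map _ _) = MvPolynomial.map _ _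
      rw [MvPolynomial.map_map]
      exact congrArg (fun f => MvPolynomial.map f F.1) (RingHom.ext fun x => τ.commutes x)
    rw [e]
    exact Ideal.mem_span_singleton_self _
  gen i := Ideal.subset_span ⟨i, by simp⟩

/-- The linear substitution `f(v) ↦ f(v g)` as a homomorphism
`K[v₁, v₂] / (F) ⟶ K[v₁, v₂] / (F')`, if `F'` divides `F(v g)`. -/
noncomputable def substHom (g : GL (Fin 2) K) (F F' : BinaryForm K n) (h : F'.1 ∣ subst g.1 F.1) :
    FormHom F F' where
  toRingHom := (subst g.1 : MvPolynomial (Fin 2) K →+* MvPolynomial (Fin 2) K)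
  homog h := subst_isHomogeneous _ h
  mem := Ideal.mem_span_singleton.2 h
  gen i := by
    have e : (X i : MvPolynomial (Fin 2) K) = subst g.1 (subst (g⁻¹).1 (X i)) := by
      rw [← AlgHom.comp_apply, ← subst_mul, ← Units.val_mul, mul_inv_cancel, Units.val_one,
        subst_one]
      rfl
    have e' : subst (g⁻¹).1 (X i) = ∑ l, X l * C ((g⁻¹).1 l i) := aeval_X _ _
    rw [e, e', map_sum]
    refine sum_mem fun l _ => ?_
    rw [map_mul]
    exact Ideal.mul_mem_right _ _ (Ideal.subset_span ⟨l, rfl⟩)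

/-- The identification of `(Proj k[v₁, v₂] / (F)) ×_k K` with `Proj K[v₁, v₂] / (F)`. -/
noncomputable def geomFormVar (K : Type u) [Field K] [Algebra k K] (F : BinaryForm k n) :
    geom K (formVar F) ≅ formVar (F.map (algebraMap k K)) :=
  Over.isoMk (isPullback_projForm (algebraMap k K) F).isoPullback.symm (by
    exact (isPullback_projForm (algebraMap k K) F).isoPullback_inv_snd)

lemma geomFormVar_inv_gal (F : BinaryForm k n) (σ : K ≃ₐ[k] K) :
    (geomFormVar K F).inv.left ≫ galAct (formVar F) σ =
      (coeffHom F σ⁻¹).proj ≫ (geomFormVar K F).inv.left := by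
  have P := isPullback_projForm (algebraMap k K) F
  have h1 : (geomFormVar K F).inv.left ≫ pullback.fst (formVar F).hom (specMap k K) =
    (F.mapHom (algebraMap k K)).proj := P.isoPullback_hom_fst
  have h2 : (geomFormVar K F).inv.left ≫ pullback.snd (formVar F).hom (specMap k K) =
    projForm.toSpec (F.map (algebraMap k K)) := P.isoPullback_hom_snd
  refine pullback.hom_ext ?_ ?_
  · have e : ((coeffHom F σ⁻¹).proj ≫ (geomFormVar K F).inv.left) ≫
        pullback.fst (formVar F).hom (specMap k K) =
        (coeffHom F σ⁻¹).proj ≫ (F.mapHom (algebraMap k K)).proj :=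
      (Category.assoc _ _ _).trans (congrArg (_ ≫ ·) h1)
    rw [e, Category.assoc, galAct_fst, ← FormHom.proj_comp, h1]
    congr 1
    refine FormHom.ext (MvPolynomial.ringHom_ext (fun r => ?_) fun j => ?_)
    · simp [FormHom.comp, coeffHom, BinaryForm.mapHom]
    · simp [FormHom.comp, coeffHom, BinaryForm.mapHom]
  · have e : ((coeffHom F σ⁻¹).proj ≫ (geomFormVar K F).inv.left) ≫
        pullback.snd (formVar F).hom (specMap k K) =
        (coeffHom F σ⁻¹).proj ≫ projForm.toSpec (F.map (algebraMap k K)) :=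
      (Category.assoc _ _ _).trans (congrArg (_ ≫ ·) h2)
    rw [e, Category.assoc, galAct_snd, ← Category.assoc, h2]
    exact (FormHom.proj_toSpec (coeffHom F σ⁻¹) ((σ⁻¹ : K ≃ₐ[k] K) : K →+* K)
      (fun r => by simp [coeffHom])).symm

lemma substHom_mul_proj (F : BinaryForm K n) (g g' : GL (Fin 2) K) (h1 h2 h3) :
    (substHom (g * g') F F h1).proj = (substHom g F F h2).proj ≫ (substHom g' F F h3).proj := by
  rw [← FormHom.proj_comp]
  exact congrArg FormHom.proj (FormHom.ext (congrArg AlgHom.toRingHom (subst_mul g.1 g'.1)))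

lemma substHom_toSpec (F : BinaryForm K n) (g : GL (Fin 2) K) (h) :
    (substHom g F F h).proj ≫ projForm.toSpec F = projForm.toSpec F := by
  have e := FormHom.proj_toSpec (substHom g F F h) (RingHom.id K)
    (fun r => (subst g.1).commutes r)
  have e' : Spec.map (CommRingCat.ofHom (RingHom.id K)) = 𝟙 (Spec (.of K)) := Spec.map_id _
  rw [e', Category.comp_id] at e
  exact e

lemma substHom_one_proj (F : BinaryForm K n) (g : GL (Fin 2) K) (hg : g = 1) (h) :
    (substHom g F F h).proj = 𝟙 (projForm F) := by
  subst hg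
  rw [← FormHom.proj_id]
  exact congrArg FormHom.proj (FormHom.ext (congrArg AlgHom.toRingHom subst_one))

/-- The automorphism `v ↦ v g` of `Proj K[v₁, v₂] / (F)`, if `F` divides `F(v g)` and
`F(v g⁻¹)`. -/
noncomputable def substIso (F : BinaryForm K n) (g : GL (Fin 2) K) (h : F.1 ∣ subst g.1 F.1)
    (h' : F.1 ∣ subst (g⁻¹).1 F.1) : formVar F ≅ formVar F where
  hom := Over.homMk (substHom g F F h).proj (substHom_toSpec F g h)
  inv := Over.homMk (substHom g⁻¹ F F h').proj (substHom_toSpec F g⁻¹ h')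
  hom_inv_id := Over.OverMorphism.ext ((substHom_mul_proj F g g⁻¹
    (by rw [mul_inv_cancel, Units.val_one, subst_one]; rfl) h h').symm.trans
    (substHom_one_proj F _ (mul_inv_cancel g) _))
  inv_hom_id := Over.OverMorphism.ext ((substHom_mul_proj F g⁻¹ g
    (by rw [inv_mul_cancel, Units.val_one, subst_one]; rfl) h' h).symm.trans
    (substHom_one_proj F _ (inv_mul_cancel g) _))

lemma substIso_mul (F : BinaryForm K n) (g g' : GL (Fin 2) K) (h1 h2 h3 h4 h5 h6) :
    substIso F (g * g') h1 h2 = (substIso F g h3 h4).trans (substIso F g' h5 h6) :=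
  Iso.ext (Over.OverMorphism.ext (substHom_mul_proj F g g' h1 h3 h5))

/-- The automorphism `v ↦ v g` of `(Proj k[v₁, v₂] / (F)) ×_k K`. -/
noncomputable def substAut (F : BinaryForm k n) (g : GL (Fin 2) K)
    (h : (F.map (algebraMap k K)).1 ∣ subst g.1 (F.map (algebraMap k K)).1)
    (h' : (F.map (algebraMap k K)).1 ∣ subst (g⁻¹).1 (F.map (algebraMap k K)).1) :
    GeomAut K (formVar F) :=
  (geomFormVar K F).trans ((substIso _ g h h').trans (geomFormVar K F).symm)

lemma substAut_mul (F : BinaryForm k n) (g g' : GL (Fin 2) K) (h1 h2 h3 h4 h5 h6) :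
    substAut F (g * g') h1 h2 = substAut F g h3 h4 * substAut F g' h5 h6 := by
  change Iso.trans _ _ = (Iso.trans _ _).trans (Iso.trans _ _)
  rw [substIso_mul _ g g' h1 h2 h3 h4 h5 h6]
  refine Iso.ext ?_
  simp

lemma coeffHom_substHom (F : BinaryForm k n) (g : GL (Fin 2) K) (σ : K ≃ₐ[k] K) (h1 h2) :
    (coeffHom F σ).proj ≫ (substHom g (F.map (algebraMap k K)) _ h2).proj ≫
      (coeffHom F σ⁻¹).proj =
    (substHom (Matrix.GeneralLinearGroup.map (σ : K →+* K) g) (F.map (algebraMap k K)) _ h1).proj := by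
  rw [← FormHom.proj_comp, ← FormHom.proj_comp]
  refine congrArg FormHom.proj (FormHom.ext (RingHom.ext fun p => ?_))
  change MvPolynomial.map (σ : K →+* K) (subst g.1
    (MvPolynomial.map ((σ⁻¹ : K ≃ₐ[k] K) : K →+* K) p)) = subst (g.1.map σ) p
  rw [map_subst, MvPolynomial.map_map]
  have e : ((σ : K →+* K).comp ((σ⁻¹ : K ≃ₐ[k] K) : K →+* K)) = RingHom.id K :=
    RingHom.ext fun x => σ.apply_symm_apply x
  rw [e, MvPolynomial.map_id]
  rfl

lemma substAut_gal (F : BinaryForm k n) (g : GL (Fin 2) K) (σ : K ≃ₐ[k] K) (h1 h2 h3 h4) :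
    substAut F (Matrix.GeneralLinearGroup.map (σ : K →+* K) g) h1 h2 =
      σ • substAut F g h3 h4 := by
  refine Iso.ext (Over.OverMorphism.ext ?_)
  have e1 := geomFormVar_inv_gal F σ
  have e2 : galAct (formVar F) σ⁻¹ ≫ (geomFormVar K F).hom.left =
      (geomFormVar K F).hom.left ≫ (coeffHom F σ).proj := by
    have e := geomFormVar_inv_gal F σ⁻¹
    rw [inv_inv] at e
    have i1 : (geomFormVar K F).hom.left ≫ (geomFormVar K F).inv.left = 𝟙 _ :=
      congrArg Over.Hom.left (geomFormVar K F).hom_inv_id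
    have i2 : (geomFormVar K F).inv.left ≫ (geomFormVar K F).hom.left = 𝟙 _ :=
      congrArg Over.Hom.left (geomFormVar K F).inv_hom_id
    calc galAct (formVar F) σ⁻¹ ≫ (geomFormVar K F).hom.left
        = (geomFormVar K F).hom.left ≫ ((geomFormVar K F).inv.left ≫
            galAct (formVar F) σ⁻¹) ≫ (geomFormVar K F).hom.left := by
          rw [Category.assoc, ← Category.assoc, i1, Category.id_comp]
      _ = (geomFormVar K F).hom.left ≫ (coeffHom F σ).proj ≫
            (geomFormVar K F).inv.left ≫ (geomFormVar K F).hom.left := by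
          rw [e]
          exact congrArg (_ ≫ ·) (Category.assoc _ _ _)
      _ = _ := by
          rw [i2]
          exact congrArg (_ ≫ ·) (Category.comp_id _)
  have key (a : (geom K (formVar F)).left ⟶ projForm (F.map (algebraMap k K)))
      (b : projForm (F.map (algebraMap k K)) ⟶ (geom K (formVar F)).left)
      (e1 : b ≫ galAct (formVar F) σ = (coeffHom F σ⁻¹).proj ≫ b)
      (e2 : galAct (formVar F) σ⁻¹ ≫ a = a ≫ (coeffHom F σ).proj) :
      a ≫ (substHom (Matrix.GeneralLinearGroup.map (σ : K →+* K) g) _ _ h1).proj ≫ b =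
      galAct (formVar F) σ⁻¹ ≫ (a ≫ (substHom g _ _ h3).proj ≫ b) ≫
        galAct (formVar F) σ := by
    rw [Category.assoc, Category.assoc, e1, ← Category.assoc (galAct (formVar F) σ⁻¹), e2,
      ← coeffHom_substHom F g σ h1 h3]
    simp only [Category.assoc]
  exact key _ _ e1 e2

variable (Q : QuaternionData k)

lemma exists_root [IsSepClosure k K] :
    ∃ t : K, t ^ 2 = algebraMap k K Q.b * t + algebraMap k K Q.a := by
  have : IsSepClosed K := IsSepClosure.sep_closed k
  have hd := Q.separable
  set p : Polynomial k := Polynomial.X ^ 2 - Polynomial.C Q.b * Polynomial.X - Polynomial.C Q.a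
    with hp
  have hdeg : p.degree = 2 := by
    rw [hp]
    compute_degree!
  have hsep : p.Separable := by
    have e : Polynomial.derivative p = 2 * Polynomial.X - Polynomial.C Q.b := by
      simp [hp, one_add_one_eq_two]
      rfl
    refine ⟨-4 * Polynomial.C (Q.b ^ 2 + 4 * Q.a)⁻¹,
      Polynomial.C (Q.b ^ 2 + 4 * Q.a)⁻¹ * (2 * Polynomial.X - Polynomial.C Q.b), ?_⟩
    rw [e]
    have h1 : (Polynomial.C (Q.b ^ 2 + 4 * Q.a)⁻¹ : Polynomial k) *
        (Polynomial.C Q.b ^ 2 + 4 * Polynomial.C Q.a) = 1 := by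
      have : (4 : Polynomial k) = Polynomial.C 4 := rfl
      rw [this, ← Polynomial.C_pow, ← Polynomial.C_mul, ← Polynomial.C_add, ← Polynomial.C_mul,
        inv_mul_cancel₀ hd, Polynomial.C_1]
    rw [hp]
    linear_combination h1
  obtain ⟨t, ht⟩ := IsSepClosed.exists_aeval_eq_zero K p (by rw [hdeg]; norm_num) hsep
  refine ⟨t, ?_⟩
  simp only [hp, map_sub, map_mul, map_pow, Polynomial.aeval_X, Polynomial.aeval_C] at ht
  linear_combination ht

variable {Q}

/-- The binary form `F_x`. -/
noncomputable def Vec.binForm (x : Vec Q k n) : BinaryForm k n :=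
  ⟨x.form, Vec.form_isHomogeneous Q n x⟩

/-- The `k`-scheme `Z_x = Proj k[v₁, v₂] / (F_x)`. -/
noncomputable abbrev zeroScheme (x : Vec Q k n) : Over (Spec (.of k)) := formVar x.binForm

lemma Stab.dvd [IsSepClosure k K] (hn : n = 2 ∨ n = 3) {w : Vec Q k n} {g : Grp Q K n}
    (hg : g ∈ Stab K w) : (w.binForm.map (algebraMap k K)).1 ∣
      subst g.2.1 (w.binForm.map (algebraMap k K)).1 := by
  obtain ⟨t, ht⟩ := exists_root (K := K) Q
  have h := form_smul_dvd Q n hn t ht g (w.base K)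
  have hg' : g • w.base K = w.base K := hg
  rw [hg', Vec.base, Vec.form_map] at h
  exact h

lemma Grp.inv_snd (g : Grp Q K n) : (g⁻¹ : Grp Q K n).2 = g.2⁻¹ := rfl

lemma Grp.mul_snd (g h : Grp Q K n) : (g * h : Grp Q K n).2 = g.2 * h.2 := rfl

lemma Grp.gal_snd (σ : K ≃ₐ[k] K) (g : Grp Q K n) :
    (σ • g : Grp Q K n).2 = Matrix.GeneralLinearGroup.map (σ : K →+* K) g.2 := rfl

lemma Stab.dvd_inv [IsSepClosure k K] (hn : n = 2 ∨ n = 3) {w : Vec Q k n} {g : Grp Q K n}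
    (hg : g ∈ Stab K w) : (w.binForm.map (algebraMap k K)).1 ∣
      subst (g.2⁻¹).1 (w.binForm.map (algebraMap k K)).1 := by
  have h := Stab.dvd hn ((Stab K w).inv_mem hg)
  rw [Grp.inv_snd] at h
  exact h

/-- The automorphism `v ↦ v g₂` of `Z_w ×_k K` for `(g₁, g₂) ∈ G_w(K)`. -/
noncomputable def cAut [IsSepClosure k K] (hn : n = 2 ∨ n = 3) (w : Vec Q k n) (g : Stab K w) :
    GeomAut K (zeroScheme w) :=
  substAut w.binForm g.1.2 (Stab.dvd hn g.2) (Stab.dvd_inv hn g.2)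

lemma substAut_congr {F : BinaryForm k n} {g g' : GL (Fin 2) K} (e : g = g') (h1 h2 h3 h4) :
    substAut F g h1 h2 = substAut F g' h3 h4 := by
  subst e
  rfl

lemma cAut_mul [IsSepClosure k K] (hn : n = 2 ∨ n = 3) (w : Vec Q k n) (g g' : Stab K w) :
    cAut hn w (g * g') = cAut hn w g * cAut hn w g' := by
  have e : (g * g').1.2 = g.1.2 * g'.1.2 := Grp.mul_snd g.1 g'.1
  have h1 := Stab.dvd hn (g * g').2
  have h2 := Stab.dvd_inv hn (g * g').2
  have h3 := h1
  have h4 := h2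
  rw [e] at h3 h4
  exact (substAut_congr e h1 h2 h3 h4).trans (substAut_mul w.binForm g.1.2 g'.1.2 h3 h4
    (Stab.dvd hn g.2) (Stab.dvd_inv hn g.2) (Stab.dvd hn g'.2) (Stab.dvd_inv hn g'.2))

lemma cAut_gal [IsSepClosure k K] (hn : n = 2 ∨ n = 3) (w : Vec Q k n) (σ : K ≃ₐ[k] K)
    (g : Stab K w) : cAut hn w (σ • g) = σ • cAut hn w g := by
  have e : (σ • g).1.2 = Matrix.GeneralLinearGroup.map (σ : K →+* K) g.1.2 := Grp.gal_snd σ g.1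
  have h1 := Stab.dvd hn (σ • g).2
  have h2 := Stab.dvd_inv hn (σ • g).2
  have h3 := h1
  have h4 := h2
  rw [e] at h3 h4
  exact (substAut_congr e h1 h2 h3 h4).trans (substAut_gal w.binForm g.1.2 σ h3 h4
    (Stab.dvd hn g.2) (Stab.dvd_inv hn g.2))

/-- The homomorphism `c_w : G_w(K) ⟶ Aut(Z_w)(K)`, `(g₁, g₂) ↦ (v ↦ v g₂)`. -/
noncomputable def cHom [IsSepClosure k K] (hn : n = 2 ∨ n = 3) (w : Vec Q k n) :
    Stab K w →* GeomAut K (zeroScheme w) :=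
  MonoidHom.mk' (cAut hn w) (cAut_mul hn w)

lemma cHom_smul [IsSepClosure k K] (hn : n = 2 ∨ n = 3) (w : Vec Q k n) (σ : K ≃ₐ[k] K)
    (g : Stab K w) : cHom hn w (σ • g) = σ • cHom hn w g :=
  cAut_gal hn w σ g

variable (K)

/-- The map `c_w : H¹(k, G_w) ⟶ H¹(k, Aut(Z_w))`. -/
noncomputable def cMap [IsSepClosure k K] (hn : n = 2 ∨ n = 3) (w : Vec Q k n) :
    H1 (K ≃ₐ[k] K) (Stab K w) → H1 (K ≃ₐ[k] K) (GeomAut K (zeroScheme w)) :=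
  H1.map (cHom hn w) (cHom_smul hn w)

/-- The map `d_w : H¹(k, Aut(Z_w)) ⟶ {k-forms of Z_w} / isomorphism`. -/
noncomputable def dMap (w : Vec Q k n) :
    H1 (K ≃ₐ[k] K) (GeomAut K (zeroScheme w)) → IsoClass k :=
  formOfClass (zeroScheme w)

/-- The map `Φ_w = d_w ∘ c_w ∘ b_w ∘ a_w` from `G(k) \ V^ss(k)` to the isomorphism classes of
`k`-schemes. -/
noncomputable def Phi [IsSepClosure k K]
    (hn : n = 2 ∨ n = 3) (w : ssLocus Q n k) (o : SSOrbits Q n) : IsoClass k :=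
  dMap K w.1 (cMap K hn w.1 (bMap K w.1 (aMap K w o)))

variable (k n) in
/-- The binary form `v₁ v₂` for `n = 2` and `v₁ v₂ (v₁ - v₂)` for `n = 3`. (It is not used for
other `n`.) -/
noncomputable def stdForm : BinaryForm k n :=
  match n with
  | 2 => ⟨X 0 * X 1, (isHomogeneous_X k 0).mul (isHomogeneous_X k 1)⟩
  | 3 => ⟨X 0 * X 1 * (X 0 - X 1), ((isHomogeneous_X k 0).mul (isHomogeneous_X k 1)).mul
      ((isHomogeneous_X k 0).sub (isHomogeneous_X k 1))⟩
  | _ => 0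

variable (k n) in
/-- The set `𝒫_n` of isomorphism classes of `k`-forms of `Proj k[v₁, v₂] / (v₁ v₂)` for `n = 2`
and of `Proj k[v₁, v₂] / (v₁ v₂ (v₁ - v₂))` for `n = 3`. -/
def formClasses : Set (IsoClass k) :=
  {c | ∃ Y, IsForm K (formVar (stdForm k n)) Y ∧ isoClass Y = c}

end Main

end PrehomOrbits

open PrehomOrbits

/-! Write K for the separable closure. If g ∈ G(K) satisfies g w = x, then F_x is a non-zero
multiple of F_w(v g₂), so v ↦ v g₂ is an isomorphism ψ from Z_x to Z_w over K. As F_w and F_x have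
coefficients in k, conjugating ψ by σ gives v ↦ v σ(g₂). Hence the cocycle of the form Z_x attached
to ψ is v ↦ v g₂⁻¹ σ(g₂), which is the image under c_w of the cocycle g⁻¹ σ(g) representing
b_w(a_w(x)). This is `formCocycle_zeroSchemeIso`, and it makes Z_x a form of Z_w of the class
c_w(b_w(a_w(x))) (`isFormOfClass_zeroScheme`).

Two facts remain. The first is that a class determines its form up to isomorphism, since
`formOfClass` merely chooses one. Over K the scheme Z_w is finite and discrete, so every form of it
is affine (`isAffine_of_geom`). A Galois-invariant isomorphism between base changes of affine
schemes descends to k because the invariants of A ⊗ K are A (`nonempty_iso_of_galIso`,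
`formOfClass_eq`).

The second is the existence of g, that is, transitivity of G(K) on the semistable locus
(`exists_smul_stdVec_eq`). Over K the form F_x has n distinct zeros, and GL₂ moves them to (1, 0),
(0, 1) and, for n = 3, (1, 1). At a simple zero the Hermitian matrix x(v) is singular, but its
adjugate is not zero; a suitable combination of the columns of the adjugate is a unimodular vector
in the kernel. The kernel vectors at the different zeros form a basis over B ⊗ K in which both
members of the pair are diagonal. Every element of K is a reduced norm from B ⊗ K, so rescaling the
basis leads to the standard pair `stdVec`. That pair is rational over k and its binary form is v₁ v₂
or v₁ v₂ (v₁ - v₂), so transitivity also shows that Z_x lies in 𝒫_n. -/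

namespace PrehomOrbits

/-! ### Adjugates of quaternionic Hermitian matrices and the derivative of the Pfaffian -/

section Adjugate

open MvPolynomial

variable {k : Type*} [Field k] {Q : QuaternionData k} {R : Type*} [CommRing R] [Algebra k R] {n : ℕ}

/-- The quaternion `r + 0 i + 0 j + 0 ij`. -/
def Quat.scal (r : R) : Quat Q R := ⟨r, 0, 0, 0⟩

lemma Quat.IsScalar.eq_scal {q : Quat Q R} (h : q.IsScalar) : q = Quat.scal q.re := by
  obtain ⟨h1, h2, h3⟩ := h
  ext <;> simp [Quat.scal, *]

lemma Herm.star_apply {y : Matrix (Fin n) (Fin n) (Quat Q R)} (hy : y ∈ Herm Q R n) (i j : Fin n) :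
    star (y i j) = y j i := by
  rw [← Matrix.conjTranspose_apply, hy.1]

/-- Rewriting a Hermitian matrix through independent entries turns the identities below into
polynomial identities in the coordinates. -/
lemma Herm.eq_two {y : Matrix (Fin 2) (Fin 2) (Quat Q R)} (hy : y ∈ Herm Q R 2) :
    y = !![Quat.scal (y 0 0).re, y 0 1; star (y 0 1), Quat.scal (y 1 1).re] := by
  ext1 i j
  fin_cases i <;> fin_cases j <;>
    simp [Herm.star_apply hy, ← (hy.2 0).eq_scal, ← (hy.2 1).eq_scal]

/-- The independent off-diagonal entries are taken in the cyclic positions 01, 12, 20, the ones that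
occur in `pfaff`. -/
lemma Herm.eq_three {y : Matrix (Fin 3) (Fin 3) (Quat Q R)} (hy : y ∈ Herm Q R 3) :
    y = !![Quat.scal (y 0 0).re, y 0 1, star (y 2 0);
      star (y 0 1), Quat.scal (y 1 1).re, y 1 2;
      y 2 0, star (y 1 2), Quat.scal (y 2 2).re] := by
  ext1 i j
  fin_cases i <;> fin_cases j <;>
    simp [Herm.star_apply hy, ← (hy.2 0).eq_scal, ← (hy.2 1).eq_scal, ← (hy.2 2).eq_scal]

/-- The adjugate of a Hermitian matrix of size `2` or `3`. (It is not used for other sizes.) -/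
def hermAdj {n : ℕ} (y : Matrix (Fin n) (Fin n) (Quat Q R)) : Matrix (Fin n) (Fin n) (Quat Q R) :=
  match n, y with
  | 2, y => !![y 1 1, -y 0 1; -y 1 0, y 0 0]
  | 3, y => !![y 1 1 * y 2 2 - y 1 2 * y 2 1, y 0 2 * y 2 1 - y 2 2 * y 0 1,
        y 0 1 * y 1 2 - y 1 1 * y 0 2;
      y 1 2 * y 2 0 - y 2 2 * y 1 0, y 0 0 * y 2 2 - y 0 2 * y 2 0, y 1 0 * y 0 2 - y 0 0 * y 1 2;
      y 2 1 * y 1 0 - y 1 1 * y 2 0, y 2 0 * y 0 1 - y 0 0 * y 2 1, y 0 0 * y 1 1 - y 0 1 * y 1 0]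
  | _, _ => 0

set_option maxHeartbeats 2000000 in
lemma hermAdj_mem {y : Matrix (Fin n) (Fin n) (Quat Q R)} (hn : n = 2 ∨ n = 3)
    (hy : y ∈ Herm Q R n) : hermAdj y ∈ Herm Q R n := by
  rcases hn with rfl | rfl
  · rw [Herm.eq_two hy]
    generalize (y 0 0).re = α, (y 1 1).re = β, y 0 1 = p
    refine ⟨?_, fun i => ?_⟩
    · ext1 i j
      fin_cases i <;> fin_cases j <;> ext <;>
        simp [hermAdj, Quat.scal, Matrix.conjTranspose_apply]
    · fin_cases i <;> simp [hermAdj, Quat.IsScalar, Quat.scal]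
  · rw [Herm.eq_three hy]
    generalize (y 0 0).re = α, (y 1 1).re = β, (y 2 2).re = γ, y 0 1 = p, y 1 2 = q, y 2 0 = r
    refine ⟨?_, fun i => ?_⟩
    · ext1 i j
      fin_cases i <;> fin_cases j <;> ext <;>
        simp [hermAdj, Quat.scal, Matrix.conjTranspose_apply] <;> ring
    · fin_cases i <;> simp [hermAdj, Quat.IsScalar, Quat.scal] <;>
        (try constructor) <;> (try constructor) <;> ring

set_option maxHeartbeats 4000000 in
-- The cofactor formula survives non-commutativity because y is Hermitian: products such as y₀₁ y₁₀
-- are norms, hence central, and the two triple products in a diagonal entry are conjugate, so that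
-- they add up to the reduced trace in `pfaff`.
lemma mul_hermAdj {y : Matrix (Fin n) (Fin n) (Quat Q R)} (hn : n = 2 ∨ n = 3)
    (hy : y ∈ Herm Q R n) : y * hermAdj y = pfaff Q y • 1 := by
  rcases hn with rfl | rfl
  · rw [Herm.eq_two hy]
    generalize (y 0 0).re = α, (y 1 1).re = β, y 0 1 = p
    ext1 i j
    fin_cases i <;> fin_cases j <;> ext <;>
      simp [hermAdj, Quat.scal, Matrix.mul_apply, pfaff, Quat.nrd, Fin.sum_univ_two] <;> ring
  · rw [Herm.eq_three hy]
    generalize (y 0 0).re = α, (y 1 1).re = β, (y 2 2).re = γ, y 0 1 = p, y 1 2 = q, y 2 0 = r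
    ext1 i j
    fin_cases i <;> fin_cases j <;> ext <;>
      simp [hermAdj, Quat.scal, Matrix.mul_apply, pfaff, Quat.nrd, Quat.trd,
        Fin.sum_univ_three] <;> ring

lemma hermAdj_mul {y : Matrix (Fin n) (Fin n) (Quat Q R)} (hn : n = 2 ∨ n = 3)
    (hy : y ∈ Herm Q R n) : hermAdj y * y = pfaff Q y • 1 := by
  have h := congrArg Matrix.conjTranspose (mul_hermAdj hn hy)
  rw [Matrix.conjTranspose_mul, (hermAdj_mem hn hy).1, hy.1] at h
  rw [h]
  ext1 i j
  rw [Matrix.conjTranspose_apply]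
  simp only [Matrix.smul_apply, Matrix.one_apply]
  by_cases hij : i = j
  · subst hij
    ext <;> simp
  · rw [if_neg hij, if_neg (Ne.symm hij)]
    simp

/-- The derivative at `y` in the direction `z` of `Pfaff_n`. -/
def pfaffDeriv {n : ℕ} (y z : Matrix (Fin n) (Fin n) (Quat Q R)) : R :=
  match n, y, z with
  | 2, y, z => (y 1 1).re * (z 0 0).re + (y 0 0).re * (z 1 1).re - (y 0 1 * star (z 0 1)).trd
  | 3, y, z => ((y 1 1).re * (y 2 2).re - (y 1 2).nrd) * (z 0 0).re +
      ((y 0 0).re * (y 2 2).re - (y 2 0).nrd) * (z 1 1).re +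
      ((y 0 0).re * (y 1 1).re - (y 0 1).nrd) * (z 2 2).re +
      (hermAdj y 1 0 * z 0 1).trd + (hermAdj y 2 1 * z 1 2).trd + (hermAdj y 0 2 * z 2 0).trd
  | _, _, _ => 0

lemma pfaff_smul_add_smul_two {y z : Matrix (Fin 2) (Fin 2) (Quat Q R)} (s t : R) :
    pfaff Q (s • y + t • z) = s ^ 2 * pfaff Q y + s * t * pfaffDeriv y z + t ^ 2 * pfaff Q z := by
  simp [pfaff, pfaffDeriv, Quat.nrd, Quat.trd]
  ring

/-- Hermitian symmetry is needed here, unlike in size 2: `pfaffDeriv` contains entries of `hermAdj`,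
which involve y 1 0 and the imaginary parts of the diagonal, while `pfaff` ignores these. -/
lemma pfaff_smul_add_smul_three {y z : Matrix (Fin 3) (Fin 3) (Quat Q R)} (hy : y ∈ Herm Q R 3)
    (hz : z ∈ Herm Q R 3) (s t : R) :
    pfaff Q (s • y + t • z) = s ^ 3 * pfaff Q y + s ^ 2 * t * pfaffDeriv y z +
      s * t ^ 2 * pfaffDeriv z y + t ^ 3 * pfaff Q z := by
  rw [Herm.eq_three hy, Herm.eq_three hz]
  generalize (y 0 0).re = α, (y 1 1).re = β, (y 2 2).re = γ, y 0 1 = p, y 1 2 = q, y 2 0 = r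
  generalize (z 0 0).re = α', (z 1 1).re = β', (z 2 2).re = γ', z 0 1 = p', z 1 2 = q', z 2 0 = r'
  simp [hermAdj, Quat.scal, pfaff, pfaffDeriv, Quat.nrd, Quat.trd]
  ring

/-- The coefficients of the derivative in the direction z are entries of the adjugate. Read
contrapositively: where the derivative does not vanish, neither does the adjugate, and this is how a
simple zero of F_x enters the argument. -/
lemma pfaffDeriv_eq_zero {y z : Matrix (Fin n) (Fin n) (Quat Q R)} (hy : y ∈ Herm Q R n)
    (h : hermAdj y = 0) : pfaffDeriv y z = 0 := by
  match n, y, z with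
  | 2, y, z =>
    have h0 : y 1 1 = 0 := congrFun (congrFun h 0) 0
    have h1 : y 0 0 = 0 := congrFun (congrFun h 1) 1
    have h2 : y 0 1 = 0 := neg_eq_zero.1 (congrFun (congrFun h 0) 1)
    simp [pfaffDeriv, h0, h1, h2, Quat.trd]
  | 3, y, z =>
    have e0 : (hermAdj y 0 0).re = (y 1 1).re * (y 2 2).re - (y 1 2).nrd := by
      rw [Herm.eq_three hy]
      simp [hermAdj, Quat.nrd, Quat.scal]
    have e1 : (hermAdj y 1 1).re = (y 0 0).re * (y 2 2).re - (y 2 0).nrd := by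
      rw [Herm.eq_three hy]
      simp [hermAdj, Quat.nrd, Quat.scal]
      ring
    have e2 : (hermAdj y 2 2).re = (y 0 0).re * (y 1 1).re - (y 0 1).nrd := by
      rw [Herm.eq_three hy]
      simp [hermAdj, Quat.nrd, Quat.scal]
    simp only [pfaffDeriv, ← e0, ← e1, ← e2, h]
    simp [Quat.trd]
  | 0, y, z => rfl
  | 1, y, z => rfl
  | (m + 4), y, z => rfl

end Adjugate

/-! ### Binary quadratic and cubic forms, and their discriminants under the action of G -/

section Disc

open MvPolynomial

variable {k : Type*} [Field k] {Q : QuaternionData k} {n : ℕ}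
variable {R S : Type*} [CommRing R] [Algebra k R] [CommRing S] [Algebra k S]

lemma pfaffDeriv_map (f : R →ₐ[k] S) (y z : Matrix (Fin n) (Fin n) (Quat Q R)) :
    pfaffDeriv (y.map (Quat.map Q f)) (z.map (Quat.map Q f)) = f (pfaffDeriv y z) := by
  match n, y, z with
  | 2, y, z =>
    simp only [pfaffDeriv, Matrix.map_apply, ← Quat.map_star, ← map_mul (Quat.map Q f),
      Quat.trd_map, Quat.map_re, map_add, map_sub, map_mul f]
  | 3, y, z =>
    simp only [pfaffDeriv, hermAdj, Matrix.map_apply, Quat.nrd_map, Quat.map_re, Matrix.of_apply,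
      Matrix.cons_val, ← map_mul (Quat.map Q f), ← map_sub (Quat.map Q f), Quat.trd_map, map_add f,
      map_sub f, map_mul f]
  | 0, y, z => simp [pfaffDeriv]
  | 1, y, z => simp [pfaffDeriv]
  | (m + 4), y, z => simp [pfaffDeriv]

/-- The binary quadratic form with the given coefficients. -/
noncomputable def quadForm (a b c : R) : MvPolynomial (Fin 2) R :=
  X 0 ^ 2 * C a + X 0 * X 1 * C b + X 1 ^ 2 * C c

/-- The binary cubic form with the given coefficients. -/
noncomputable def cubicForm (a b c d : R) : MvPolynomial (Fin 2) R :=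
  X 0 ^ 3 * C a + X 0 ^ 2 * X 1 * C b + X 0 * X 1 ^ 2 * C c + X 1 ^ 3 * C d

lemma coeff_X_pow_mul_X_pow_mul_C (i j i' j' : ℕ) (a : R) :
    (X 0 ^ i * X 1 ^ j * C a : MvPolynomial (Fin 2) R).coeff
      (Finsupp.single 0 i' + Finsupp.single 1 j') = if i = i' ∧ j = j' then a else 0 := by
  have e : (X 0 ^ i * X 1 ^ j * C a : MvPolynomial (Fin 2) R) =
      monomial (Finsupp.single 0 i + Finsupp.single 1 j) a := by
    rw [X_pow_eq_monomial, X_pow_eq_monomial, monomial_mul, mul_comm, C_mul_monomial]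
    simp
  rw [e, coeff_monomial]
  simp [Finsupp.ext_iff, Fin.forall_fin_two]

lemma binaryDisc_quadForm (a b c : R) : binaryDisc 2 (quadForm a b c) = b ^ 2 - 4 * a * c := by
  -- The exponents 0 and 1 are written out so that `coeff_X_pow_mul_X_pow_mul_C` applies to every
  -- term.
  have e : quadForm a b c = X 0 ^ 2 * X 1 ^ 0 * C a + X 0 ^ 1 * X 1 ^ 1 * C b +
      X 0 ^ 0 * X 1 ^ 2 * C c := by simp [quadForm]
  rw [e]
  simp only [binaryDisc, coeff_add, coeff_X_pow_mul_X_pow_mul_C]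
  simp

lemma binaryDisc_cubicForm (a b c d : R) : binaryDisc 3 (cubicForm a b c d) =
    b ^ 2 * c ^ 2 - 4 * a * c ^ 3 - 4 * b ^ 3 * d - 27 * a ^ 2 * d ^ 2 + 18 * a * b * c * d := by
  have e : cubicForm a b c d = X 0 ^ 3 * X 1 ^ 0 * C a + X 0 ^ 2 * X 1 ^ 1 * C b +
      X 0 ^ 1 * X 1 ^ 2 * C c + X 0 ^ 0 * X 1 ^ 3 * C d := by simp [cubicForm]
  rw [e]
  simp only [binaryDisc, coeff_add, coeff_X_pow_mul_X_pow_mul_C]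
  simp

lemma C_mul_quadForm (e a b c : R) : C e * quadForm a b c = quadForm (e * a) (e * b) (e * c) := by
  simp only [quadForm, map_mul]
  ring

lemma C_mul_cubicForm (e a b c d : R) :
    C e * cubicForm a b c d = cubicForm (e * a) (e * b) (e * c) (e * d) := by
  simp only [cubicForm, map_mul]
  ring

lemma subst_quadForm (g : Matrix (Fin 2) (Fin 2) R) (a b c : R) : subst g (quadForm a b c) =
    quadForm (a * g 0 0 ^ 2 + b * g 0 0 * g 0 1 + c * g 0 1 ^ 2)
      (2 * a * g 0 0 * g 1 0 + b * (g 0 0 * g 1 1 + g 1 0 * g 0 1) + 2 * c * g 0 1 * g 1 1)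
      (a * g 1 0 ^ 2 + b * g 1 0 * g 1 1 + c * g 1 1 ^ 2) := by
  simp only [quadForm, subst, map_add, map_mul, map_pow, aeval_X, algHom_C,
    MvPolynomial.algebraMap_eq, Fin.sum_univ_two, map_ofNat]
  ring

lemma subst_cubicForm (g : Matrix (Fin 2) (Fin 2) R) (a b c d : R) :
    subst g (cubicForm a b c d) = cubicForm
      (a * g 0 0 ^ 3 + b * g 0 0 ^ 2 * g 0 1 + c * g 0 0 * g 0 1 ^ 2 + d * g 0 1 ^ 3)
      (3 * a * g 0 0 ^ 2 * g 1 0 + b * (2 * g 0 0 * g 1 0 * g 0 1 + g 0 0 ^ 2 * g 1 1) +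
        c * (g 1 0 * g 0 1 ^ 2 + 2 * g 0 0 * g 0 1 * g 1 1) + 3 * d * g 0 1 ^ 2 * g 1 1)
      (3 * a * g 0 0 * g 1 0 ^ 2 + b * (g 1 0 ^ 2 * g 0 1 + 2 * g 0 0 * g 1 0 * g 1 1) +
        c * (2 * g 1 0 * g 0 1 * g 1 1 + g 0 0 * g 1 1 ^ 2) + 3 * d * g 0 1 * g 1 1 ^ 2)
      (a * g 1 0 ^ 3 + b * g 1 0 ^ 2 * g 1 1 + c * g 1 0 * g 1 1 ^ 2 + d * g 1 1 ^ 3) := by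
  simp only [cubicForm, subst, map_add, map_mul, map_pow, aeval_X, algHom_C,
    MvPolynomial.algebraMap_eq, Fin.sum_univ_two, map_ofNat]
  ring

lemma Vec.lin_eq (x : Vec Q R n) : (x.lin Q n).1 = (X 0 : MvPolynomial (Fin 2) R) •
      (x 0).1.map (Quat.map Q (IsScalarTower.toAlgHom k R (MvPolynomial (Fin 2) R))) +
    (X 1 : MvPolynomial (Fin 2) R) •
      (x 1).1.map (Quat.map Q (IsScalarTower.toAlgHom k R (MvPolynomial (Fin 2) R))) := by
  ext1 i j
  exact Vec.lin_apply Q n x i j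

lemma Vec.form_eq_quadForm (x : Vec Q R 2) :
    x.form = quadForm (pfaff Q (x 0).1) (pfaffDeriv (x 0).1 (x 1).1) (pfaff Q (x 1).1) := by
  rw [Vec.form, Vec.lin_eq, pfaff_smul_add_smul_two]
  simp only [pfaff_map, pfaffDeriv_map]
  rfl

lemma Vec.form_eq_cubicForm (x : Vec Q R 3) :
    x.form = cubicForm (pfaff Q (x 0).1) (pfaffDeriv (x 0).1 (x 1).1)
      (pfaffDeriv (x 1).1 (x 0).1) (pfaff Q (x 1).1) := by
  rw [Vec.form, Vec.lin_eq, ← Herm.map_coe, ← Herm.map_coe,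
    pfaff_smul_add_smul_three (Subtype.prop _) (Subtype.prop _)]
  simp only [Herm.map_coe, pfaff_map, pfaffDeriv_map]
  rfl

/-- Divisibility for g and for g⁻¹ makes the two forms associated, and the units of a polynomial
ring over a field are the non-zero constants. The value of c is irrelevant in the sequel. -/
lemma associated_form_smul (hn : n = 2 ∨ n = 3) {L : Type*} [Field L] [Algebra k L] (t : L)
    (ht : t ^ 2 = algebraMap k L Q.b * t + algebraMap k L Q.a) (g : Grp Q L n) (x : Vec Q L n) :
    ∃ c : L, c ≠ 0 ∧ (g • x).form = C c * subst g.2.1 x.form := by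
  have h1 := form_smul_dvd Q n hn t ht g x
  have h2 := form_smul_dvd Q n hn t ht g⁻¹ (g • x)
  rw [inv_smul_smul] at h2
  -- Substituting v g₂ in the divisibility for g⁻¹ gives F_x(v g₂) ∣ F_{gx}(v).
  have h3 := map_dvd (subst g.2.1) h2
  have e : (g⁻¹).2 = g.2⁻¹ := rfl
  rw [← AlgHom.comp_apply, ← subst_mul, e, ← Units.val_mul, mul_inv_cancel, Units.val_one,
    subst_one, AlgHom.id_apply] at h3
  obtain ⟨u, hu⟩ := associated_of_dvd_dvd h3 h1
  obtain ⟨c, hc, hc'⟩ := MvPolynomial.isUnit_iff_eq_C_of_isReduced.1 u.isUnit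
  exact ⟨c, hc.ne_zero, by rw [← hu, hc', mul_comm]⟩

/-- The discriminant of e F(v g) is e² det(g)² disc(F) in degree 2 and e⁴ det(g)⁶ disc(F) in degree
3. -/
lemma disc_smul_ne_zero (hn : n = 2 ∨ n = 3) {L : Type*} [Field L] [Algebra k L] (t : L)
    (ht : t ^ 2 = algebraMap k L Q.b * t + algebraMap k L Q.a) (g : Grp Q L n) {x : Vec Q L n}
    (hx : x.disc ≠ 0) : (g • x).disc ≠ 0 := by
  obtain ⟨e, he, h⟩ := associated_form_smul hn t ht g x
  have hg : g.2.1.det ≠ 0 := ((Matrix.isUnit_iff_isUnit_det _).1 g.2.isUnit).ne_zero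
  rw [Matrix.det_fin_two] at hg
  rw [Vec.disc] at hx ⊢
  rw [h]
  rcases hn with rfl | rfl
  · rw [Vec.form_eq_quadForm, binaryDisc_quadForm] at hx
    rw [Vec.form_eq_quadForm, subst_quadForm, C_mul_quadForm, binaryDisc_quadForm]
    refine (mul_ne_zero (mul_ne_zero (pow_ne_zero 2 he) (pow_ne_zero 2 hg)) hx) ∘ ?_
    intro h'
    rw [← h']
    ring
  · rw [Vec.form_eq_cubicForm, binaryDisc_cubicForm] at hx
    rw [Vec.form_eq_cubicForm, subst_cubicForm, C_mul_cubicForm, binaryDisc_cubicForm]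
    refine (mul_ne_zero (mul_ne_zero (pow_ne_zero 4 he) (pow_ne_zero 6 hg)) hx) ∘ ?_
    intro h'
    rw [← h']
    ring

end Disc

/-! ### Zeros of binary forms over a separably closed field -/

section Roots

variable {K : Type*} [Field K] [IsSepClosed K]

/-- A binary quadratic form with non-zero discriminant over a separably closed field has two
zeros. -/
lemma exists_zeros_quad (a b c : K) (h : b ^ 2 - 4 * a * c ≠ 0) :
    ∃ p q : Fin 2 → K, p 0 * q 1 - p 1 * q 0 ≠ 0 ∧
      (a * p 0 ^ 2 + b * p 0 * p 1 + c * p 1 ^ 2 = 0) ∧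
      (a * q 0 ^ 2 + b * q 0 * q 1 + c * q 1 ^ 2 = 0) := by
  by_cases ha : a = 0
  · subst ha
    have hb : b ≠ 0 := by
      rintro rfl
      simp at h
    -- For a = 0 the form is v₂ (b v₁ + c v₂).
    refine ⟨![1, 0], ![c, -b], by simpa using hb, by simp, ?_⟩
    simp
    ring
  · have hd : (-b / a) ^ 2 + 4 * (-c / a) ≠ 0 := by
      have : (-b / a) ^ 2 + 4 * (-c / a) = (b ^ 2 - 4 * a * c) / a ^ 2 := by
        field_simp
        ring
      rw [this]
      exact div_ne_zero h (pow_ne_zero 2 ha)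
    -- The equation t² = -(b/a) t - c/a has the shape treated by `exists_root`, whose argument is
    -- valid in characteristic 2. The third constant of this auxiliary quaternion algebra is an
    -- arbitrary non-zero element.
    obtain ⟨t, ht⟩ := exists_root (k := K) (K := K) ⟨-c / a, -b / a, 1, hd, one_ne_zero⟩
    simp only [Algebra.algebraMap_self, RingHom.id_apply] at ht
    have ht' : a * t ^ 2 + b * t + c = 0 := by
      rw [ht]
      field_simp
      ring
    refine ⟨![t, 1], ![-b / a - t, 1], ?_, ?_, ?_⟩
    · simp only [Matrix.cons_val_zero, Matrix.cons_val_one]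
      intro h0
      -- If t equals the other root -b/a - t, then 2at + b = 0, and b² - 4ac = (2at + b)² - 4a(at² +
      -- bt + c) vanishes.
      have e : 2 * a * t + b = 0 := by
        field_simp at h0
        linear_combination h0
      refine h ?_
      linear_combination (2 * a * t + b) * e - 4 * a * ht'
    · simp
      linear_combination ht'
    · have e : a * (-b / a) = -b := by field_simp
      simp only [Matrix.cons_val_zero, Matrix.cons_val_one]
      linear_combination ht' + (-b / a - 2 * t) * e

/-- If a = 0, the form is v₂ times a quadratic form, and its discriminant is b² times that of the
quadratic form. If a ≠ 0, the dehomogenized cubic is separable and therefore splits over K. -/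
lemma exists_zeros_cubic_aux (a b c d : K)
    (h : b ^ 2 * c ^ 2 - 4 * a * c ^ 3 - 4 * b ^ 3 * d - 27 * a ^ 2 * d ^ 2
      + 18 * a * b * c * d ≠ 0) :
    ∃ p q r : Fin 2 → K, p 0 * q 1 - p 1 * q 0 ≠ 0 ∧ p 0 * r 1 - p 1 * r 0 ≠ 0 ∧
      q 0 * r 1 - q 1 * r 0 ≠ 0 ∧
      (a * p 0 ^ 3 + b * p 0 ^ 2 * p 1 + c * p 0 * p 1 ^ 2 + d * p 1 ^ 3 = 0) ∧
      (a * q 0 ^ 3 + b * q 0 ^ 2 * q 1 + c * q 0 * q 1 ^ 2 + d * q 1 ^ 3 = 0) ∧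
      (a * r 0 ^ 3 + b * r 0 ^ 2 * r 1 + c * r 0 * r 1 ^ 2 + d * r 1 ^ 3 = 0) := by
  by_cases ha : a = 0
  · subst ha
    have hb : b ≠ 0 := by
      rintro rfl
      simp at h
    have hd : c ^ 2 - 4 * b * d ≠ 0 := fun h0 => h (by linear_combination b ^ 2 * h0)
    obtain ⟨p, q, h1, h2, h3⟩ := exists_zeros_quad b c d hd
    have key (p : Fin 2 → K) (h2 : b * p 0 ^ 2 + c * p 0 * p 1 + d * p 1 ^ 2 = 0)
        (hp : p 1 = 0) : p 0 = 0 := by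
      rw [hp] at h2
      simpa [hb] using h2
    refine ⟨p, q, ![1, 0], h1, ?_, ?_, ?_, ?_, ?_⟩
    · intro h0
      have hp : p 1 = 0 := by simpa using h0
      exact h1 (by rw [hp, key p h2 hp]; ring)
    · intro h0
      have hq : q 1 = 0 := by simpa using h0
      exact h1 (by rw [hq, key q h3 hq]; ring)
    · linear_combination p 1 * h2
    · linear_combination q 1 * h3
    · simp
  · let P : Cubic K := ⟨a, b, c, d⟩
    have hP : P.discr ≠ 0 := by
      intro h0
      refine h ?_
      rw [← h0, Cubic.discr]
    have hP0 : P.toPoly ≠ 0 := Cubic.ne_zero_of_a_ne_zero ha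
    -- Separability is tested over the algebraic closure, where the cubic splits and the
    -- discriminant detects repeated roots.
    have hs := IsAlgClosed.splits (P.toPoly.map (algebraMap K (AlgebraicClosure K)))
    have hsep : P.toPoly.Separable := by
      have h1 := (Cubic.discr_ne_zero_iff_roots_nodup ha hs).1 hP
      rw [Cubic.map_roots] at h1
      exact (Polynomial.separable_map _).1 ((Polynomial.nodup_roots_iff_of_splits
        (Polynomial.map_ne_zero hP0) hs).1 h1)
    have hs' : (P.toPoly.map (RingHom.id K)).Splits := by
      rw [Polynomial.map_id]
      exact IsSepClosed.splits_of_separable _ hsep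
    obtain ⟨x, y, z, hr⟩ := (Cubic.splits_iff_roots_eq_three ha).1 hs'
    obtain ⟨h1, h2, h3⟩ := (Cubic.discr_ne_zero_iff_roots_ne ha hr).1 hP
    have key (x : K) (hx : x ∈ (Cubic.map (RingHom.id K) P).roots) :
        a * x ^ 3 + b * x ^ 2 + c * x + d = 0 := by
      rw [Cubic.map_roots, Polynomial.map_id] at hx
      have := (Polynomial.mem_roots hP0).1 hx
      simpa [Cubic.toPoly, P] using this
    have hx := key x (by rw [hr]; simp)
    have hy := key y (by rw [hr]; simp)
    have hz := key z (by rw [hr]; simp)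
    refine ⟨![x, 1], ![y, 1], ![z, 1], ?_, ?_, ?_, ?_, ?_, ?_⟩
    · simpa [sub_eq_zero] using h1
    · simpa [sub_eq_zero] using h2
    · simpa [sub_eq_zero] using h3
    · simpa using hx
    · simpa using hy
    · simpa using hz

/-- A binary cubic form with non-zero discriminant over a separably closed field has three zeros
`p`, `q` and `p + q`. -/
lemma exists_zeros_cubic (a b c d : K)
    (h : b ^ 2 * c ^ 2 - 4 * a * c ^ 3 - 4 * b ^ 3 * d - 27 * a ^ 2 * d ^ 2
      + 18 * a * b * c * d ≠ 0) :
    ∃ p q : Fin 2 → K, p 0 * q 1 - p 1 * q 0 ≠ 0 ∧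
      (a * p 0 ^ 3 + b * p 0 ^ 2 * p 1 + c * p 0 * p 1 ^ 2 + d * p 1 ^ 3 = 0) ∧
      (a * q 0 ^ 3 + b * q 0 ^ 2 * q 1 + c * q 0 * q 1 ^ 2 + d * q 1 ^ 3 = 0) ∧
      (a * (p 0 + q 0) ^ 3 + b * (p 0 + q 0) ^ 2 * (p 1 + q 1) +
        c * (p 0 + q 0) * (p 1 + q 1) ^ 2 + d * (p 1 + q 1) ^ 3 = 0) := by
  obtain ⟨p, q, r, h1, h2, h3, h4, h5, h6⟩ := exists_zeros_cubic_aux a b c d h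
  -- With [p q] = p₀q₁ - p₁q₀, the relation [q r] p - [p r] q = -[p q] r makes the sum of the
  -- rescaled p and q a multiple of the third zero r.
  refine ⟨(q 0 * r 1 - q 1 * r 0) • p, (p 1 * r 0 - p 0 * r 1) • q, ?_, ?_, ?_, ?_⟩
  · have e : p 1 * r 0 - p 0 * r 1 ≠ 0 := fun h0 => h2 (by linear_combination -h0)
    refine (mul_ne_zero (mul_ne_zero h3 e) h1) ∘ fun h0 => ?_
    rw [← h0]
    simp only [Pi.smul_apply, smul_eq_mul]
    ring
  · simp only [Pi.smul_apply, smul_eq_mul]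
    linear_combination (q 0 * r 1 - q 1 * r 0) ^ 3 * h4
  · simp only [Pi.smul_apply, smul_eq_mul]
    linear_combination (p 1 * r 0 - p 0 * r 1) ^ 3 * h5
  · have e0 : (q 0 * r 1 - q 1 * r 0) * p 0 + (p 1 * r 0 - p 0 * r 1) * q 0 =
        - (p 0 * q 1 - p 1 * q 0) * r 0 := by ring
    have e1 : (q 0 * r 1 - q 1 * r 0) * p 1 + (p 1 * r 0 - p 0 * r 1) * q 1 =
        - (p 0 * q 1 - p 1 * q 0) * r 1 := by ring
    simp only [Pi.smul_apply, smul_eq_mul, e0, e1]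
    linear_combination (- (p 0 * q 1 - p 1 * q 0)) ^ 3 * h6

end Roots

/-! ### Unimodular kernel vectors of singular Hermitian matrices -/

section Kernel

variable {k : Type*} [Field k] {Q : QuaternionData k} {L : Type*} [Field L] [Algebra k L] {n : ℕ}

/-- The splitting of B ⊗ L given by t sends the witness to diag(r, 1). The division is legitimate
because (2t - b)² = b² + 4a ≠ 0. -/
lemma Quat.exists_nrd_eq (t : L) (ht : t ^ 2 = algebraMap k L Q.b * t + algebraMap k L Q.a)
    (r : L) : ∃ q : Quat Q L, q.nrd = r := by
  set a := algebraMap k L Q.a with ha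
  set b := algebraMap k L Q.b with hb
  have hd : 2 * t - b ≠ 0 := by
    intro h0
    have h1 : algebraMap k L (Q.b ^ 2 + 4 * Q.a) = 0 := by
      rw [map_add, map_mul, map_pow, map_ofNat, ← ha, ← hb]
      linear_combination (2 * t - b) * h0 - 4 * ht
    exact Q.separable ((map_eq_zero _).1 h1)
  set y := (r - 1) / (2 * t - b) with hy
  have hy' : y * (2 * t - b) = r - 1 := by
    rw [hy]
    field_simp
  refine ⟨⟨r - y * t, y, 0, 0⟩, ?_⟩
  simp only [Quat.nrd, QuaternionAlgebra.re_mul, QuaternionAlgebra.re_star,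
    QuaternionAlgebra.imI_star, QuaternionAlgebra.imJ_star, QuaternionAlgebra.imK_star, ← ha, ← hb]
  linear_combination (-r) * hy' + y ^ 2 * ht

/-- The trace form is non-degenerate: pairing with 1, i, j, ij gives one linear system for `re`,
`imI` and one for `imJ`, `imK`, and both are solved using only that b² + 4a and c are non-zero.
Nothing is divided by 2, so characteristic 2 is included. -/
lemma Quat.exists_trd_mul_ne_zero {q : Quat Q L} (hq : q ≠ 0) :
    ∃ r : Quat Q L, (q * r).trd ≠ 0 := by
  by_contra! h
  refine hq ?_
  have hd : algebraMap k L Q.b ^ 2 + 4 * algebraMap k L Q.a ≠ 0 := by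
    have h1 : algebraMap k L (Q.b ^ 2 + 4 * Q.a) ≠ 0 := (map_ne_zero _).2 Q.separable
    rwa [map_add, map_mul, map_pow, map_ofNat] at h1
  have hc : algebraMap k L Q.c ≠ 0 := (map_ne_zero _).2 Q.c_ne_zero
  set a := algebraMap k L Q.a
  set b := algebraMap k L Q.b
  set c := algebraMap k L Q.c
  have h1 := h ⟨1, 0, 0, 0⟩
  have h2 := h ⟨0, 1, 0, 0⟩
  have h3 := h ⟨0, 0, 1, 0⟩
  have h4 := h ⟨0, 0, 0, 1⟩
  simp [Quat.trd] at h1 h2 h3 h4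
  have e2 : q.imI = 0 := by
    refine (mul_eq_zero.1 (?_ : (b ^ 2 + 4 * a) * q.imI = 0)).resolve_left hd
    linear_combination 2 * h2 - b * h1
  have e1 : q.re = 0 := by
    refine (mul_eq_zero.1 (?_ : (b ^ 2 + 4 * a) * q.re = 0)).resolve_left hd
    linear_combination (b ^ 2 + 2 * a) * h1 - b * h2
  have e4 : q.imK = 0 := by
    refine (mul_eq_zero.1 (?_ : c * (b ^ 2 + 4 * a) * q.imK = 0)).resolve_left (mul_ne_zero hc hd)
    linear_combination b * h3 - 2 * h4
  have e3 : q.imJ = 0 := by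
    refine (mul_eq_zero.1 (?_ : c * (b ^ 2 + 4 * a) * q.imJ = 0)).resolve_left (mul_ne_zero hc hd)
    linear_combination 2 * a * h3 + b * h4
  exact QuaternionAlgebra.ext e1 e2 e3 e4

lemma Quat.add_star (q : Quat Q L) : q + star q = Quat.scal q.trd := by
  ext <;> simp [Quat.trd, Quat.scal]

/-- Since B ⊗ L may have zero divisors, y v ≠ 0 would be too weak; y v has to be unimodular. A
non-zero diagonal entry is an invertible scalar. If the diagonal vanishes and y_ij ≠ 0, then v = e_i
+ e_j γ gives v* y v = y_ij γ + (y_ij γ)* = trd(y_ij γ), which is non-zero for a suitable γ. -/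
lemma Herm.exists_dotProduct_mulVec {y : Matrix (Fin n) (Fin n) (Quat Q L)} (hy : y ∈ Herm Q L n)
    (h0 : y ≠ 0) : ∃ r v : Fin n → Quat Q L, dotProduct r (y.mulVec v) = 1 := by
  have hs {d : L} (hd : d ≠ 0) : Quat.scal (Q := Q) d⁻¹ * Quat.scal d = 1 := by
    ext <;> simp [Quat.scal, hd]
  by_cases hdiag : ∃ i, y i i ≠ 0
  · obtain ⟨i, hi⟩ := hdiag
    have e := (hy.2 i).eq_scal
    have hd : (y i i).re ≠ 0 := by
      intro h
      rw [h] at e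
      exact hi (e.trans rfl)
    refine ⟨Pi.single i (Quat.scal (y i i).re⁻¹), Pi.single i 1, ?_⟩
    rw [single_dotProduct, Matrix.mulVec_single_one, Matrix.col_apply, e]
    exact hs hd
  · push Not at hdiag
    obtain ⟨i, j, hij⟩ : ∃ i j, y i j ≠ 0 := by
      by_contra! h
      exact h0 (Matrix.ext h)
    obtain ⟨γ, hγ⟩ := Quat.exists_trd_mul_ne_zero hij
    refine ⟨Quat.scal (Q := Q) (y i j * γ).trd⁻¹ • 
      ((Pi.single i 1 : Fin n → Quat Q L) + (Pi.single j (star γ) : Fin n → Quat Q L)),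
      Pi.single i 1 + Pi.single j γ, ?_⟩
    have e : dotProduct
        ((Pi.single i 1 : Fin n → Quat Q L) + (Pi.single j (star γ) : Fin n → Quat Q L))
        (y.mulVec (Pi.single i 1 + Pi.single j γ)) = Quat.scal (Q := Q) (y i j * γ).trd := by
      rw [Matrix.mulVec_add, add_dotProduct, single_dotProduct, single_dotProduct,
        Pi.add_apply, Pi.add_apply, Matrix.mulVec_single_one, Matrix.mulVec_single]
      simp only [Matrix.col_apply, Pi.smul_apply, MulOpposite.smul_eq_mul_unop, MulOpposite.unop_op,
        hdiag, ← Herm.star_apply hy i j, zero_add, one_mul, zero_mul, add_zero]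
      rw [← star_mul]
      exact Quat.add_star _
    rw [smul_dotProduct, e]
    exact hs hγ

/-- Multiplication by the adjugate turns y v = 0 into Pfaff(y) v = 0. -/
lemma Herm.eq_zero_of_mulVec_eq_zero (hn : n = 2 ∨ n = 3) {y : Matrix (Fin n) (Fin n) (Quat Q L)}
    (hy : y ∈ Herm Q L n) (h : pfaff Q y ≠ 0) {v : Fin n → Quat Q L} (hv : y.mulVec v = 0) :
    v = 0 := by
  have e := congrArg (hermAdj y).mulVec hv
  rw [Matrix.mulVec_mulVec, hermAdj_mul hn hy, Matrix.mulVec_zero, Matrix.smul_mulVec,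
    Matrix.one_mulVec] at e
  exact (smul_eq_zero.1 e).resolve_left h

/-- The Pfaffian and this derivative are the coefficients of v₁ⁿ and v₁ⁿ⁻¹ v₂ in F_x. If both
vanished, (1, 0) would be a multiple zero. -/
lemma Vec.pfaffDeriv_ne_zero (hn : n = 2 ∨ n = 3) {x : Vec Q L n} (hx : x.disc ≠ 0)
    (h : pfaff Q (x 0).1 = 0) : pfaffDeriv (x 0).1 (x 1).1 ≠ 0 := by
  intro h0
  refine hx ?_
  rw [Vec.disc]
  rcases hn with rfl | rfl
  · rw [Vec.form_eq_quadForm, binaryDisc_quadForm, h, h0]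
    ring
  · rw [Vec.form_eq_cubicForm, binaryDisc_cubicForm, h, h0]
    ring

/-- The product of x 0 with its adjugate is Pfaff(x 0) = 0, so the columns of the adjugate lie in
the kernel. The adjugate is non-zero because the zero (1, 0) of F_x is simple, and being Hermitian
it has a unimodular combination of columns. -/
lemma Vec.exists_mulVec_eq_zero (hn : n = 2 ∨ n = 3) {x : Vec Q L n} (hx : x.disc ≠ 0)
    (h : pfaff Q (x 0).1 = 0) :
    ∃ u r : Fin n → Quat Q L, (x 0).1.mulVec u = 0 ∧ dotProduct r u = 1 := by
  have h0 : hermAdj (x 0).1 ≠ 0 := fun h0 =>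
    Vec.pfaffDeriv_ne_zero hn hx h (pfaffDeriv_eq_zero (x 0).2 h0)
  obtain ⟨r, v, hrv⟩ := Herm.exists_dotProduct_mulVec (hermAdj_mem hn (x 0).2) h0
  refine ⟨(hermAdj (x 0).1).mulVec v, r, ?_, hrv⟩
  rw [Matrix.mulVec_mulVec, mul_hermAdj hn (x 0).2, h, zero_smul, Matrix.zero_mulVec]

/-- The element `(1, h)` of `G`. -/
def Grp.ofGL {R : Type*} [CommRing R] [Algebra k R] (h : GL (Fin 2) R) : Grp Q R n :=
  ((1, h) : (Matrix (Fin n) (Fin n) (Quat Q R))ˣ × GL (Fin 2) R)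

/-- The element `(g, 1)` of `G`. -/
def Grp.ofUnits {R : Type*} [CommRing R] [Algebra k R] (g : (Matrix (Fin n) (Fin n) (Quat Q R))ˣ) :
    Grp Q R n :=
  ((g, 1) : (Matrix (Fin n) (Fin n) (Quat Q R))ˣ × GL (Fin 2) R)

lemma Grp.ofGL_smul (h : GL (Fin 2) L) (x : Vec Q L n) (i : Fin 2) :
    ((Grp.ofGL (Q := Q) (n := n) h • x) i).1 = h.1 i 0 • (x 0).1 + h.1 i 1 • (x 1).1 := by
  rw [Grp.smul_apply]
  simp [Grp.ofGL, Fin.sum_univ_two]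

lemma Grp.ofUnits_smul (g : (Matrix (Fin n) (Fin n) (Quat Q L))ˣ) (x : Vec Q L n) (i : Fin 2) :
    ((Grp.ofUnits g • x) i).1 = g.1 * (x i).1 * g.1.conjTranspose := by
  rw [Grp.smul_apply]
  fin_cases i <;> simp [Grp.ofUnits, Matrix.one_apply]

/-- An element of GL₂ with first row (a, b) reduces an arbitrary zero (a, b) of F_x to the zero (1,
0); the row (c, d) only completes the matrix. -/
lemma Vec.exists_mulVec_eq_zero' (hn : n = 2 ∨ n = 3) (t : L)
    (ht : t ^ 2 = algebraMap k L Q.b * t + algebraMap k L Q.a) {x : Vec Q L n} (hx : x.disc ≠ 0)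
    (a b c d : L) (hd : a * d - b * c ≠ 0) (h : pfaff Q (a • (x 0).1 + b • (x 1).1) = 0) :
    ∃ u r : Fin n → Quat Q L, a • (x 0).1.mulVec u + b • (x 1).1.mulVec u = 0 ∧
      dotProduct r u = 1 := by
  let g := Matrix.GeneralLinearGroup.mkOfDetNeZero !![a, b; c, d] (by rwa [Matrix.det_fin_two_of])
  have e : ((Grp.ofGL g • x) 0).1 = a • (x 0).1 + b • (x 1).1 := Grp.ofGL_smul g x 0
  obtain ⟨u, r, h1, h2⟩ := Vec.exists_mulVec_eq_zero hn (disc_smul_ne_zero hn t ht (Grp.ofGL g) hx)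
    (by rwa [e])
  rw [e, Matrix.add_mulVec, Matrix.smul_mulVec, Matrix.smul_mulVec] at h1
  exact ⟨u, r, h1, h2⟩

/-- Left multiplication by U is an injective endomorphism of a finite-dimensional L-space, hence
surjective. The right inverse C is two-sided because U (C U - 1) = 0. -/
lemma isUnit_of_mulVec_eq_zero {U : Matrix (Fin n) (Fin n) (Quat Q L)}
    (h : ∀ v, U.mulVec v = 0 → v = 0) : IsUnit U := by
  have hinj (C : Matrix (Fin n) (Fin n) (Quat Q L)) (hC : U * C = 0) : C = 0 := by
    ext1 i j
    have := h (C.col j) (by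
      ext1 a
      exact congrFun (congrFun hC a) j)
    exact congrFun this i
  have hi : Function.Injective (LinearMap.mulLeft L U) := by
    rw [injective_iff_map_eq_zero]
    exact hinj
  obtain ⟨C, hC⟩ := LinearMap.injective_iff_surjective.1 hi 1
  have hC' : U * C = 1 := hC
  refine ⟨⟨U, C, hC', ?_⟩, rfl⟩
  refine sub_eq_zero.1 (hinj _ ?_)
  rw [mul_sub, ← mul_assoc, hC', one_mul, mul_one, sub_self]

end Kernel

/-! ### Transitivity on the semistable locus over a separably closed field -/

section Transitivity

variable {k : Type*} [Field k] {Q : QuaternionData k} {n : ℕ}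

/-- The diagonal Hermitian matrix with the given entries. -/
def diagHerm {R : Type*} [CommRing R] [Algebra k R] (s : Fin n → R) : Herm Q R n :=
  ⟨Matrix.diagonal fun i => Quat.scal (s i), by
    refine ⟨?_, fun i => ?_⟩
    · rw [Matrix.diagonal_conjTranspose]
      congr 1
      ext i <;> simp [Quat.scal]
    · simp [Quat.IsScalar, Quat.scal]⟩

/-- The pair of diagonal Hermitian matrices with the given entries. -/
def diagVec {R : Type*} [CommRing R] [Algebra k R] (s : Fin 2 → Fin n → R) : Vec Q R n :=
  fun i => diagHerm (s i)

variable (Q n) in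
/-- The point `(diag(1, 0), diag(0, 1))` for `n = 2` and `(diag(1, 0, 1), diag(0, 1, -1))` for
`n = 3`. (It is not used for other `n`.) -/
def stdVec (R : Type*) [CommRing R] [Algebra k R] : Vec Q R n :=
  match n with
  | 2 => diagVec ![![1, 0], ![0, 1]]
  | 3 => diagVec ![![1, 0, 1], ![0, 1, -1]]
  | _ => diagVec 0

lemma diagHerm_apply_self {R : Type*} [CommRing R] [Algebra k R] (s : Fin n → R) (i : Fin n) :
    (diagHerm (Q := Q) s).1 i i = Quat.scal (s i) := Matrix.diagonal_apply_eq _ _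

lemma diagHerm_apply_ne {R : Type*} [CommRing R] [Algebra k R] (s : Fin n → R) {i j : Fin n}
    (h : i ≠ j) : (diagHerm (Q := Q) s).1 i j = 0 := Matrix.diagonal_apply_ne _ h

lemma diagVec_form_two {R : Type*} [CommRing R] [Algebra k R] (s : Fin 2 → Fin 2 → R) :
    (diagVec (Q := Q) s).form =
      quadForm (s 0 0 * s 0 1) (s 0 0 * s 1 1 + s 1 0 * s 0 1) (s 1 0 * s 1 1) := by
  rw [Vec.form_eq_quadForm]
  simp only [diagVec, pfaff, pfaffDeriv, diagHerm_apply_self,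
    diagHerm_apply_ne _ (by decide : (0 : Fin 2) ≠ 1)]
  simp only [Quat.scal, Quat.trd, Quat.nrd, star_zero, mul_zero, add_zero,
    QuaternionAlgebra.re_zero, sub_zero]
  congr 1
  ring

lemma diagVec_form_three {R : Type*} [CommRing R] [Algebra k R] (s : Fin 2 → Fin 3 → R) :
    (diagVec (Q := Q) s).form =
      cubicForm (s 0 0 * s 0 1 * s 0 2)
        (s 1 0 * s 0 1 * s 0 2 + s 0 0 * s 1 1 * s 0 2 + s 0 0 * s 0 1 * s 1 2)
        (s 0 0 * s 1 1 * s 1 2 + s 1 0 * s 0 1 * s 1 2 + s 1 0 * s 1 1 * s 0 2)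
        (s 1 0 * s 1 1 * s 1 2) := by
  rw [Vec.form_eq_cubicForm]
  simp only [diagVec, pfaff, pfaffDeriv, diagHerm_apply_self,
    diagHerm_apply_ne _ (by decide : (0 : Fin 3) ≠ 1),
    diagHerm_apply_ne _ (by decide : (1 : Fin 3) ≠ 2),
    diagHerm_apply_ne _ (by decide : (2 : Fin 3) ≠ 0)]
  simp only [Quat.scal, Quat.trd, Quat.nrd, star_zero, mul_zero, add_zero,
    QuaternionAlgebra.re_zero, sub_zero]
  congr 1 <;> ring

open MvPolynomial in
lemma stdVec_form_two {R : Type*} [CommRing R] [Algebra k R] :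
    (stdVec Q 2 R).form = X 0 * X 1 := by
  rw [stdVec, diagVec_form_two]
  simp [quadForm]

open MvPolynomial in
lemma stdVec_form_three {R : Type*} [CommRing R] [Algebra k R] :
    (stdVec Q 3 R).form = X 0 * X 1 * (X 0 - X 1) := by
  rw [stdVec, diagVec_form_three]
  simp [cubicForm]
  ring

lemma stdVec_disc_ne_zero (hn : n = 2 ∨ n = 3) {R : Type*} [CommRing R] [Nontrivial R]
    [Algebra k R] : (stdVec Q n R).disc ≠ 0 := by
  rw [Vec.disc]
  rcases hn with rfl | rfl
  · rw [stdVec, diagVec_form_two, binaryDisc_quadForm]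
    simp
  · rw [stdVec, diagVec_form_three, binaryDisc_cubicForm]
    simp

variable {L : Type*} [Field L] [Algebra k L]

/-- A pair of diagonal matrices whose entries are multiples of those of `stdVec` by non-zero
scalars is in the orbit of `stdVec`. -/
lemma exists_smul_eq_of_diagonal (t : L)
    (ht : t ^ 2 = algebraMap k L Q.b * t + algebraMap k L Q.a) (m : Fin n → L)
    (hm : ∀ i, m i ≠ 0) (s : Fin 2 → Fin n → L) :
    ∃ g : Grp Q L n, g • diagVec (Q := Q) s = diagVec fun i j => m j * s i j := by
  -- As B ⊗ L is split by t, every m j is a reduced norm. Acting by the diagonal matrix of the d j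
  -- multiplies the j-th diagonal entries by d j (d j)* = m j.
  choose d hd using fun j => Quat.exists_nrd_eq (Q := Q) t ht (m j)
  have h1 (q : Quat Q L) : q * star q = Quat.scal q.nrd := by
    ext <;> simp [Quat.scal, Quat.nrd] <;> ring
  have h2 (q : Quat Q L) : star q * q = Quat.scal q.nrd := by
    ext <;> simp [Quat.scal, Quat.nrd] <;> ring
  have h3 (j) : (m j)⁻¹ • (Quat.scal (m j) : Quat Q L) = 1 := by
    ext <;> simp [Quat.scal, hm]
  let u : (Matrix (Fin n) (Fin n) (Quat Q L))ˣ :=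
    { val := Matrix.diagonal d
      inv := Matrix.diagonal fun j => (m j)⁻¹ • star (d j)
      val_inv := by
        rw [Matrix.diagonal_mul_diagonal]
        simp only [mul_smul_comm, h1, hd, h3]
        exact Matrix.diagonal_one
      inv_val := by
        rw [Matrix.diagonal_mul_diagonal]
        simp only [smul_mul_assoc, h2, hd, h3]
        exact Matrix.diagonal_one }
  refine ⟨Grp.ofUnits u, funext fun i => Subtype.ext ?_⟩
  rw [Grp.ofUnits_smul]
  change Matrix.diagonal d * Matrix.diagonal _ * (Matrix.diagonal d).conjTranspose =
    Matrix.diagonal _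
  rw [Matrix.diagonal_conjTranspose, Matrix.diagonal_mul_diagonal, Matrix.diagonal_mul_diagonal]
  congr 1
  funext j
  have h4 : (Quat.scal (m j * s i j) : Quat Q L) = s i j • (d j * star (d j)) := by
    rw [h1, hd]
    ext <;> simp [Quat.scal, mul_comm]
  have h5 : (Quat.scal (s i j) : Quat Q L) = s i j • 1 := by
    ext <;> simp [Quat.scal]
  rw [h4, h5, mul_smul_comm, mul_one, smul_mul_assoc, Pi.star_apply]

/-- Unimodularity replaces the missing division: u c = 0 forces c = (r u) c = 0. -/
lemma op_smul_eq_zero {u r : Fin n → Quat Q L} (h : dotProduct r u = 1) {c : Quat Q L}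
    (hc : MulOpposite.op c • u = 0) : c = 0 := by
  have : dotProduct r u * c = 0 := by
    rw [dotProduct, Finset.sum_mul]
    refine Finset.sum_eq_zero fun i _ => ?_
    have := congrFun hc i
    rw [mul_assoc, show u i * c = 0 from this, mul_zero]
  rwa [h, one_mul] at this

/-- If `y` kills the `j`-th column of `U`, then the `j`-th row and column of `Uᴴ * y * U` are zero. -/
lemma conj_apply_eq_zero {y U : Matrix (Fin n) (Fin n) (Quat Q L)} (hy : y ∈ Herm Q L n)
    {j : Fin n} (h : y.mulVec (U.col j) = 0) (i : Fin n) :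
    (U.conjTranspose * y * U) i j = 0 ∧ (U.conjTranspose * y * U) j i = 0 := by
  have h1 : (U.conjTranspose * y * U) i j = 0 := by
    have : (U.conjTranspose * y * U) i j = (U.conjTranspose.mulVec (y.mulVec (U.col j))) i := by
      rw [Matrix.mulVec_mulVec]
      rfl
    rw [this, h, Matrix.mulVec_zero]
    rfl
  refine ⟨h1, ?_⟩
  have h2 : U.conjTranspose * y * U ∈ Herm Q L n := by
    have := herm_conj Q n U.conjTranspose y hy
    rwa [Matrix.conjTranspose_conjTranspose] at this
  rw [← Herm.star_apply h2, h1, star_zero]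

/-- The element `star U` acts by passing to the basis formed by the columns of U, which is the shape
needed for `conj_apply_eq_zero`. -/
lemma smul_smul_unit_conj (U : (Matrix (Fin n) (Fin n) (Quat Q L))ˣ) (x : Vec Q L n) (i : Fin 2) :
    ((Grp.ofUnits (star U) • x) i).1 = U.1.conjTranspose * (x i).1 * U.1 := by
  rw [Grp.ofUnits_smul]
  congr 1
  exact Matrix.conjTranspose_conjTranspose _

/-- The kernel vectors u1 of x 0 and u0 of x 1 form a basis, in which x 0 becomes diag(*, 0) and x 1
becomes diag(0, *). Rescaling the basis by quaternions of suitable norm gives the standard pair. -/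
lemma exists_smul_eq_stdVec_two (t : L)
    (ht : t ^ 2 = algebraMap k L Q.b * t + algebraMap k L Q.a) {x : Vec Q L 2} (hx : x.disc ≠ 0)
    (h0 : pfaff Q (x 0).1 = 0) (h1 : pfaff Q (x 1).1 = 0) :
    ∃ g : Grp Q L 2, g • stdVec Q 2 L = x := by
  have hn : 2 = 2 ∨ 2 = 3 := .inl rfl
  obtain ⟨u1, r1, hu1, hr1⟩ := Vec.exists_mulVec_eq_zero' hn t ht hx 1 0 0 1 (by simp) (by simpa)
  obtain ⟨u0, r0, hu0, hr0⟩ := Vec.exists_mulVec_eq_zero' hn t ht hx 0 1 1 0 (by simp) (by simpa)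
  simp only [one_smul, zero_smul, add_zero, zero_add] at hu0 hu1
  -- As (1, 0) and (0, 1) are the zeros of F_x, its value at (1, 1) is the middle coefficient.
  have hp : pfaff Q ((x 0).1 + (x 1).1) ≠ 0 := by
    have := pfaff_smul_add_smul_two (Q := Q) (y := (x 0).1) (z := (x 1).1) 1 1
    simp only [one_smul, h0, h1] at this
    rw [this]
    simpa using Vec.pfaffDeriv_ne_zero hn hx h0
  let M : Matrix (Fin 2) (Fin 2) (Quat Q L) := Matrix.of fun i j => ![u0, u1] j i
  have hM : IsUnit M := by
    -- In a relation u0 c₀ + u1 c₁ = 0, the term u0 c₀ is killed by x 1, and also by x 0 because x 0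
    -- kills the other term. So it is killed by the non-singular matrix x 0 + x 1.
    refine isUnit_of_mulVec_eq_zero fun v hv => ?_
    set w0 := MulOpposite.op (v 0) • u0 with hw0
    set w1 := MulOpposite.op (v 1) • u1 with hw1
    have hs : w0 + w1 = 0 := by
      rw [← hv]
      ext1 i
      simp [M, Matrix.mulVec, dotProduct, Fin.sum_univ_two, hw0, hw1]
    have e0 : (x 1).1.mulVec w0 = 0 := by rw [hw0, Matrix.mulVec_smul, hu0, smul_zero]
    have e1 : (x 0).1.mulVec w1 = 0 := by rw [hw1, Matrix.mulVec_smul, hu1, smul_zero]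
    have e2 : (x 0).1.mulVec w0 = 0 := by
      have := congrArg (x 0).1.mulVec hs
      rwa [Matrix.mulVec_add, e1, add_zero, Matrix.mulVec_zero] at this
    have f0 : w0 = 0 := by
      refine Herm.eq_zero_of_mulVec_eq_zero hn (add_mem (x 0).2 (x 1).2) hp ?_
      rw [Matrix.add_mulVec, e0, e2, add_zero]
    have f1 : w1 = 0 := by rwa [f0, zero_add] at hs
    ext1 i
    fin_cases i
    · exact op_smul_eq_zero hr0 f0
    · exact op_smul_eq_zero hr1 f1
  obtain ⟨U, hU⟩ := hM
  have c0 : U.1.col 0 = u0 := by rw [hU]; rfl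
  have c1 : U.1.col 1 = u1 := by rw [hU]; rfl
  set z := Grp.ofUnits (star U) • x with hz
  have hzd : z.disc ≠ 0 := disc_smul_ne_zero hn t ht _ hx
  have z0 := fun i => conj_apply_eq_zero (x 0).2 (j := 1) (U := U.1) (by rw [c1, hu1]) i
  have z1 := fun i => conj_apply_eq_zero (x 1).2 (j := 0) (U := U.1) (by rw [c0, hu0]) i
  rw [← smul_smul_unit_conj, ← hz] at z0 z1
  let m : Fin 2 → L := ![((z 0).1 0 0).re, ((z 1).1 1 1).re]
  -- Both matrices are diagonal by now, and the discriminant is the square of m 0 * m 1.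
  have hm : ∀ i, m i ≠ 0 := by
    rw [Vec.disc, Vec.form_eq_quadForm, binaryDisc_quadForm] at hzd
    simp [pfaff, pfaffDeriv, z0, z1, Quat.nrd, Quat.trd] at hzd
    intro i
    fin_cases i
    · exact fun h => hzd.1 h
    · exact fun h => hzd.2 h
  obtain ⟨g, hg⟩ := exists_smul_eq_of_diagonal t ht m hm ![![1, 0], ![0, 1]]
  have e : g • stdVec Q 2 L = z := by
    refine hg.trans (funext fun i => Subtype.ext ?_)
    ext1 a b
    fin_cases i <;> fin_cases a <;> fin_cases b <;>
      simp [z0, z1, m, diagVec, diagHerm, ← ((z 0).2.2 0).eq_scal, ← ((z 1).2.2 1).eq_scal] <;> rfl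
  exact ⟨(Grp.ofUnits (star U))⁻¹ * g, by rw [mul_smul, e, hz, inv_smul_smul]⟩


/-- A finite field is perfect, so if it were separably closed it would be algebraically closed,
hence infinite. -/
lemma exists_ne_zero_ne_one (L : Type*) [Field L] [IsSepClosed L] : ∃ s : L, s ≠ 0 ∧ s ≠ 1 := by
  have : Infinite L := by
    by_contra h
    have : Finite L := not_infinite_iff_finite.1 h
    exact h IsAlgClosed.instInfinite
  classical
  obtain ⟨s, hs⟩ := Infinite.exists_notMem_finset ({0, 1} : Finset L)
  exact ⟨s, by simpa using hs⟩

/-- The kernel vectors u1, u0, u2 of x 0, x 1 and x 0 + x 1 form a basis in which the pair is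
diag(m₀, 0, m₂), diag(0, m₁, -m₂). A fourth, non-singular member s x 0 + x 1 of the pencil serves to
prove independence, so s must avoid the zeros 0 and 1. -/
lemma exists_smul_eq_stdVec_three [IsSepClosed L] (t : L)
    (ht : t ^ 2 = algebraMap k L Q.b * t + algebraMap k L Q.a) {x : Vec Q L 3} (hx : x.disc ≠ 0)
    (h0 : pfaff Q (x 0).1 = 0) (h1 : pfaff Q (x 1).1 = 0)
    (h2 : pfaff Q ((x 0).1 + (x 1).1) = 0) :
    ∃ g : Grp Q L 3, g • stdVec Q 3 L = x := by
  have hn : 3 = 2 ∨ 3 = 3 := .inr rfl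
  obtain ⟨u1, r1, hu1, hr1⟩ := Vec.exists_mulVec_eq_zero' hn t ht hx 1 0 0 1 (by simp) (by simpa)
  obtain ⟨u0, r0, hu0, hr0⟩ := Vec.exists_mulVec_eq_zero' hn t ht hx 0 1 1 0 (by simp) (by simpa)
  obtain ⟨u2, r2, hu2, hr2⟩ := Vec.exists_mulVec_eq_zero' hn t ht hx 1 1 0 1 (by simp) (by simpa)
  simp only [one_smul, zero_smul, add_zero, zero_add] at hu0 hu1 hu2
  obtain ⟨s, hs0, hs1⟩ := exists_ne_zero_ne_one L
  have hp : pfaff Q (s • (x 0).1 + (1 : L) • (x 1).1) ≠ 0 := by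
    have e1 := pfaff_smul_add_smul_three (x 0).2 (x 1).2 1 1
    rw [one_smul, one_smul, h2, h0, h1] at e1
    have e2 := pfaff_smul_add_smul_three (x 0).2 (x 1).2 s 1
    -- The vanishing at (1, 1) makes the two middle coefficients opposite, so F_x(s, 1) is s² - s
    -- times one of them.
    have e3 : pfaff Q (s • (x 0).1 + (1 : L) • (x 1).1) =
        s * (s - 1) * pfaffDeriv (x 0).1 (x 1).1 := by
      rw [e2, h0, h1]
      linear_combination (-s) * e1
    rw [e3]
    exact mul_ne_zero (mul_ne_zero hs0 (sub_ne_zero.2 hs1)) (Vec.pfaffDeriv_ne_zero hn hx h0)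
  have inj {v : Fin 3 → Quat Q L} (hv : s • (x 0).1.mulVec v + (x 1).1.mulVec v = 0) : v = 0 := by
    refine Herm.eq_zero_of_mulVec_eq_zero hn
      (add_mem (Submodule.smul_mem _ s (x 0).2) (Submodule.smul_mem _ 1 (x 1).2)) hp ?_
    rw [Matrix.add_mulVec, Matrix.smul_mulVec, Matrix.smul_mulVec, one_smul, hv]
  let M : Matrix (Fin 3) (Fin 3) (Quat Q L) := Matrix.of fun i j => ![u0, u1, u2] j i
  have hM : IsUnit M := by
    refine isUnit_of_mulVec_eq_zero fun v hv => ?_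
    set w0 := MulOpposite.op (v 0) • u0 with hw0
    set w1 := MulOpposite.op (v 1) • u1 with hw1
    set w2 := MulOpposite.op (v 2) • u2 with hw2
    have hs : w0 + w1 + w2 = 0 := by
      rw [← hv]
      ext1 i
      simp [M, Matrix.mulVec, dotProduct, Fin.sum_univ_three, hw0, hw1, hw2]
    have e0 : (x 1).1.mulVec w0 = 0 := by rw [hw0, Matrix.mulVec_smul, hu0, smul_zero]
    have e1 : (x 0).1.mulVec w1 = 0 := by rw [hw1, Matrix.mulVec_smul, hu1, smul_zero]
    have e2 : (x 0).1.mulVec w2 + (x 1).1.mulVec w2 = 0 := by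
      rw [hw2, Matrix.mulVec_smul, Matrix.mulVec_smul, ← smul_add, hu2, smul_zero]
    have e3 : (x 0).1.mulVec w0 + (x 0).1.mulVec w2 = 0 := by
      have := congrArg (x 0).1.mulVec hs
      rwa [Matrix.mulVec_add, Matrix.mulVec_add, e1, add_zero, Matrix.mulVec_zero] at this
    -- The combination is chosen to lie in the kernel of s x 0 + x 1: since x 0 w0 = -x 0 w2, its
    -- image is s (x 0 + x 1) w2 = 0. Applying x 1 to the resulting relation then removes w0 and
    -- isolates w2.
    have f : (s - 1) • w0 + s • w2 = 0 := by
      refine inj ?_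
      simp only [Matrix.mulVec_add, Matrix.mulVec_smul, e0, eq_neg_of_add_eq_zero_left e3,
        eq_neg_of_add_eq_zero_right e2]
      module
    have f1 : (x 1).1.mulVec w2 = 0 := by
      have := congrArg (x 1).1.mulVec f
      rw [Matrix.mulVec_add, Matrix.mulVec_smul _ _ w0, Matrix.mulVec_smul _ _ w2, e0, smul_zero,
        zero_add, Matrix.mulVec_zero] at this
      exact (smul_eq_zero.1 this).resolve_left hs0
    have g2 : w2 = 0 := inj (by
      rw [f1, add_zero] at e2 ⊢
      rw [e2, smul_zero])
    have g0 : w0 = 0 := by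
      rw [g2, smul_zero, add_zero] at f
      exact (smul_eq_zero.1 f).resolve_left (sub_ne_zero.2 hs1)
    have g1 : w1 = 0 := by rwa [g0, g2, zero_add, add_zero] at hs
    ext1 i
    fin_cases i
    · exact op_smul_eq_zero hr0 g0
    · exact op_smul_eq_zero hr1 g1
    · exact op_smul_eq_zero hr2 g2
  obtain ⟨U, hU⟩ := hM
  have c0 : U.1.col 0 = u0 := by rw [hU]; rfl
  have c1 : U.1.col 1 = u1 := by rw [hU]; rfl
  have c2 : U.1.col 2 = u2 := by rw [hU]; rfl
  set z := Grp.ofUnits (star U) • x with hz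
  have hzd : z.disc ≠ 0 := disc_smul_ne_zero hn t ht _ hx
  have z0 := fun i => conj_apply_eq_zero (x 0).2 (j := 1) (U := U.1) (by rw [c1, hu1]) i
  have z1 := fun i => conj_apply_eq_zero (x 1).2 (j := 0) (U := U.1) (by rw [c0, hu0]) i
  have z2 := fun i => conj_apply_eq_zero (add_mem (x 0).2 (x 1).2) (j := 2) (U := U.1)
    (by rw [c2, Matrix.add_mulVec, hu2]) i
  rw [← smul_smul_unit_conj, ← hz] at z0 z1
  simp only [mul_add, add_mul, ← smul_smul_unit_conj, ← hz, Matrix.add_apply] at z2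
  -- Row and column 2 of z 0 + z 1 vanish, while row and column 0 of z 1 and row and column 1 of z 0
  -- are already zero. So the remaining off-diagonal entries vanish as well.
  have z3 : (z 0).1 0 2 = 0 := by simpa [z1] using (z2 0).1
  have z4 : (z 0).1 2 0 = 0 := by simpa [z1] using (z2 0).2
  have z5 : (z 1).1 1 2 = 0 := by simpa [z0] using (z2 1).1
  have z6 : (z 1).1 2 1 = 0 := by simpa [z0] using (z2 1).2
  have z7 : (z 1).1 2 2 = -(z 0).1 2 2 := eq_neg_of_add_eq_zero_right (z2 2).1
  let m : Fin 3 → L := ![((z 0).1 0 0).re, ((z 1).1 1 1).re, ((z 0).1 2 2).re]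
  have e' : z = diagVec fun i j => m j *
      (![![1, 0, 1], ![0, 1, -1]] : Fin 2 → Fin 3 → L) i j := by
    refine funext fun i => Subtype.ext ?_
    have neg_scal (a : L) : (Quat.scal (-a) : Quat Q L) = - Quat.scal a := by
      ext <;> simp [Quat.scal]
    ext1 a b
    fin_cases i <;> fin_cases a <;> fin_cases b <;>
      simp [z0, z1, z3, z4, z5, z6, z7, m, diagVec, diagHerm, neg_scal,
        ← ((z 0).2.2 0).eq_scal, ← ((z 1).2.2 1).eq_scal, ← ((z 0).2.2 2).eq_scal] <;> rfl
  -- If some m i were zero, the resulting binary form would be zero.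
  have hm : ∀ i, m i ≠ 0 := by
    rw [e', Vec.disc, diagVec_form_three, binaryDisc_cubicForm] at hzd
    intro i h
    refine hzd ?_
    fin_cases i <;> simp at h <;> simp [h]
  obtain ⟨g, hg⟩ := exists_smul_eq_of_diagonal t ht m hm ![![1, 0, 1], ![0, 1, -1]]
  have e : g • stdVec Q 3 L = z := hg.trans e'.symm
  exact ⟨(Grp.ofUnits (star U))⁻¹ * g, by rw [mul_smul, e, hz, inv_smul_smul]⟩

lemma exists_ofGL_smul_eq {p q : Fin 2 → L} (h : p 0 * q 1 - p 1 * q 0 ≠ 0) (x : Vec Q L n) :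
    ∃ g : GL (Fin 2) L, ((Grp.ofGL (Q := Q) (n := n) g • x) 0).1 = p 0 • (x 0).1 + p 1 • (x 1).1 ∧
      ((Grp.ofGL (Q := Q) (n := n) g • x) 1).1 = q 0 • (x 0).1 + q 1 • (x 1).1 :=
  ⟨Matrix.GeneralLinearGroup.mkOfDetNeZero !![p 0, p 1; q 0, q 1]
    (by rwa [Matrix.det_fin_two_of]), Grp.ofGL_smul _ x 0, Grp.ofGL_smul _ x 1⟩

/-- `G(L)` acts transitively on `V^ss(L)` if `L` is separably closed. -/
lemma exists_smul_stdVec_eq [IsSepClosed L] (hn : n = 2 ∨ n = 3) (t : L)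
    (ht : t ^ 2 = algebraMap k L Q.b * t + algebraMap k L Q.a) {x : Vec Q L n} (hx : x.disc ≠ 0) :
    ∃ g : Grp Q L n, g • stdVec Q n L = x := by
  have key (h : GL (Fin 2) L) (H : ∃ g : Grp Q L n, g • stdVec Q n L = Grp.ofGL (Q := Q) (n := n) h • x) :
      ∃ g : Grp Q L n, g • stdVec Q n L = x := by
    obtain ⟨g, hg⟩ := H
    exact ⟨(Grp.ofGL h)⁻¹ * g, by rw [mul_smul, hg, inv_smul_smul]⟩
  rcases hn with rfl | rfl
  · have hd := hx
    rw [Vec.disc, Vec.form_eq_quadForm, binaryDisc_quadForm] at hd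
    obtain ⟨p, q, h, hp, hq⟩ := exists_zeros_quad _ _ _ hd
    obtain ⟨g, g0, g1⟩ := exists_ofGL_smul_eq h x
    refine key g ?_
    refine exists_smul_eq_stdVec_two t ht (disc_smul_ne_zero (.inl rfl) t ht _ hx) ?_ ?_
    · rw [g0]
      refine (pfaff_smul_add_smul_two _ _).trans ?_
      linear_combination hp
    · rw [g1]
      refine (pfaff_smul_add_smul_two _ _).trans ?_
      linear_combination hq
  · have hd := hx
    rw [Vec.disc, Vec.form_eq_cubicForm, binaryDisc_cubicForm] at hd
    obtain ⟨p, q, h, hp, hq, hpq⟩ := exists_zeros_cubic _ _ _ _ hd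
    obtain ⟨g, g0, g1⟩ := exists_ofGL_smul_eq h x
    refine key g ?_
    refine exists_smul_eq_stdVec_three t ht (disc_smul_ne_zero (.inr rfl) t ht _ hx) ?_ ?_ ?_
    · rw [g0]
      refine (pfaff_smul_add_smul_three (x 0).2 (x 1).2 _ _).trans ?_
      linear_combination hp
    · rw [g1]
      refine (pfaff_smul_add_smul_three (x 0).2 (x 1).2 _ _).trans ?_
      linear_combination hq
    · rw [g0, g1]
      have e (a b c d : L) (y z : Matrix (Fin 3) (Fin 3) (Quat Q L)) :
          a • y + b • z + (c • y + d • z) = (a + c) • y + (b + d) • z := by module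
      rw [e]
      refine (pfaff_smul_add_smul_three (x 0).2 (x 1).2 _ _).trans ?_
      linear_combination hpq

end Transitivity

/-! ### Projective schemes of binary forms; the standard form is finite and discrete -/

section FormVariety

open MvPolynomial AlgebraicGeometry CategoryTheory CategoryTheory.Limits

variable {k : Type u} [Field k] {n : ℕ}

lemma algebraMap_coordGrading_zero_surjective (F : BinaryForm k n) :
    Function.Surjective (algebraMap k (coordGrading F 0)) := by
  rintro ⟨_, p, hp, rfl⟩
  have e : p = C (p.coeff 0) := (totalDegree_eq_zero_iff_eq_C).1
    ((totalDegree_zero_iff_isHomogeneous _).2 hp)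
  exact ⟨p.coeff 0, Subtype.ext (congrArg (Ideal.Quotient.mk (Ideal.span {F.1})) e.symm)⟩

/-- The Proj of the coordinate ring is separated and of finite type over the spectrum of its
degree-zero part. That part is a quotient of k, so its spectrum is closed in Spec k. -/
lemma isVar_formVar (F : BinaryForm k n) : IsVar k (formVar F) := by
  have hs := algebraMap_coordGrading_zero_surjective F
  have : Algebra.FiniteType k (CoordRing F) := inferInstance
  have : Algebra.FiniteType (coordGrading F 0) (CoordRing F) := by
    have h : ((algebraMap (coordGrading F 0) (CoordRing F)).comp
        (algebraMap k (coordGrading F 0))).FiniteType :=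
      RingHom.finiteType_algebraMap.2 this
    exact RingHom.finiteType_algebraMap.1 (RingHom.FiniteType.of_comp_finiteType h)
  have : IsClosedImmersion (Spec.map (CommRingCat.ofHom (algebraMap k (coordGrading F 0)))) :=
    IsClosedImmersion.spec_of_surjective _ hs
  have e : (formVar F).hom = Proj.toSpecZero (coordGrading F) ≫
    Spec.map (CommRingCat.ofHom (algebraMap k (coordGrading F 0))) := rfl
  refine ⟨?_, ?_, ?_⟩
  · rw [e]; infer_instance
  · rw [e]; infer_instance
  · rw [e]; infer_instance

/-- Meant for φ the reduction at a point of Proj: there the coordinates are proportional to a, and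
each monomial of degree d acquires the factor mᵈ. -/
lemma ringHom_apply_of_isHomogeneous {D : Type*} [CommRing D]
    (φ : MvPolynomial (Fin 2) k →+* D) (a : Fin 2 → k) (m : D) (h : ∀ i, φ (X i) = φ (C (a i)) * m)
    {d : ℕ} {f : MvPolynomial (Fin 2) k} (hf : f.IsHomogeneous d) :
    φ f = φ (C (eval a f)) * m ^ d := by
  conv_lhs => rw [f.as_sum]
  rw [eval_eq', map_sum, map_sum, map_sum, Finset.sum_mul]
  refine Finset.sum_congr rfl fun e he => ?_
  have hd : d = e 0 + e 1 := by
    have h1 := hf (mem_support_iff.1 he)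
    rw [Finsupp.weight_apply, Finsupp.sum_fintype _ _ (by simp)] at h1
    simpa [Fin.sum_univ_two] using h1.symm
  rw [monomial_eq, Finsupp.prod_fintype _ _ (by simp)]
  simp only [Fin.prod_univ_two, map_mul, map_pow, h]
  rw [hd]
  ring

/-- A point of `Proj k[v₁, v₂] / (F)` on which the linear form `a₁ v₁ - a₀ v₂` vanishes consists of
the forms vanishing at `a`. -/
lemma mem_asHomogeneousIdeal_iff {F : BinaryForm k n} (p : ProjectiveSpectrum (coordGrading F))
    (a : Fin 2 → k) (ha : a ≠ 0)
    (h : Ideal.Quotient.mk (Ideal.span {F.1}) (C (a 1) * X 0 - C (a 0) * X 1) ∈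
      p.asHomogeneousIdeal)
    {d : ℕ} {f : MvPolynomial (Fin 2) k} (hf : f.IsHomogeneous d) :
    Ideal.Quotient.mk (Ideal.span {F.1}) f ∈ p.asHomogeneousIdeal ↔ eval a f = 0 := by
  let φ : MvPolynomial (Fin 2) k →+* CoordRing F ⧸ p.asHomogeneousIdeal.toIdeal :=
    (Ideal.Quotient.mk _).comp (Ideal.Quotient.mk (Ideal.span {F.1}))
  have hφ (f) : Ideal.Quotient.mk (Ideal.span {F.1}) f ∈ p.asHomogeneousIdeal ↔ φ f = 0 :=
    Ideal.Quotient.eq_zero_iff_mem.symm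
  rw [hφ, map_sub, map_mul, map_mul, sub_eq_zero] at h
  have hC {c : k} (hc : c ≠ 0) : φ (C c⁻¹) * φ (C c) = 1 := by
    rw [← map_mul, ← map_mul, inv_mul_cancel₀ hc, map_one, map_one]
  -- In the quotient by the prime the hypothesis reads a₁ X₀ = a₀ X₁, so the coordinates are a times
  -- a common factor, found by dividing by a non-zero a i.
  obtain ⟨m, hm⟩ : ∃ m, ∀ i, φ (X i) = φ (C (a i)) * m := by
    by_cases h0 : a 0 = 0
    · have h1 : a 1 ≠ 0 := fun h1 => ha (funext fun i => by fin_cases i <;> assumption)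
      refine ⟨φ (C (a 1)⁻¹) * φ (X 1), fun i => ?_⟩
      fin_cases i
      · change φ (X 0) = φ (C (a 0)) * (φ (C (a 1)⁻¹) * φ (X 1))
        linear_combination φ (C (a 1)⁻¹) * h - φ (X 0) * hC h1
      · change φ (X 1) = φ (C (a 1)) * (φ (C (a 1)⁻¹) * φ (X 1))
        linear_combination - φ (X 1) * hC h1
    · refine ⟨φ (C (a 0)⁻¹) * φ (X 0), fun i => ?_⟩
      fin_cases i
      · change φ (X 0) = φ (C (a 0)) * (φ (C (a 0)⁻¹) * φ (X 0))
        linear_combination - φ (X 0) * hC h0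
      · change φ (X 1) = φ (C (a 1)) * (φ (C (a 0)⁻¹) * φ (X 0))
        linear_combination - φ (C (a 0)⁻¹) * h - φ (X 1) * hC h0
  -- If m were zero, all forms of positive degree would lie in the prime, which does not contain the
  -- irrelevant ideal.
  have hm0 : m ≠ 0 := by
    rintro rfl
    refine p.not_irrelevant_le ((HomogeneousIdeal.irrelevant_le _).2 ?_)
    rintro d hd _ ⟨f, hf, rfl⟩
    refine (hφ f).2 ?_
    rw [ringHom_apply_of_isHomogeneous φ a 0 hm hf, zero_pow hd.ne', mul_zero]
  rw [hφ, ringHom_apply_of_isHomogeneous φ a m hm hf, mul_eq_zero]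
  refine ⟨fun h => ?_, fun h => by rw [h, map_zero, map_zero]; exact .inl rfl⟩
  by_contra hc
  have h1 := h.resolve_right (pow_ne_zero d hm0)
  have h2 := hC hc
  rw [h1, mul_zero] at h2
  exact zero_ne_one h2

variable (k) in
/-- The zeros of the form `v₁ v₂ (v₁ - v₂)`. -/
def stdZero : Fin 3 → Fin 2 → k := ![![0, 1], ![1, 0], ![1, 1]]

lemma stdZero_ne_zero (i : Fin 3) : stdZero k i ≠ 0 := by
  fin_cases i
  · exact fun h => one_ne_zero (congrFun h 1)
  · exact fun h => one_ne_zero (congrFun h 0)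
  · exact fun h => one_ne_zero (congrFun h 0)

/-- The product of the linear factors is zero in the coordinate ring, so a prime contains one of
them. For n = 2 only the indices 0 and 1 are used. -/
lemma exists_mem_asHomogeneousIdeal (hn : n = 2 ∨ n = 3)
    (p : ProjectiveSpectrum (coordGrading (stdForm k n))) :
    ∃ i : Fin 3, Ideal.Quotient.mk (Ideal.span {(stdForm k n).1})
      (C (stdZero k i 1) * X 0 - C (stdZero k i 0) * X 1) ∈ p.asHomogeneousIdeal := by
  have h0 : Ideal.Quotient.mk (Ideal.span {(stdForm k n).1}) (stdForm k n).1 ∈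
      p.asHomogeneousIdeal := by
    rw [Ideal.Quotient.eq_zero_iff_mem.2 (Ideal.mem_span_singleton_self _)]
    exact zero_mem _
  have hp {x y} : x * y ∈ p.asHomogeneousIdeal → x ∈ p.asHomogeneousIdeal ∨
    y ∈ p.asHomogeneousIdeal := p.isPrime.mem_or_mem
  have e1 : (C 0 * X 0 - C 1 * X 1 : MvPolynomial (Fin 2) k) = - X 1 := by simp
  have e0 : (C 1 * X 0 - C 0 * X 1 : MvPolynomial (Fin 2) k) = X 0 := by simp
  have e2 : (C 1 * X 0 - C 1 * X 1 : MvPolynomial (Fin 2) k) = X 0 - X 1 := by simp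
  have c0 (h : Ideal.Quotient.mk (Ideal.span {(stdForm k n).1}) (X 0) ∈ p.asHomogeneousIdeal) :
      ∃ i : Fin 3, Ideal.Quotient.mk (Ideal.span {(stdForm k n).1})
        (C (stdZero k i 1) * X 0 - C (stdZero k i 0) * X 1) ∈ p.asHomogeneousIdeal :=
    ⟨0, by
      change Ideal.Quotient.mk (Ideal.span {(stdForm k n).1}) (C 1 * X 0 - C 0 * X 1) ∈ _
      rwa [e0]⟩
  have c1 (h : Ideal.Quotient.mk (Ideal.span {(stdForm k n).1}) (X 1) ∈ p.asHomogeneousIdeal) :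
      ∃ i : Fin 3, Ideal.Quotient.mk (Ideal.span {(stdForm k n).1})
        (C (stdZero k i 1) * X 0 - C (stdZero k i 0) * X 1) ∈ p.asHomogeneousIdeal :=
    ⟨1, by
      change Ideal.Quotient.mk (Ideal.span {(stdForm k n).1}) (C 0 * X 0 - C 1 * X 1) ∈ _
      rw [e1, map_neg]
      exact p.asHomogeneousIdeal.toIdeal.neg_mem h⟩
  rcases hn with rfl | rfl
  · rw [show Ideal.Quotient.mk (Ideal.span {(stdForm k 2).1}) (stdForm k 2).1 =
      Ideal.Quotient.mk _ (X 0) * Ideal.Quotient.mk _ (X 1) from map_mul _ _ _] at h0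
    exact (hp h0).elim c0 c1
  · rw [show Ideal.Quotient.mk (Ideal.span {(stdForm k 3).1}) (stdForm k 3).1 =
      Ideal.Quotient.mk _ (X 0) * Ideal.Quotient.mk _ (X 1) *
        Ideal.Quotient.mk _ (X 0 - X 1) by rw [← map_mul, ← map_mul]; rfl] at h0
    refine (hp h0).elim (fun h => (hp h).elim c0 c1) fun h => ⟨2, ?_⟩
    change Ideal.Quotient.mk (Ideal.span {(stdForm k 3).1}) (C 1 * X 0 - C 1 * X 1) ∈ _
    rwa [e2]

/-- A homogeneous ideal is determined by its homogeneous elements, and for both primes these are the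
classes of forms vanishing at a. -/
lemma eq_of_mem_asHomogeneousIdeal {F : BinaryForm k n}
    {p q : ProjectiveSpectrum (coordGrading F)} (a : Fin 2 → k) (ha : a ≠ 0)
    (hp : Ideal.Quotient.mk (Ideal.span {F.1}) (C (a 1) * X 0 - C (a 0) * X 1) ∈
      p.asHomogeneousIdeal)
    (hq : Ideal.Quotient.mk (Ideal.span {F.1}) (C (a 1) * X 0 - C (a 0) * X 1) ∈
      q.asHomogeneousIdeal) : p = q := by
  have key (p q : ProjectiveSpectrum (coordGrading F))
    (hp : Ideal.Quotient.mk (Ideal.span {F.1}) (C (a 1) * X 0 - C (a 0) * X 1) ∈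
      p.asHomogeneousIdeal)
    (hq : Ideal.Quotient.mk (Ideal.span {F.1}) (C (a 1) * X 0 - C (a 0) * X 1) ∈
      q.asHomogeneousIdeal) : p ≤ q := by
    intro x hx
    classical
    rw [← DirectSum.sum_support_decompose (coordGrading F) x]
    refine sum_mem fun d _ => ?_
    have hd : (DirectSum.decompose (coordGrading F) x d : CoordRing F) ∈ p.asHomogeneousIdeal :=
      p.asHomogeneousIdeal.isHomogeneous d hx
    obtain ⟨f, hf, e⟩ := (DirectSum.decompose (coordGrading F) x d).2
    rw [← e] at hd ⊢
    exact (mem_asHomogeneousIdeal_iff q a ha hq hf).2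
      ((mem_asHomogeneousIdeal_iff p a ha hp hf).1 hd)
  exact le_antisymm (key p q hp hq) (key q p hq hp)

lemma finite_projForm_stdForm (hn : n = 2 ∨ n = 3) : Finite (projForm (stdForm k n)) := by
  choose i hi using exists_mem_asHomogeneousIdeal (k := k) hn
  refine Finite.of_injective (β := Fin 3) i fun p q h => ?_
  have hq := hi q
  rw [← h] at hq
  exact eq_of_mem_asHomogeneousIdeal _ (stdZero_ne_zero _) (hi p) hq

/-- If p specializes to q, then p ≤ q, so a linear factor in p also lies in q and the points
coincide. A finite T₁ space is discrete. -/
lemma discreteTopology_projForm_stdForm (hn : n = 2 ∨ n = 3) :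
    DiscreteTopology (projForm (stdForm k n)) := by
  have := finite_projForm_stdForm (k := k) hn
  have : T1Space (projForm (stdForm k n)) := by
    refine t1Space_iff_specializes_imp_eq.2 fun {p q} h => ?_
    have h' : p.asHomogeneousIdeal ≤ q.asHomogeneousIdeal :=
      (ProjectiveSpectrum.le_iff_mem_closure _ p q).2 (specializes_iff_mem_closure.1 h)
    obtain ⟨i, hi⟩ := exists_mem_asHomogeneousIdeal hn p
    exact eq_of_mem_asHomogeneousIdeal _ (stdZero_ne_zero i) hi (h' hi)
  infer_instance

end FormVariety

/-! ### Galois descent for affine schemes -/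

section Descent

open AlgebraicGeometry CategoryTheory CategoryTheory.Limits TensorProduct

variable {k : Type u} [Field k] {K : Type u} [Field K] [Algebra k K]

/-- A k-basis of A identifies A ⊗ K with finitely supported families in K on which σ acts
coordinatewise, so fixed elements have coordinates in k. -/
lemma equivFinsuppOfBasisLeft_lTensor {ι A : Type*} [DecidableEq ι] [CommRing A] [Algebra k A]
    (b : Module.Basis ι k A) (σ : K →ₗ[k] K) (z : A ⊗[k] K) (i : ι) :
    TensorProduct.equivFinsuppOfBasisLeft b (σ.lTensor A z) i =
      σ (TensorProduct.equivFinsuppOfBasisLeft b z i) := by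
  induction z with
  | zero => simp
  | add x y hx hy => simp [hx, hy]
  | tmul a c => simp [TensorProduct.equivFinsuppOfBasisLeft_apply_tmul]

/-- The elements of `A ⊗ K` fixed by the Galois group come from `A`. -/
lemma mem_range_includeLeft_of_fixed [IsGalois k K] {A : Type*} [CommRing A] [Algebra k A]
    {z : A ⊗[k] K} (h : ∀ σ : K ≃ₐ[k] K, (σ : K →ₐ[k] K).toLinearMap.lTensor A z = z) :
    ∃ a : A, a ⊗ₜ[k] (1 : K) = z := by
  classical
  let b := Module.Basis.ofVectorSpace k A
  set f := TensorProduct.equivFinsuppOfBasisLeft (N := K) b z with hf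
  have hc (i) : ∃ c : k, algebraMap k K c = f i := by
    refine (InfiniteGalois.mem_range_algebraMap_iff_fixed (f i)).2 fun σ => ?_
    have e := equivFinsuppOfBasisLeft_lTensor b (σ : K →ₐ[k] K).toLinearMap z i
    rw [h σ, ← hf] at e
    exact e.symm
  choose c hc using hc
  refine ⟨f.sum fun i _ => c i • b i, ?_⟩
  have e : z = f.sum fun i n => b i ⊗ₜ n := by
    rw [← TensorProduct.equivFinsuppOfBasisLeft_symm_apply, hf, LinearEquiv.symm_apply_apply]
  rw [e, Finsupp.sum, Finsupp.sum, TensorProduct.sum_tmul]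
  refine Finset.sum_congr rfl fun i _ => ?_
  rw [TensorProduct.smul_tmul, ← hc, Algebra.smul_def, mul_one]

lemma exists_lift_of_fixed [IsGalois k K] {A C : Type*} [CommRing A] [Algebra k A] [CommRing C]
    (γ : C →+* A ⊗[k] K)
    (h : ∀ (σ : K ≃ₐ[k] K) (c : C), (σ : K →ₐ[k] K).toLinearMap.lTensor A (γ c) = γ c) :
    ∃ δ : C →+* A, (Algebra.TensorProduct.includeLeftRingHom : A →+* A ⊗[k] K).comp δ = γ := by
  have hinj : Function.Injective (Algebra.TensorProduct.includeLeftRingHom : A →+* A ⊗[k] K) :=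
    Algebra.TensorProduct.includeLeft_injective (S := k) (algebraMap k K).injective
  have key (c : C) : γ c ∈ (Algebra.TensorProduct.includeLeftRingHom : A →+* A ⊗[k] K).range :=
    mem_range_includeLeft_of_fixed fun σ => h σ c
  let e := RingEquiv.ofLeftInverse (Function.leftInverse_invFun hinj)
  refine ⟨e.symm.toRingHom.comp (γ.codRestrict _ key), RingHom.ext fun c => ?_⟩
  exact congrArg Subtype.val (e.apply_symm_apply ⟨γ c, key c⟩)

/-- A morphism from the base change `X ×_k K` of an affine scheme to an affine scheme is defined
over `k` if it is invariant under the Galois group. -/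
lemma exists_fst_comp_eq [IsGalois k K] (X : Over (Spec (.of k))) [IsAffine X.left] {Z : Scheme.{u}}
    [IsAffine Z] (g : (geom K X).left ⟶ Z) (hg : ∀ σ : K ≃ₐ[k] K, galAct X σ ≫ g = g) :
    ∃ u : X.left ⟶ Z, pullback.fst X.hom (specMap k K) ≫ u = g := by
  let A := Γ(X.left, ⊤)
  let α : CommRingCat.of k ⟶ A := Spec.preimage (X.left.isoSpec.inv ≫ X.hom)
  let : Algebra k A := α.hom.toAlgebra
  have hα : Spec.map (CommRingCat.ofHom (algebraMap k A)) = X.left.isoSpec.inv ≫ X.hom :=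
    Spec.map_preimage _
  have P : IsPullback (pullback.fst X.hom (specMap k K) ≫ X.left.isoSpec.hom)
      (pullback.snd X.hom (specMap k K)) (Spec.map (CommRingCat.ofHom (algebraMap k A)))
      (specMap k K) := by
    refine (IsPullback.of_hasPullback X.hom (specMap k K)).of_iso (Iso.refl _) X.left.isoSpec
      (Iso.refl _) (Iso.refl _) ?_ ?_ ?_ ?_
    · simp
    · simp
    · simp [hα]
    · simp
  let φ : Spec (.of (A ⊗[k] K)) ≅ pullback X.hom (specMap k K) :=
    (pullbackSpecIso k A K).symm ≪≫ P.isoPullback.symm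
  have h1 : φ.hom ≫ pullback.fst X.hom (specMap k K) ≫ X.left.isoSpec.hom =
      Spec.map (CommRingCat.ofHom Algebra.TensorProduct.includeLeftRingHom) := by
    rw [← pullbackSpecIso_inv_fst k A K]
    simp only [φ, Iso.trans_hom, Iso.symm_hom, Category.assoc]
    congr 1
    exact P.isoPullback_inv_fst
  have h2 : φ.hom ≫ pullback.snd X.hom (specMap k K) =
      Spec.map (CommRingCat.ofHom (Algebra.TensorProduct.includeRight : K →ₐ[k] A ⊗[k] K)) := by
    rw [← pullbackSpecIso_inv_snd k A K]
    simp only [φ, Iso.trans_hom, Iso.symm_hom, Category.assoc]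
    congr 1
    exact P.isoPullback_inv_snd
  -- In affine coordinates σ_X is the spectrum of id ⊗ σ⁻¹, with the inverse built into `galSpec`.
  -- For this reason invariance is applied below to σ⁻¹.
  have hσ (σ : K ≃ₐ[k] K) : φ.hom ≫ galAct X σ = Spec.map (CommRingCat.ofHom
      (Algebra.TensorProduct.map (AlgHom.id k A) ((σ⁻¹ : K ≃ₐ[k] K) : K →ₐ[k] K) :
        A ⊗[k] K →+* A ⊗[k] K)) ≫ φ.hom := by
    refine P.hom_ext ?_ ?_
    · rw [Category.assoc, ← Category.assoc (galAct X σ), galAct_fst, h1, Category.assoc, h1,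
        ← Spec.map_comp, ← CommRingCat.ofHom_comp]
      congr 2
      exact RingHom.ext fun a => ((Algebra.TensorProduct.map_tmul (AlgHom.id k A) _ a 1).trans
        (congrArg (a ⊗ₜ[k] ·) (map_one _))).symm
    · rw [Category.assoc, galAct_snd, ← Category.assoc, h2, Category.assoc, h2, galSpec,
        ← Spec.map_comp, ← Spec.map_comp, ← CommRingCat.ofHom_comp, ← CommRingCat.ofHom_comp]
      congr 2
  let γ : Γ(Z, ⊤) ⟶ .of (A ⊗[k] K) := Spec.preimage (φ.hom ≫ g ≫ Z.isoSpec.hom)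
  have hγ : Spec.map γ = φ.hom ≫ g ≫ Z.isoSpec.hom := Spec.map_preimage _
  obtain ⟨δ, hδ⟩ := exists_lift_of_fixed γ.hom (fun σ c => by
    have e : φ.hom ≫ galAct X σ⁻¹ ≫ g ≫ Z.isoSpec.hom = φ.hom ≫ g ≫ Z.isoSpec.hom := by
      rw [← Category.assoc (galAct X _), hg]
    rw [← Category.assoc, hσ, Category.assoc, ← hγ, ← Spec.map_comp, Spec.map_inj, inv_inv] at e
    exact congrArg (fun f => f.hom c) e)
  refine ⟨X.left.isoSpec.hom ≫ Spec.map (CommRingCat.ofHom δ) ≫ Z.isoSpec.inv, ?_⟩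
  rw [← cancel_epi φ.hom, ← Category.assoc (pullback.fst _ _), ← Category.assoc, h1,
    ← Category.assoc, ← Spec.map_comp, ← CommRingCat.ofHom_comp, hδ, Iso.comp_inv_eq,
    Category.assoc, ← hγ]
  rfl

/-- An isomorphism `X ×_k K ≅ Y ×_k K` of affine schemes that is invariant under the Galois group
is defined over `k`. -/
lemma nonempty_iso_of_galIso [IsGalois k K] {X Y : Over (Spec (.of k))} [IsAffine X.left]
    [IsAffine Y.left] (θ : geom K X ≅ geom K Y) (hθ : ∀ σ : K ≃ₐ[k] K, galIso σ θ = θ) :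
    Nonempty (X ≅ Y) := by
  have hcomm (X Y : Over (Spec (.of k))) (α : geom K X ⟶ geom K Y)
      (hα : ∀ σ : K ≃ₐ[k] K, galHom σ α = α) (σ : K ≃ₐ[k] K) :
      galAct X σ ≫ α.left = α.left ≫ galAct Y σ := by
    have e := congrArg Over.Hom.left (hα σ)
    rw [galHom_left] at e
    rw [← e, ← Category.assoc, galAct_comp_inv, Category.id_comp, e]
  have key (X Y : Over (Spec (.of k))) [IsAffine X.left] [IsAffine Y.left]
      (α : geom K X ⟶ geom K Y) (hα : ∀ σ : K ≃ₐ[k] K, galHom σ α = α) :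
      ∃ u : X.left ⟶ Y.left, pullback.fst X.hom (specMap k K) ≫ u =
        α.left ≫ pullback.fst Y.hom (specMap k K) := by
    refine exists_fst_comp_eq X _ fun σ => ?_
    rw [← Category.assoc, hcomm X Y α hα, Category.assoc, galAct_fst]
  obtain ⟨u, hu⟩ := key X Y θ.hom fun σ => congrArg Iso.hom (hθ σ)
  obtain ⟨v, hv⟩ := key Y X θ.inv fun σ => congrArg Iso.inv (hθ σ)
  -- The projections X ×_k K → X are flat and surjective, hence epimorphisms, so identities between
  -- morphisms over k may be checked after composing with them.
  have eX : Epi (pullback.fst X.hom (specMap k K)) := Flat.epi_of_flat_of_surjective _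
  have eY : Epi (pullback.fst Y.hom (specMap k K)) := Flat.epi_of_flat_of_surjective _
  have i1 : θ.hom.left ≫ θ.inv.left = 𝟙 _ := congrArg Over.Hom.left θ.hom_inv_id
  have i2 : θ.inv.left ≫ θ.hom.left = 𝟙 _ := congrArg Over.Hom.left θ.inv_hom_id
  have uv : u ≫ v = 𝟙 _ := by
    rw [← cancel_epi (pullback.fst X.hom (specMap k K)), ← Category.assoc, hu, Category.assoc, hv,
      ← Category.assoc, i1]
    exact (Category.id_comp _).trans (Category.comp_id _).symm
  have vu : v ≫ u = 𝟙 _ := by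
    rw [← cancel_epi (pullback.fst Y.hom (specMap k K)), ← Category.assoc, hv, Category.assoc, hu,
      ← Category.assoc, i2]
    exact (Category.id_comp _).trans (Category.comp_id _).symm
  refine ⟨Over.isoMk ⟨u, v, uv, vu⟩ ?_⟩
  change u ≫ Y.hom = X.hom
  have w : θ.hom.left ≫ pullback.snd Y.hom (specMap k K) = pullback.snd X.hom (specMap k K) :=
    Over.w θ.hom
  rw [← cancel_epi (pullback.fst X.hom (specMap k K)), ← Category.assoc, hu, Category.assoc,
    pullback.condition, ← Category.assoc, w, pullback.condition]

/-- A `k`-scheme is affine if its base change to `K` has finitely many points and is discrete. -/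
lemma isAffine_of_geom (X : Over (Spec (.of k))) [Finite (geom K X).left]
    [DiscreteTopology (geom K X).left] : IsAffine X.left := by
  -- The projection is a topological quotient map, so finiteness and discreteness pass to X, and a
  -- finite discrete scheme is affine.
  have hq := Flat.isQuotientMap_of_surjective (pullback.fst X.hom (specMap k K))
  have : Finite ↥(pullback X.hom (specMap k K)) := inferInstanceAs (Finite (geom K X).left)
  have : DiscreteTopology ↥(pullback X.hom (specMap k K)) :=
    inferInstanceAs (DiscreteTopology (geom K X).left)
  have : Finite X.left := Finite.of_surjective _ hq.surjective
  have : DiscreteTopology X.left := discreteTopology_iff_forall_isOpen.2 fun s =>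
    hq.isOpen_preimage.1 (isOpen_discrete _)
  infer_instance

/-- If g relates the cocycles of ψ and ψ', then "ψ, then g, then ψ'⁻¹" is Galois-invariant: solving
the coboundary relation for it gives back the same composite with σ applied to each factor. Such an
isomorphism descends to k. -/
lemma isoClass_eq_of_cls_eq [IsGalois k K] {X Y Y' : Over (Spec (.of k))} [IsAffine Y.left]
    [IsAffine Y'.left] {ξ : H1 (K ≃ₐ[k] K) (GeomAut K X)} (hY : IsFormOfClass X ξ Y)
    (hY' : IsFormOfClass X ξ Y') : isoClass Y = isoClass Y' := by
  obtain ⟨-, ψ, h, hψ, hξ⟩ := hY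
  obtain ⟨-, ψ', h', hψ', hξ'⟩ := hY'
  obtain ⟨g, hg⟩ : ∃ g : GeomAut K X, ∀ σ, h'.toFun σ = g⁻¹ * h.toFun σ * σ • g :=
    Quotient.exact (s := OneCocycle.setoid) (hξ.trans hξ'.symm)
  refine Quotient.sound (s := isIsomorphicSetoid _) ?_
  let g' : geom K X ≅ geom K X := g
  refine nonempty_iso_of_galIso (ψ ≪≫ g' ≪≫ ψ'.symm) fun σ => Iso.ext ?_
  have e : ψ'.inv ≫ galHom σ ψ'.hom = g'.inv ≫ (ψ.inv ≫ galHom σ ψ.hom) ≫ galHom σ g'.hom := by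
    have := (hψ' σ).symm.trans (hg σ)
    rw [hψ σ] at this
    refine (congrArg Iso.hom this).trans ?_
    exact Category.assoc _ _ _
  have e' : galHom σ ψ'.hom ≫ galHom σ ψ'.inv = 𝟙 _ := by
    rw [← galHom_comp, ψ'.hom_inv_id, galHom_id]
  change galHom σ (ψ.hom ≫ g'.hom ≫ ψ'.inv) = ψ.hom ≫ g'.hom ≫ ψ'.inv
  rw [galHom_comp, galHom_comp]
  have e2 : galHom σ ψ.hom ≫ galHom σ g'.hom = ψ.hom ≫ g'.hom ≫ ψ'.inv ≫ galHom σ ψ'.hom := by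
    rw [e]
    simp
  rw [← Category.assoc, e2]
  simp only [Category.assoc, e', Category.comp_id]

/-- Every form in the class, in particular the chosen one, becomes finite and discrete over K and is
therefore affine, so the choice made in `formOfClass` is immaterial. -/
lemma formOfClass_eq [IsGalois k K] {X Y : Over (Spec (.of k))} [Finite (geom K X).left]
    [DiscreteTopology (geom K X).left] {ξ : H1 (K ≃ₐ[k] K) (GeomAut K X)}
    (hY : IsFormOfClass X ξ Y) : formOfClass X ξ = isoClass Y := by
  have aff (Y : Over (Spec (.of k))) (h : IsFormOfClass X ξ Y) : IsAffine Y.left := by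
    obtain ⟨-, ψ, -⟩ := h
    let e : (geom K Y).left ≃ₜ (geom K X).left :=
      Scheme.homeoOfIso ((Over.forget _).mapIso ψ)
    have : Finite (geom K Y).left := Finite.of_equiv _ e.symm.toEquiv
    have : DiscreteTopology (geom K Y).left := e.symm.discreteTopology
    exact isAffine_of_geom (K := K) Y
  have h : ∃ Y, IsFormOfClass X ξ Y := ⟨Y, hY⟩
  have := aff _ h.choose_spec
  have := aff _ hY
  rw [formOfClass, dif_pos h]
  exact isoClass_eq_of_cls_eq h.choose_spec hY

end Descent

/-! ### The cocycle of an isomorphism v ↦ v g between the schemes of two forms -/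

section Comparison

open MvPolynomial AlgebraicGeometry CategoryTheory CategoryTheory.Limits

variable {k : Type u} [Field k] {K : Type u} [Field K] [Algebra k K] {n : ℕ}

/-- As `subst` is multiplicative and Proj reverses arrows, g g' becomes "g, then g'" in diagrammatic
order, as it should for the right action v ↦ v g. -/
lemma substHom_mul_proj_of_dvd (F F' F'' : BinaryForm K n) (g g' : GL (Fin 2) K) (h1 h2 h3) :
    (substHom (g * g') F F'' h1).proj =
      (substHom g F' F'' h2).proj ≫ (substHom g' F F' h3).proj := by
  rw [← FormHom.proj_comp]
  exact congrArg FormHom.proj (FormHom.ext (congrArg AlgHom.toRingHom (subst_mul g.1 g'.1)))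

lemma substHom_toSpec_of_dvd (F F' : BinaryForm K n) (g : GL (Fin 2) K) (h) :
    (substHom g F F' h).proj ≫ projForm.toSpec F = projForm.toSpec F' := by
  have e := FormHom.proj_toSpec (substHom g F F' h) (RingHom.id K)
    (fun r => (subst g.1).commutes r)
  have e' : Spec.map (CommRingCat.ofHom (RingHom.id K)) = 𝟙 (Spec (.of K)) := Spec.map_id _
  rw [e', Category.comp_id] at e
  exact e

/-- The isomorphism `v ↦ v g` from `Proj K[v₁, v₂] / (F')` to `Proj K[v₁, v₂] / (F)`, if `F'` divides
`F(v g)` and `F` divides `F'(v g⁻¹)`. -/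
noncomputable def formVarIso (F F' : BinaryForm K n) (g : GL (Fin 2) K)
    (h : F'.1 ∣ subst g.1 F.1) (h' : F.1 ∣ subst (g⁻¹).1 F'.1) : formVar F' ≅ formVar F where
  hom := Over.homMk (substHom g F F' h).proj (substHom_toSpec_of_dvd F F' g h)
  inv := Over.homMk (substHom g⁻¹ F' F h').proj (substHom_toSpec_of_dvd F' F g⁻¹ h')
  hom_inv_id := Over.OverMorphism.ext ((substHom_mul_proj_of_dvd F' F F' g g⁻¹
    (by rw [mul_inv_cancel, Units.val_one, subst_one]; rfl) h h').symm.trans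
    (substHom_one_proj F' _ (mul_inv_cancel g) _))
  inv_hom_id := Over.OverMorphism.ext ((substHom_mul_proj_of_dvd F F' F g⁻¹ g
    (by rw [inv_mul_cancel, Units.val_one, subst_one]; rfl) h' h).symm.trans
    (substHom_one_proj F _ (inv_mul_cancel g) _))

/-- The isomorphism `v ↦ v g` from `(Proj k[v₁, v₂] / (F')) ×_k K` to
`(Proj k[v₁, v₂] / (F)) ×_k K`. -/
noncomputable def geomIso (F F' : BinaryForm k n) (g : GL (Fin 2) K)
    (h : (F'.map (algebraMap k K)).1 ∣ subst g.1 (F.map (algebraMap k K)).1)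
    (h' : (F.map (algebraMap k K)).1 ∣ subst (g⁻¹).1 (F'.map (algebraMap k K)).1) :
    geom K (formVar F') ≅ geom K (formVar F) :=
  geomFormVar K F' ≪≫ formVarIso _ _ g h h' ≪≫ (geomFormVar K F).symm

/-- On polynomials, applying σ⁻¹ to the coefficients, substituting v g and applying σ amounts to
substituting v σ(g). -/
lemma coeffHom_substHom_of_dvd (F F' : BinaryForm k n) (g : GL (Fin 2) K) (σ : K ≃ₐ[k] K) (h1 h2) :
    (coeffHom F' σ).proj ≫
      (substHom g (F.map (algebraMap k K)) (F'.map (algebraMap k K)) h2).proj ≫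
      (coeffHom F σ⁻¹).proj =
    (substHom (Matrix.GeneralLinearGroup.map (σ : K →+* K) g) (F.map (algebraMap k K))
      (F'.map (algebraMap k K)) h1).proj := by
  rw [← FormHom.proj_comp, ← FormHom.proj_comp]
  refine congrArg FormHom.proj (FormHom.ext (RingHom.ext fun p => ?_))
  change MvPolynomial.map (σ : K →+* K) (subst g.1
    (MvPolynomial.map ((σ⁻¹ : K ≃ₐ[k] K) : K →+* K) p)) = subst (g.1.map σ) p
  rw [map_subst, MvPolynomial.map_map]
  have e : ((σ : K →+* K).comp ((σ⁻¹ : K ≃ₐ[k] K) : K →+* K)) = RingHom.id K :=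
    RingHom.ext fun x => σ.apply_symm_apply x
  rw [e, MvPolynomial.map_id]
  rfl

lemma galAct_inv_geomFormVar_hom (F : BinaryForm k n) (σ : K ≃ₐ[k] K) :
    galAct (formVar F) σ⁻¹ ≫ (geomFormVar K F).hom.left =
      (geomFormVar K F).hom.left ≫ (coeffHom F σ).proj := by
  have e := geomFormVar_inv_gal F σ⁻¹
  rw [inv_inv] at e
  have i1 : (geomFormVar K F).hom.left ≫ (geomFormVar K F).inv.left = 𝟙 _ :=
    congrArg Over.Hom.left (geomFormVar K F).hom_inv_id
  have i2 : (geomFormVar K F).inv.left ≫ (geomFormVar K F).hom.left = 𝟙 _ :=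
    congrArg Over.Hom.left (geomFormVar K F).inv_hom_id
  calc galAct (formVar F) σ⁻¹ ≫ (geomFormVar K F).hom.left
      = (geomFormVar K F).hom.left ≫ ((geomFormVar K F).inv.left ≫
          galAct (formVar F) σ⁻¹) ≫ (geomFormVar K F).hom.left := by
        rw [Category.assoc, ← Category.assoc, i1, Category.id_comp]
    _ = (geomFormVar K F).hom.left ≫ (coeffHom F σ).proj ≫
          (geomFormVar K F).inv.left ≫ (geomFormVar K F).hom.left := by
        rw [e]
        exact congrArg (_ ≫ ·) (Category.assoc _ _ _)
    _ = _ := by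
        rw [i2]
        exact congrArg (_ ≫ ·) (Category.comp_id _)

/-- Both forms have coefficients in k, so `geomFormVar` turns σ_X into the action on coefficients,
and only the matrix g is changed. -/
lemma galIso_geomIso (F F' : BinaryForm k n) (g : GL (Fin 2) K) (σ : K ≃ₐ[k] K) (h1 h2 h3 h4) :
    galIso σ (geomIso F F' g h3 h4) =
      geomIso F F' (Matrix.GeneralLinearGroup.map (σ : K →+* K) g) h1 h2 := by
  refine Iso.ext (Over.OverMorphism.ext ?_)
  have key (a : (geom K (formVar F')).left ⟶ projForm (F'.map (algebraMap k K)))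
      (b : projForm (F.map (algebraMap k K)) ⟶ (geom K (formVar F)).left)
      (e1 : b ≫ galAct (formVar F) σ = (coeffHom F σ⁻¹).proj ≫ b)
      (e2 : galAct (formVar F') σ⁻¹ ≫ a = a ≫ (coeffHom F' σ).proj) :
      galAct (formVar F') σ⁻¹ ≫ (a ≫ (substHom g _ _ h3).proj ≫ b) ≫ galAct (formVar F) σ =
      a ≫ (substHom (Matrix.GeneralLinearGroup.map (σ : K →+* K) g) _ _ h1).proj ≫ b := by
    rw [Category.assoc, Category.assoc, e1, ← Category.assoc (galAct (formVar F') σ⁻¹), e2,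
      ← coeffHom_substHom_of_dvd F F' g σ h1 h3]
    simp only [Category.assoc]
  exact key _ _ (geomFormVar_inv_gal F σ) (galAct_inv_geomFormVar_hom F' σ)

/-- The inverse v ↦ v g⁻¹ followed by the conjugate v ↦ v σ(g) is v ↦ v g⁻¹ σ(g). -/
lemma formCocycle_geomIso (F F' : BinaryForm k n) (g : GL (Fin 2) K) (σ : K ≃ₐ[k] K)
    (h1 h2) (h3 h4)
    (h5 : (F'.map (algebraMap k K)).1 ∣
      subst (Matrix.GeneralLinearGroup.map (σ : K →+* K) g).1 (F.map (algebraMap k K)).1)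
    (h6 : (F.map (algebraMap k K)).1 ∣
      subst ((Matrix.GeneralLinearGroup.map (σ : K →+* K) g)⁻¹).1 (F'.map (algebraMap k K)).1) :
    formCocycle (geomIso F F' g h1 h2) σ =
      substAut F (g⁻¹ * Matrix.GeneralLinearGroup.map (σ : K →+* K) g) h3 h4 := by
  have e := galIso_geomIso F F' g σ h5 h6 h1 h2
  rw [formCocycle, e]
  refine Iso.ext ?_
  have e2 : (formVarIso _ _ g h1 h2).inv ≫ (formVarIso _ _ _ h5 h6).hom =
      (substIso (F.map (algebraMap k K)) _ h3 h4).hom :=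
    Over.OverMorphism.ext (substHom_mul_proj_of_dvd _ _ _ _ _ h3 h2 h5).symm
  change (geomIso F F' g h1 h2).inv ≫ (geomIso F F' _ h5 h6).hom = _ ≫ _ ≫ _
  rw [← e2]
  simp [geomIso]

end Comparison

/-! ### The cohomology class of Z_x and the map Φ_w -/

section Orbits

open MvPolynomial AlgebraicGeometry CategoryTheory CategoryTheory.Limits

variable {k : Type u} [Field k] {K : Type u} [Field K] [Algebra k K] {n : ℕ}
  {Q : QuaternionData k}

lemma binaryDisc_map {R S : Type*} [CommRing R] [CommRing S] (f : R →+* S)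
    (F : MvPolynomial (Fin 2) R) : binaryDisc n (MvPolynomial.map f F) = f (binaryDisc n F) := by
  match n with
  | 0 | 1 | m + 4 => simp [binaryDisc]
  | 2 | 3 =>
    simp only [binaryDisc, MvPolynomial.coeff_map, map_sub, map_add, map_mul, map_pow]
    simp only [map_ofNat]

lemma Vec.base_disc_ne_zero {x : Vec Q k n} (hx : x.disc ≠ 0) : (x.base K).disc ≠ 0 := by
  rw [Vec.disc, Vec.base, Vec.form_map, binaryDisc_map]
  exact (map_ne_zero_iff _ (algebraMap k K).injective).2 hx

lemma exists_smul_eq [IsSepClosure k K] (hn : n = 2 ∨ n = 3) {x y : Vec Q K n}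
    (hx : x.disc ≠ 0) (hy : y.disc ≠ 0) : ∃ g : Grp Q K n, g • x = y := by
  have : IsSepClosed K := IsSepClosure.sep_closed k
  obtain ⟨t, ht⟩ := exists_root (K := K) Q
  obtain ⟨g, rfl⟩ := exists_smul_stdVec_eq hn t ht hx
  obtain ⟨h, rfl⟩ := exists_smul_stdVec_eq hn t ht hy
  exact ⟨h * g⁻¹, by rw [mul_smul, inv_smul_smul]⟩

lemma orbit_base_eq_ssLocus [IsSepClosure k K] (hn : n = 2 ∨ n = 3) {w : Vec Q k n}
    (hw : w.disc ≠ 0) : MulAction.orbit (Grp Q K n) (w.base K) = ssLocus Q n K := by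
  obtain ⟨t, ht⟩ := exists_root (K := K) Q
  ext y
  refine ⟨?_, fun hy => exists_smul_eq hn (Vec.base_disc_ne_zero hw) hy⟩
  rintro ⟨g, rfl⟩
  exact disc_smul_ne_zero hn t ht g (Vec.base_disc_ne_zero hw)

lemma dvd_subst_of_smul_eq [IsSepClosure k K] (hn : n = 2 ∨ n = 3) {w x : Vec Q k n}
    {g : Grp Q K n} (hg : g • w.base K = x.base K) :
    (x.binForm.map (algebraMap k K)).1 ∣ subst g.2.1 (w.binForm.map (algebraMap k K)).1 := by
  obtain ⟨t, ht⟩ := exists_root (K := K) Q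
  have h := form_smul_dvd Q n hn t ht g (w.base K)
  rw [hg, Vec.base, Vec.base, Vec.form_map, Vec.form_map] at h
  exact h

lemma dvd_subst_inv_of_smul_eq [IsSepClosure k K] (hn : n = 2 ∨ n = 3) {w x : Vec Q k n}
    {g : Grp Q K n} (hg : g • w.base K = x.base K) :
    (w.binForm.map (algebraMap k K)).1 ∣ subst (g.2⁻¹).1 (x.binForm.map (algebraMap k K)).1 :=
  dvd_subst_of_smul_eq hn (g := g⁻¹) (by rw [← hg, inv_smul_smul])

/-- The isomorphism `v ↦ v g₂` from `Z_x ×_k K` to `Z_w ×_k K`, if `g w = x`. -/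
noncomputable def zeroSchemeIso [IsSepClosure k K] (hn : n = 2 ∨ n = 3) {w x : Vec Q k n}
    {g : Grp Q K n} (hg : g • w.base K = x.base K) :
    geom K (zeroScheme x) ≅ geom K (zeroScheme w) :=
  geomIso w.binForm x.binForm g.2 (dvd_subst_of_smul_eq hn hg) (dvd_subst_inv_of_smul_eq hn hg)

/-- The heart of the theorem: the cocycle measuring the form Z_x of Z_w is the image of the cocycle
measuring the orbit of x relative to w. -/
lemma formCocycle_zeroSchemeIso [IsSepClosure k K] (hn : n = 2 ∨ n = 3) {w x : Vec Q k n}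
    {g : Grp Q K n} (hg : g • w.base K = x.base K) (σ : K ≃ₐ[k] K)
    (hσ : g⁻¹ * σ • g ∈ Stab K w) :
    formCocycle (zeroSchemeIso hn hg) σ = cHom hn w ⟨g⁻¹ * σ • g, hσ⟩ := by
  -- Since w and x are rational, σ(g) also carries w to x, which supplies the divisibilities for the
  -- conjugate isomorphism.
  have hg' : (σ • g) • w.base K = x.base K := by rw [gal_smul_base, hg, Vec.base_gal]
  have e : (g⁻¹ * σ • g : Grp Q K n).2 =
      g.2⁻¹ * Matrix.GeneralLinearGroup.map (σ : K →+* K) g.2 := by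
    rw [Grp.mul_snd, Grp.inv_snd, Grp.gal_snd]
  have h1 := Stab.dvd hn hσ
  have h2 := Stab.dvd_inv hn hσ
  have h3 := dvd_subst_of_smul_eq hn hg'
  have h4 := dvd_subst_inv_of_smul_eq hn hg'
  have h5 := h1
  have h6 := h2
  rw [e] at h5 h6
  rw [Grp.gal_snd] at h3 h4
  exact (formCocycle_geomIso w.binForm x.binForm g.2 σ _ _ h5 h6 h3 h4).trans
    (substAut_congr e h1 h2 h5 h6).symm

lemma stdVec_binForm (hn : n = 2 ∨ n = 3) : (stdVec Q n k).binForm = stdForm k n := by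
  refine Subtype.ext ?_
  rcases hn with rfl | rfl
  · exact stdVec_form_two
  · exact stdVec_form_three

lemma stdForm_map (hn : n = 2 ∨ n = 3) :
    (stdForm k n).map (algebraMap k K) = stdForm K n := by
  refine Subtype.ext ?_
  rcases hn with rfl | rfl <;> simp [BinaryForm.map, stdForm]

/-- The point `stdVec` is rational over k for every B and has the standard binary form, so
transitivity over K compares Z_x with the standard scheme. -/
lemma nonempty_geom_zeroScheme_iso [IsSepClosure k K] (hn : n = 2 ∨ n = 3) {x : Vec Q k n}
    (hx : x.disc ≠ 0) : Nonempty (geom K (zeroScheme x) ≅ geom K (formVar (stdForm k n))) := by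
  obtain ⟨g, hg⟩ := exists_smul_eq (K := K) hn
    (Vec.base_disc_ne_zero (stdVec_disc_ne_zero (Q := Q) hn)) (Vec.base_disc_ne_zero hx)
  rw [← stdVec_binForm (Q := Q) hn]
  exact ⟨zeroSchemeIso hn hg⟩

lemma finite_and_discreteTopology_geom_zeroScheme [IsSepClosure k K] (hn : n = 2 ∨ n = 3)
    {x : Vec Q k n} (hx : x.disc ≠ 0) :
    Finite (geom K (zeroScheme x)).left ∧ DiscreteTopology (geom K (zeroScheme x)).left := by
  obtain ⟨ψ⟩ := nonempty_geom_zeroScheme_iso (K := K) hn hx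
  have θ := ψ ≪≫ geomFormVar K (stdForm k n)
  rw [stdForm_map hn] at θ
  let e : (geom K (zeroScheme x)).left ≃ₜ projForm (stdForm K n) :=
    Scheme.homeoOfIso ((Over.forget _).mapIso θ)
  have := finite_projForm_stdForm (k := K) hn
  have := discreteTopology_projForm_stdForm (k := K) hn
  exact ⟨Finite.of_equiv _ e.symm.toEquiv, e.symm.discreteTopology⟩

lemma isFormOfClass_zeroScheme [IsSepClosure k K] (hn : n = 2 ∨ n = 3) (w x : ssLocus Q n k) :
    IsFormOfClass (zeroScheme w.1) (cMap K hn w.1 (bMap K w.1 (aMap K w (ssOrbit x))))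
      (zeroScheme x.1) := by
  obtain ⟨g, hg⟩ := exists_smul_eq (K := K) hn (Vec.base_disc_ne_zero w.2)
    (Vec.base_disc_ne_zero x.2)
  have e : (aPoint K w.1 x.1).1 = g := aCoset_eq K hg
  -- The map `bMap` uses the representative `out` of the coset, so the isomorphism is built from it
  -- rather than from g; it carries w to x as well.
  have hout : (aPoint K w.1 x.1).1.out • w.1.base K = x.1.base K :=
    ((coset_eq K).1 ((Quotient.out_eq' _).trans e)).trans hg
  exact ⟨isVar_formVar _, zeroSchemeIso hn hout, OneCocycle.map (cHom hn w.1) (cHom_smul hn w.1)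
    (cobCocycle w.1 _ ((aPoint K w.1 x.1).mem _ (Quotient.out_eq' _))),
    fun σ => (formCocycle_zeroSchemeIso hn hout σ _).symm, rfl⟩

lemma Phi_ssOrbit [IsSepClosure k K] (hn : n = 2 ∨ n = 3) (w x : ssLocus Q n k) :
    Phi K hn w (ssOrbit x) = isoClass (zeroScheme x.1) := by
  have : IsGalois k K := IsSepClosure.isGalois
  obtain ⟨_, _⟩ := finite_and_discreteTopology_geom_zeroScheme (K := K) hn w.2
  exact formOfClass_eq (isFormOfClass_zeroScheme hn w x)

end Orbits

end PrehomOrbits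

theorem theorem3 {k K : Type u} [Field k] [Field K] [Algebra k K] [IsSepClosure k K]
    (Q : QuaternionData k) {n : ℕ} (hn : n = 2 ∨ n = 3) :
    (∀ w : ssLocus Q n k, MulAction.orbit (Grp Q K n) (w.1.base K) = ssLocus Q n K) ∧
    (∀ w x : ssLocus Q n k,
      Phi K hn w (ssOrbit x) = isoClass (zeroScheme x.1) ∧
      isoClass (zeroScheme x.1) ∈ formClasses k K n) ∧
    (∀ w w' : ssLocus Q n k, Phi K hn w = Phi K hn w') := by
  refine ⟨fun w => orbit_base_eq_ssLocus hn w.2, fun w x => ⟨Phi_ssOrbit hn w x, ?_⟩,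
    fun w w' => funext fun o => ?_⟩
  · exact ⟨_, ⟨isVar_formVar _, nonempty_geom_zeroScheme_iso hn x.2⟩, rfl⟩
  -- Independence of w: both sides are the class of Z_x, which does not involve the base point.
  · obtain ⟨x, rfl⟩ := Quotient.exists_rep o
    exact (Phi_ssOrbit hn w x).trans (Phi_ssOrbit hn w' x).symm
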